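/- **Setting.** Let $\phi:\mathbb{R}\to[0,+\infty]$ be a closed (lower semicontinuous) convex function with $\phi(1)=0$, whose domain $\{\phi<\infty\}$ is an interval with endpoints $a_\phi<1<b_\phi$ (finite or infinite). Assume that $\phi$ is strictly convex and differentiable on $]a_\phi,b_\phi[$, that it is essentially smooth ($\phi'(t)\to-\infty$ as $t\downarrow a_\phi$ if $a_\phi>-\infty$, and $\phi'(t)\to+\infty$ as $t\uparrow b_\phi$ if $b_\phi<+\infty$), that it has continuous derivatives up to order 4 on $]a_\phi,b_\phi[$, and that $\phi''(1)>0$. Let $\lambda$ be a $\sigma$-finite measure on a measurable space $\mathcal{X}$, let $\Theta\subseteq\mathbb{R}^d$, and let $\{P_\theta;\theta\in\Theta\}$ be an identifiable family of probability measures on $\mathcal{X}$ with densities $p_\theta=dP_\theta/d\lambda$ which have a common support $S$: for $\lambda$-a.e. $x$ and all $\theta\in\Theta$, $p_\theta(x)>0$ if and only if $x\in S$. Let $\theta_T$ be an interior point of $\Theta$, and assume that for $\lambda$-a.e. $x$ the map $\theta\mapsto p_\theta(x)$ has continuous partial derivatives up to order 3 on the interior of $\Theta$. For $\theta,\alpha\in\Theta$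 put $$f(\theta,\alpha,x)=\phi'\Big(\tfrac{p_\theta(x)}{p_\alpha(x)}\Big),\qquad g(\theta,\alpha,x)=\tfrac{p_\theta(x)}{p_\alpha(x)}\,\phi'\Big(\tfrac{p_\theta(x)}{p_\alpha(x)}\Big)-\phi\Big(\tfrac{p_\theta(x)}{p_\alpha(x)}\Big),\qquad h(\theta,\alpha,x)=\int f(\theta,\alpha,\cdot)\,dP_\theta-g(\theta,\alpha,x),$$ and assume that for all $\theta,\alpha\in\Theta$ one has $p_\theta/p_\alpha\in\,]a_\phi,b_\phi[$ $P_\theta$-a.s. and $\int|f(\theta,\alpha,\cdot)|\,dP_\theta<\infty$. Let $I_{\theta_T}=\int \frac{p'_{\theta_T}{p'_{\theta_T}}^{T}}{p_{\theta_T}}\,d\lambda$ be the Fisher information matrix, where $p'_\theta$ is the gradient in $\theta$. Let $X_1,X_2,\dots$ be i.i.d. with law $P_{\theta_T}$, and write $P_n\psi=\frac1n\sum_{i=1}^n\psi(X_i)$ for a function $\psi$ on $\mathcal{X}$. **Assumptions.** (A.5) There is a neighborhood $N$ of $\theta_T$ such that on $N\times N$ all first and second order partial derivatives (with respect to the coordinates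 of $\theta$ and $\alpha$) of $f(\theta,\alpha,x)p_\theta(x)$ are dominated by a $\lambda$-integrable function of $x$, and all third order partial derivatives of $h(\theta,\alpha,x)$ exist and are dominated by a $P_{\theta_T}$-integrable function of $x$. (A.6) The first order partial derivatives of $h$ at $(\theta_T,\theta_T)$ are $P_{\theta_T}$-square integrable, the second order ones (including mixed ones) are $P_{\theta_T}$-integrable, and $I_{\theta_T}$ is nonsingular. **Theorem (local min-max).** Assume (A.5) and (A.6), and let $B=B_n=\{\theta\in\Theta:\|\theta-\theta_T\|\le n^{-1/3}\}$. Call $(\vartheta,a)$ a *local min-max point* (for the sample size $n$) if it lies in the interior of $B\times B$ and there is a map $\alpha^*:B\to B$ such that $\alpha^*(\theta)$ maximizes $\alpha\mapsto P_nh(\theta,\alpha)$ over $B$ for every $\theta\in B$, $\vartheta$ minimizes $\theta\mapsto P_nh(\theta,\alpha^*(\theta))$ over $B$, and $a=\alpha^*(\vartheta)$. (a) With probability one, for all sufficiently large $n$, the function $(\theta,\alpha)\mapsto P_nh(\theta,\alpha)$ has a local min-max point, and every local min-max point $(\vartheta,a)$ solves both score equations $$P_n\frac{\partial}{\partial\alpha}h(\vartheta,a)=0\quad\text{and}\quad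 P_n\frac{\partial}{\partial\theta}h(\vartheta,a)=0 .$$ (b) There are random vectors $\widetilde\theta_{n}$, $\widetilde\alpha_{n}$ such that, with probability one, $(\widetilde\theta_{n},\widetilde\alpha_{n})$ is a local min-max point for all sufficiently large $n$. For every such sequence of random vectors, both $\sqrt n(\widetilde\theta_n-\theta_T)$ and $\sqrt n(\widetilde\alpha_n-\theta_T)$ converge in distribution to the centered normal law on $\mathbb{R}^d$ with covariance matrix $I_{\theta_T}^{-1}$. -/

import Mathlib

open Set Filter Topology MeasureTheory ProbabilityTheory
open scoped NNReal ENNReal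

noncomputable section

namespace PhiDivergence

/-! ### The convex function -/

/-- The interior `]a_φ, b_φ[` of the domain of `φ : ℝ → [0, ∞]`. -/
def intDom (φ : ℝ → ℝ≥0∞) : Set ℝ := interior {t | φ t ≠ ∞}

/-- The real-valued version of `φ`; only its values on the domain of `φ` matter. -/
def realPhi (φ : ℝ → ℝ≥0∞) (t : ℝ) : ℝ := (φ t).toReal

/-- The derivative `φ'`; only its values on `intDom φ` matter. -/
def dPhi (φ : ℝ → ℝ≥0∞) : ℝ → ℝ := deriv (realPhi φ)

/-- `φ : ℝ → [0, ∞]` is a closed convex function with `φ 1 = 0`, whose domain has endpoints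
`a_φ < 1 < b_φ`, and which is strictly convex and essentially smooth. -/
structure IsDivergenceFunction (φ : ℝ → ℝ≥0∞) : Prop where
  convex : ConvexOn ℝ≥0 univ φ
  closed : LowerSemicontinuous φ
  map_one : φ 1 = 0
  one_mem : (1 : ℝ) ∈ intDom φ
  strictConvex : StrictConvexOn ℝ (intDom φ) (realPhi φ)
  differentiable : DifferentiableOn ℝ (realPhi φ) (intDom φ)
  /-- `φ'(t) → -∞` as `t ↓ a_φ`, if `a_φ` is finite. -/
  steep_left : ∀ a : ℝ, IsGLB (intDom φ) a → Tendsto (dPhi φ) (𝓝[>] a) atBot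
  /-- `φ'(t) → +∞` as `t ↑ b_φ`, if `b_φ` is finite. -/
  steep_right : ∀ b : ℝ, IsLUB (intDom φ) b → Tendsto (dPhi φ) (𝓝[<] b) atTop

/-! ### The parametric model -/

variable {d : ℕ} {𝒳 : Type*} [MeasurableSpace 𝒳]

/-- The measure `P_θ = p_θ · lam`. -/
def modelMeasure (lam : Measure 𝒳) (p : EuclideanSpace ℝ (Fin d) → 𝒳 → ℝ)
    (θ : EuclideanSpace ℝ (Fin d)) : Measure 𝒳 :=
  lam.withDensity (fun x => ENNReal.ofReal (p θ x))

/-- `(p_θ)_{θ ∈ Θ}` are the `lam`-densities of an identifiable model of probability measures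
with common support. -/
structure IsParametricModel (lam : Measure 𝒳) (Θ : Set (EuclideanSpace ℝ (Fin d)))
    (p : EuclideanSpace ℝ (Fin d) → 𝒳 → ℝ) : Prop where
  measurable : ∀ θ ∈ Θ, Measurable (p θ)
  nonneg : ∀ θ ∈ Θ, ∀ x, 0 ≤ p θ x
  isProbabilityMeasure : ∀ θ ∈ Θ, IsProbabilityMeasure (modelMeasure lam p θ)
  support : ∃ S : Set 𝒳, ∀ᵐ x ∂lam, ∀ θ ∈ Θ, 0 < p θ x ↔ x ∈ S
  identifiable : ∀ θ ∈ Θ, ∀ θ' ∈ Θ, modelMeasure lam p θ = modelMeasure lam p θ' → θ = θ'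

/-- `f(θ, α, x) = φ'(p_θ(x) / p_α(x))`. -/
def fFun (φ : ℝ → ℝ≥0∞) (p : EuclideanSpace ℝ (Fin d) → 𝒳 → ℝ)
    (θ α : EuclideanSpace ℝ (Fin d)) (x : 𝒳) : ℝ :=
  dPhi φ (p θ x / p α x)

/-- `g(θ, α, x) = (p_θ(x) / p_α(x)) φ'(p_θ(x) / p_α(x)) - φ(p_θ(x) / p_α(x))`. -/
def gFun (φ : ℝ → ℝ≥0∞) (p : EuclideanSpace ℝ (Fin d) → 𝒳 → ℝ)
    (θ α : EuclideanSpace ℝ (Fin d)) (x : 𝒳) : ℝ :=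
  p θ x / p α x * dPhi φ (p θ x / p α x) - realPhi φ (p θ x / p α x)

/-- `h(θ, α, x) = P_θ f(θ, α) - g(θ, α, x)`. -/
def hFun (lam : Measure 𝒳) (φ : ℝ → ℝ≥0∞) (p : EuclideanSpace ℝ (Fin d) → 𝒳 → ℝ)
    (θ α : EuclideanSpace ℝ (Fin d)) (x : 𝒳) : ℝ :=
  (∫ y, fFun φ p θ α y ∂(modelMeasure lam p θ)) - gFun φ p θ α x

/-- `φ'(p_θ / p_α)` is defined, finite and integrable under `P_θ`, for all `θ, α ∈ Θ`. -/
def IntegrabilityCondition (lam : Measure 𝒳) (φ : ℝ → ℝ≥0∞)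
    (Θ : Set (EuclideanSpace ℝ (Fin d))) (p : EuclideanSpace ℝ (Fin d) → 𝒳 → ℝ) : Prop :=
  ∀ θ ∈ Θ, ∀ α ∈ Θ,
    (∀ᵐ x ∂(modelMeasure lam p θ), p θ x / p α x ∈ intDom φ) ∧
      Integrable (fFun φ p θ α) (modelMeasure lam p θ)

/-- The Fisher information matrix `∫ p'_θ p'_θᵀ / p_θ d lam`. -/
def fisherInfo (lam : Measure 𝒳) (p : EuclideanSpace ℝ (Fin d) → 𝒳 → ℝ)
    (θ : EuclideanSpace ℝ (Fin d)) : Matrix (Fin d) (Fin d) ℝ :=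
  Matrix.of fun i j =>
    ∫ x, lineDeriv ℝ (fun ϑ => p ϑ x) θ (EuclideanSpace.single i 1) *
      lineDeriv ℝ (fun ϑ => p ϑ x) θ (EuclideanSpace.single j 1) / p θ x ∂lam

/-! ### Partial derivatives with respect to `(θ, α)` -/

/-- The coordinate directions of `ℝᵈ × ℝᵈ`: `inl i` stands for `θ_i` and `inr i` for `α_i`. -/
def dir : Fin d ⊕ Fin d → EuclideanSpace ℝ (Fin d) × EuclideanSpace ℝ (Fin d)
  | Sum.inl i => (EuclideanSpace.single i 1, 0)
  | Sum.inr i => (0, EuclideanSpace.single i 1)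

/-- The partial derivative in the coordinate `i` of a function of `(θ, α)`. -/
def partialD (i : Fin d ⊕ Fin d)
    (F : EuclideanSpace ℝ (Fin d) × EuclideanSpace ℝ (Fin d) → ℝ) :
    EuclideanSpace ℝ (Fin d) × EuclideanSpace ℝ (Fin d) → ℝ :=
  fun z => lineDeriv ℝ F z (dir i)

/-- `(θ, α) ↦ f(θ, α, x) p_θ(x)`. -/
def fpAt (φ : ℝ → ℝ≥0∞) (p : EuclideanSpace ℝ (Fin d) → 𝒳 → ℝ) (x : 𝒳) :
    EuclideanSpace ℝ (Fin d) × EuclideanSpace ℝ (Fin d) → ℝ :=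
  fun z => fFun φ p z.1 z.2 x * p z.1 x

/-- `(θ, α) ↦ h(θ, α, x)`. -/
def hAt (lam : Measure 𝒳) (φ : ℝ → ℝ≥0∞) (p : EuclideanSpace ℝ (Fin d) → 𝒳 → ℝ) (x : 𝒳) :
    EuclideanSpace ℝ (Fin d) × EuclideanSpace ℝ (Fin d) → ℝ :=
  fun z => hFun lam φ p z.1 z.2 x

/-- On `N × N`, for some neighbourhood `N` of `θT`, the first and second order partial derivatives
of `f(θ, α, x) p_θ(x)` are dominated by a `lam`-integrable function, and the third order partial
derivatives of `h(θ, α, x)` exist and are dominated by a `P_θT`-integrable function. -/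
def DominationCondition (lam : Measure 𝒳) (φ : ℝ → ℝ≥0∞) (Θ : Set (EuclideanSpace ℝ (Fin d)))
    (p : EuclideanSpace ℝ (Fin d) → 𝒳 → ℝ) (θT : EuclideanSpace ℝ (Fin d)) : Prop :=
  ∃ N : Set (EuclideanSpace ℝ (Fin d)), IsOpen N ∧ θT ∈ N ∧ N ⊆ Θ ∧
    (∃ L : 𝒳 → ℝ, Integrable L lam ∧ ∀ᵐ x ∂lam, ∀ z ∈ N ×ˢ N,
      (∀ i, |partialD i (fpAt φ p x) z| ≤ L x) ∧
      (∀ i j, |partialD j (partialD i (fpAt φ p x)) z| ≤ L x)) ∧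
    (∃ K : 𝒳 → ℝ, Integrable K (modelMeasure lam p θT) ∧
      ∀ᵐ x ∂(modelMeasure lam p θT), ∀ z ∈ N ×ˢ N, ∀ i j k,
        LineDifferentiableAt ℝ (partialD j (partialD i (hAt lam φ p x))) z (dir k) ∧
        |partialD k (partialD j (partialD i (hAt lam φ p x))) z| ≤ K x)

/-- At `(θT, θT)` the first order partial derivatives of `h` are square integrable and the second
order ones are integrable under `P_θT`, and the Fisher information matrix is nonsingular. -/
def MomentCondition (lam : Measure 𝒳) (φ : ℝ → ℝ≥0∞)
    (p : EuclideanSpace ℝ (Fin d) → 𝒳 → ℝ) (θT : EuclideanSpace ℝ (Fin d)) : Prop :=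
  (∀ i, MemLp (fun x => partialD i (hAt lam φ p x) (θT, θT)) 2 (modelMeasure lam p θT)) ∧
  (∀ i j, Integrable (fun x => partialD j (partialD i (hAt lam φ p x)) (θT, θT))
    (modelMeasure lam p θT)) ∧
  IsUnit (fisherInfo lam p θT).det

/-! ### Empirical measure and local min-max points -/

/-- `P_n f`, the mean of `f` under the empirical measure of the first `n` observations. -/
def empMean (X : ℕ → 𝒳) (n : ℕ) (f : 𝒳 → ℝ) : ℝ :=
  (n : ℝ)⁻¹ * ∑ i ∈ Finset.range n, f (X i)

/-- The ball `{θ ∈ Θ : ‖θ - θT‖ ≤ n^{-1/3}}`. -/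
def ballB (Θ : Set (EuclideanSpace ℝ (Fin d))) (θT : EuclideanSpace ℝ (Fin d)) (n : ℕ) :
    Set (EuclideanSpace ℝ (Fin d)) :=
  {θ | θ ∈ Θ ∧ ‖θ - θT‖ ≤ (n : ℝ) ^ (-(1 / 3) : ℝ)}

/-- `F` attains its min-max value `min_{θ ∈ B} max_{α ∈ B} F θ α` at `(ϑ, a)`: there is a selection
`θ ↦ A θ` of maximizers over `B` of `F θ ·` such that `ϑ` minimizes `θ ↦ F θ (A θ)` over `B`, and
`a = A ϑ`. -/
def IsMinMaxOn {E : Type*} (F : E → E → ℝ) (B : Set E) (ϑ a : E) : Prop :=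
  ∃ A : E → E, (∀ θ ∈ B, A θ ∈ B ∧ IsMaxOn (F θ) B (A θ)) ∧
    ϑ ∈ B ∧ IsMinOn (fun θ => F θ (A θ)) B ϑ ∧ a = A ϑ

/-- `(ϑ, a)` is a min-max point of `(θ, α) ↦ P_n h(θ, α)` on `B × B` which lies in the interior of
`B × B`. -/
def IsLocalMinMax (lam : Measure 𝒳) (φ : ℝ → ℝ≥0∞) (Θ : Set (EuclideanSpace ℝ (Fin d)))
    (p : EuclideanSpace ℝ (Fin d) → 𝒳 → ℝ) (θT : EuclideanSpace ℝ (Fin d))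
    (X : ℕ → 𝒳) (n : ℕ) (ϑ a : EuclideanSpace ℝ (Fin d)) : Prop :=
  (ϑ, a) ∈ interior (ballB Θ θT n ×ˢ ballB Θ θT n) ∧
    IsMinMaxOn (fun θ α => empMean X n (hFun lam φ p θ α)) (ballB Θ θT n) ϑ a

/-- The score equations `P_n (∂/∂θ) h(ϑ, a) = 0` and `P_n (∂/∂α) h(ϑ, a) = 0`. -/
def SolvesScores (lam : Measure 𝒳) (φ : ℝ → ℝ≥0∞) (p : EuclideanSpace ℝ (Fin d) → 𝒳 → ℝ)
    (X : ℕ → 𝒳) (n : ℕ) (ϑ a : EuclideanSpace ℝ (Fin d)) : Prop :=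
  (∀ i, empMean X n (fun x => partialD (Sum.inl i) (hAt lam φ p x) (ϑ, a)) = 0) ∧
  (∀ i, empMean X n (fun x => partialD (Sum.inr i) (hAt lam φ p x) (ϑ, a)) = 0)

end PhiDivergence

end

/-! Near `(θT, θT)` the empirical contrast `P_n h` is almost a quadratic saddle. Write `c = φ''(1)`,
`s` for the score and `I` for the Fisher information. The gradient of `h` at `(θT, θT)` is `(-c s, c
s)`, and its Hessian there has mean `diag (c I, -c I)`. The bound on third derivatives and the
strong law keep the Hessian of `P_n h` uniformly close to this matrix on the ball of radius
`n^(-1/3)`. The gradient at the centre is almost surely `o(n^(-1/3))`, a rate that comes from L²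
martingale convergence and Kronecker's lemma (`ae_tendsto_rpow_mul_mean`).

These facts are packed into `NearSaddle`, from which existence and uniqueness follow
deterministically. The simplified Newton map contracts the ball, and its fixed point is a zero `(ϑ,
a)` of the gradient in the open ball (`exists_tendsto_iterate`). Coercivity gives `F (ϑ, α) < F (ϑ,
a) < F (θ, a)` for `α ≠ a` and `θ ≠ ϑ`, so the zero is a min-max point, and the only one whatever
selection of maximizers is used (`isMinMaxOn`, `eq_of_isMinMaxOn`). Hence every min-max point solves
the scores, and limits of Newton iterates provide a measurable choice. One Newton step from the
centre shows that `ϑ - θT` and `a - θT` both equal `I⁻¹ P_n s` up to an error `o(‖P_n s‖)`. Scaled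
by `√n`, the error vanishes in probability, and the central limit theorem with Slutsky's lemma
concludes.

It remains to see that the model yields such a contrast
(`exists_regularContrast_of_isParametricModel`), where two points are delicate. First, the ratios
`p_θ / p_α` must lie in the interior of the domain of `φ` for all `θ, α` near `θT` at once, off a
single null set. The bound on the derivatives of `φ'(p_θ / p_α) p_θ` keeps `φ'` bounded along a
segment starting on the diagonal, and essential smoothness then keeps the ratio from leaving the
domain (`ratio_mem_intDom`). Second, the mean Hessian comes from a pointwise identity between second
derivatives of `f p_θ` and of `g` in which the second derivatives of the density disappear
(`partialD_partialD_sub`), so no integral of `p''` is needed. -/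

noncomputable section

namespace PhiDivergence

/-! ### Limit theorems for independent identically distributed variables -/

/-- **Kronecker's lemma.** -/
lemma tendsto_sum_div_of_tendsto_sum_div {x b : ℕ → ℝ} (hb : Monotone b) (hb0 : ∀ n, 0 < b n)
    (hb_top : Tendsto b atTop atTop) {l : ℝ}
    (hx : Tendsto (fun n => ∑ k ∈ Finset.range n, x k / b k) atTop (𝓝 l)) :
    Tendsto (fun n => (∑ k ∈ Finset.range n, x k) / b n) atTop (𝓝 0) := by
  set M : ℕ → ℝ := fun n => ∑ k ∈ Finset.range n, x k / b k with hM
  -- Summation by parts, centred at the limit `l`. After division by `b n` the last sum is a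
  -- weighted average of the null sequence `M (k + 1) - l`, and the other two terms clearly vanish.
  have hparts : ∀ n, ∑ k ∈ Finset.range n, x k =
      b n * (M n - l) + b 0 * l - ∑ k ∈ Finset.range n, (b (k + 1) - b k) * (M (k + 1) - l) := by
    intro n
    induction n with
    | zero => simp [hM]
    | succ n ih =>
      rw [Finset.sum_range_succ, Finset.sum_range_succ, ih]
      have : M (n + 1) = M n + x n / b n := Finset.sum_range_succ _ _
      have h2 : x n = b n * (M (n + 1) - M n) := by
        rw [this]; field_simp [(hb0 n).ne']; ring
      rw [h2]; ring
  have hsum : ∀ n, ∑ i ∈ Finset.range n, (b (i + 1) - b i) = b n - b 0 :=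
    fun n => Finset.sum_range_sub _ n
  have hN : Tendsto (fun n => M (n + 1) - l) atTop (𝓝 0) := by
    simpa using ((tendsto_add_atTop_iff_nat 1).2 hx).sub_const l
  have ho : (fun n => (b (n + 1) - b n) * (M (n + 1) - l)) =o[atTop]
      fun n => b (n + 1) - b n := by
    have := (Asymptotics.isBigO_refl (fun n => b (n + 1) - b n) atTop).mul_isLittleO
      ((Asymptotics.isLittleO_one_iff ℝ).2 hN)
    simpa using this
  have ho' := ho.sum_range (fun n => sub_nonneg.2 (hb n.le_succ)) (by
    simp_rw [hsum]; exact tendsto_atTop_add_const_right _ _ hb_top)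
  simp_rw [hsum] at ho'
  have hO : (fun n => b n - b 0) =O[atTop] b := by
    refine Asymptotics.IsBigO.of_bound 1 (Eventually.of_forall fun n => ?_)
    rw [Real.norm_of_nonneg (sub_nonneg.2 (hb n.zero_le)), Real.norm_of_nonneg (hb0 n).le]
    linarith [hb0 0]
  have h3 := (ho'.trans_isBigO hO).tendsto_div_nhds_zero
  have h1 : Tendsto (fun n => M n - l) atTop (𝓝 0) := by simpa using hx.sub_const l
  have h2 : Tendsto (fun n => b 0 * l / b n) atTop (𝓝 0) := hb_top.const_div_atTop _
  have := (h1.add h2).sub h3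
  simp only [add_zero, sub_zero] at this
  refine this.congr fun n => ?_
  rw [hparts n]
  field_simp [(hb0 n).ne']

variable {Ω : Type*} [MeasurableSpace Ω] {Pr : Measure Ω} [IsProbabilityMeasure Pr]

/-- A weighted sum `∑ a k * Y k` of independent centered variables with bounded variances converges
almost surely as soon as `∑ (a k) ^ 2` does. -/
lemma ae_exists_tendsto_sum_mul {Y : ℕ → Ω → ℝ} (hY : ∀ k, Measurable (Y k))
    (hindep : iIndepFun Y Pr) (hL2 : ∀ k, MemLp (Y k) 2 Pr) (hmean : ∀ k, ∫ ω, Y k ω ∂Pr = 0)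
    {v : ℝ} (hvar : ∀ k, Var[Y k; Pr] ≤ v) {a : ℕ → ℝ} (ha : Summable fun k => a k ^ 2) :
    ∀ᵐ ω ∂Pr, ∃ l, Tendsto (fun n => ∑ k ∈ Finset.range n, a k * Y k ω) atTop (𝓝 l) := by
  set ℱ := Filtration.natural Y (fun k => (hY k).stronglyMeasurable) with hℱ
  -- The range ends at `n + 1` so that `Z n` involves exactly `Y 0, …, Y n` and is adapted to the
  -- natural filtration.
  set Z : ℕ → Ω → ℝ := fun n ω => ∑ k ∈ Finset.range (n + 1), a k * Y k ω with hZ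
  have hYint : ∀ k, Integrable (Y k) Pr := fun k => (hL2 k).integrable (by norm_num)
  have hadY : StronglyAdapted ℱ Y := Filtration.stronglyAdapted_natural _
  have hZad : StronglyAdapted ℱ Z := by
    intro n
    refine Finset.stronglyMeasurable_fun_sum _ fun k hk => ?_
    exact ((hadY k).mono (ℱ.mono (Nat.lt_succ_iff.1 (Finset.mem_range.1 hk)))).const_mul _
  have hZint : ∀ n, Integrable (Z n) Pr := fun n =>
    integrable_finsetSum _ fun k _ => (hYint k).const_mul _
  have hmart : Martingale Z ℱ Pr := by
    refine martingale_nat hZad hZint fun n => ?_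
    have hsucc : Z (n + 1) = Z n + a (n + 1) • Y (n + 1) := by
      ext ω; simp [hZ, Finset.sum_range_succ]
    rw [hsucc]
    have h1 := condExp_add (hZint n) ((hYint (n + 1)).smul (a (n + 1))) (ℱ n)
    have h2 := condExp_smul (μ := Pr) (a (n + 1)) (Y (n + 1)) (ℱ n)
    have h3 := hindep.condExp_natural_ae_eq_of_lt (fun k => (hY k).stronglyMeasurable)
      (Nat.lt_succ_self n)
    rw [condExp_of_stronglyMeasurable (ℱ.le n) (hZad n) (hZint n)] at h1
    filter_upwards [h1, h2, h3] with ω e1 e2 e3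
    rw [e1, Pi.add_apply, e2, Pi.smul_apply, e3, hmean]
    simp
  have hterm : ∀ k, MemLp (fun ω => a k * Y k ω) 2 Pr := fun k => (hL2 k).const_mul _
  have hZ2 : ∀ n, MemLp (Z n) 2 Pr := fun n => memLp_finsetSum _ fun k _ => hterm k
  have hv0 : 0 ≤ v := (variance_nonneg _ _).trans (hvar 0)
  have hbound : ∀ n, ∫ ω, (Z n ω) ^ 2 ∂Pr ≤ v * ∑' k, a k ^ 2 := by
    intro n
    have hZm : ∫ ω, Z n ω ∂Pr = 0 := by
      simp only [hZ]
      rw [integral_finsetSum _ fun k _ => (hYint k).const_mul _]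
      simp [integral_const_mul, hmean]
    have : ∫ ω, (Z n ω) ^ 2 ∂Pr = Var[Z n; Pr] := by
      rw [variance_eq_sub (hZ2 n), hZm]; simp
    rw [this]
    have hsum : Z n = ∑ k ∈ Finset.range (n + 1), fun ω => a k * Y k ω := by
      ext ω; simp [hZ]
    rw [hsum, IndepFun.variance_sum (fun k _ => hterm k)]
    · calc ∑ k ∈ Finset.range (n + 1), Var[fun ω => a k * Y k ω; Pr]
          ≤ ∑ k ∈ Finset.range (n + 1), v * a k ^ 2 := by
            refine Finset.sum_le_sum fun k _ => ?_
            rw [variance_const_mul, mul_comm v]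
            exact mul_le_mul_of_nonneg_left (hvar k) (sq_nonneg _)
        _ = v * ∑ k ∈ Finset.range (n + 1), a k ^ 2 := by rw [Finset.mul_sum]
        _ ≤ v * ∑' k, a k ^ 2 := by
            gcongr
            exact ha.sum_le_tsum _ fun k _ => sq_nonneg _
    · intro i _ j _ hij
      exact (hindep.indepFun hij).comp (measurable_const_mul (a i)) (measurable_const_mul (a j))
  -- The martingale convergence theorem asks for an L¹ bound; `|z| ≤ 1 + z ^ 2` extracts it from the
  -- bound on second moments.
  have hL1 : ∀ n, eLpNorm (Z n) 1 Pr ≤ ((1 + v * ∑' k, a k ^ 2).toNNReal : ℝ≥0∞) := by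
    intro n
    rw [eLpNorm_one_eq_lintegral_enorm, ← ofReal_integral_norm_eq_lintegral_enorm (hZint n)]
    refine ENNReal.ofReal_le_ofReal ?_
    calc ∫ ω, ‖Z n ω‖ ∂Pr ≤ ∫ ω, (1 + (Z n ω) ^ 2) ∂Pr := by
          refine integral_mono (hZint n).norm ((integrable_const _).add (hZ2 n).integrable_sq) ?_
          intro ω
          simp only [Real.norm_eq_abs]
          nlinarith [sq_abs (Z n ω), sq_nonneg (|Z n ω| - 1), abs_nonneg (Z n ω)]
      _ = 1 + ∫ ω, (Z n ω) ^ 2 ∂Pr := by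
          rw [integral_add (integrable_const _) (hZ2 n).integrable_sq]; simp
      _ ≤ _ := by linarith [hbound n]
  filter_upwards [hmart.submartingale.exists_ae_tendsto_of_bdd hL1] with ω hω
  obtain ⟨l, hl⟩ := hω
  exact ⟨l, (tendsto_add_atTop_iff_nat 1).1 hl⟩

/-- A law of large numbers with rate: the mean of the first `n` of a sequence of i.i.d. centered
square integrable variables is almost surely `o(n ^ (-1/3))`. -/
lemma ae_tendsto_rpow_mul_mean {Y : ℕ → Ω → ℝ} (hY : ∀ k, Measurable (Y k))
    (hindep : iIndepFun Y Pr) (hident : ∀ k, IdentDistrib (Y k) (Y 0) Pr Pr)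
    (hL2 : MemLp (Y 0) 2 Pr) (hmean : ∫ ω, Y 0 ω ∂Pr = 0) :
    ∀ᵐ ω ∂Pr, Tendsto
      (fun n : ℕ => (n : ℝ) ^ (1 / 3 : ℝ) * ((n : ℝ)⁻¹ * ∑ k ∈ Finset.range n, Y k ω))
      atTop (𝓝 0) := by
  -- The exponent `2/3` is dictated by `n^(1/3) * n⁻¹ = n^(-2/3)`, and it is admissible because `∑
  -- k^(-4/3)` converges.
  set b : ℕ → ℝ := fun k => ((k : ℝ) + 1) ^ (2 / 3 : ℝ) with hb
  have hb0 : ∀ n, 0 < b n := fun n => by positivity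
  have hsumm : Summable fun k => (b k)⁻¹ ^ 2 := by
    have h := (Real.summable_one_div_nat_rpow (p := 4 / 3)).2 (by norm_num)
    have h' := (summable_nat_add_iff 1).2 h
    refine h'.congr fun k => ?_
    simp only [hb, one_div, Nat.cast_add, Nat.cast_one]
    rw [inv_pow, ← Real.rpow_natCast, ← Real.rpow_mul (by positivity)]
    norm_num
  have hmono : Monotone b := fun m n h => by
    apply Real.rpow_le_rpow (by positivity) _ (by norm_num)
    have : (m : ℝ) ≤ n := by exact_mod_cast h
    linarith
  have htop : Tendsto b atTop atTop :=
    (tendsto_rpow_atTop (by norm_num : (0 : ℝ) < 2 / 3)).comp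
      (tendsto_atTop_add_const_right _ _ tendsto_natCast_atTop_atTop)
  have hconv := ae_exists_tendsto_sum_mul hY hindep (fun k => (hident k).memLp_iff.2 hL2)
    (fun k => (hident k).integral_eq.trans hmean) (v := Var[Y 0; Pr])
    (fun k => (hident k).variance_eq.le) hsumm
  filter_upwards [hconv] with ω hω
  obtain ⟨l, hl⟩ := hω
  have h1 := tendsto_sum_div_of_tendsto_sum_div hmono hb0 htop (x := fun k => Y k ω) (l := l)
    (hl.congr fun n => Finset.sum_congr rfl fun k _ => by rw [div_eq_inv_mul])
  have h2 : Tendsto (fun n : ℕ => b n / (n : ℝ) ^ (2 / 3 : ℝ)) atTop (𝓝 1) := by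
    have h3 : Tendsto (fun n : ℕ => (1 + 1 / (n : ℝ)) ^ (2 / 3 : ℝ)) atTop (𝓝 1) := by
      have h4 : Tendsto (fun n : ℕ => 1 + 1 / (n : ℝ)) atTop (𝓝 1) := by
        simpa using tendsto_one_div_atTop_nhds_zero_nat.const_add (1 : ℝ)
      simpa using h4.rpow_const (p := 2 / 3) (Or.inl one_ne_zero)
    refine h3.congr' ?_
    filter_upwards [eventually_gt_atTop 0] with n hn
    have hn' : (0 : ℝ) < n := by exact_mod_cast hn
    rw [hb, ← Real.div_rpow (by positivity) hn'.le]
    congr 1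
    field_simp
  have h5 := h1.mul h2
  rw [zero_mul] at h5
  refine h5.congr' ?_
  filter_upwards [eventually_gt_atTop 0] with n hn
  have hn' : (0 : ℝ) < n := by exact_mod_cast hn
  have h6 : (n : ℝ) ^ (1 / 3 : ℝ) * (n : ℝ)⁻¹ = ((n : ℝ) ^ (2 / 3 : ℝ))⁻¹ := by
    rw [← Real.rpow_neg_one, ← Real.rpow_add hn', ← Real.rpow_neg hn'.le]
    norm_num
  rw [← mul_assoc, h6]
  field_simp [(hb0 n).ne']

/-- If `E |Y n| ^ 2` is bounded and `ε n → 0` almost surely, then `ε n * |Y n| → 0` in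
probability. -/
lemma tendstoInMeasure_mul_norm {F : Type*} [NormedAddCommGroup F] {Y : ℕ → Ω → F}
    {ε : ℕ → Ω → ℝ} {C : ℝ} (hY : ∀ n, Integrable (fun ω => ‖Y n ω‖ ^ 2) Pr)
    (hC : ∀ n, ∫ ω, ‖Y n ω‖ ^ 2 ∂Pr ≤ C) (hε : ∀ n, AEMeasurable (ε n) Pr)
    (hlim : ∀ᵐ ω ∂Pr, Tendsto (fun n => ε n ω) atTop (𝓝 0)) :
    TendstoInMeasure Pr (fun n ω => ε n ω * ‖Y n ω‖) atTop 0 := by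
  have hε0 : TendstoInMeasure Pr ε atTop 0 :=
    tendstoInMeasure_of_tendsto_ae (fun n => (hε n).aestronglyMeasurable) hlim
  rw [tendstoInMeasure_iff_measureReal_norm] at hε0 ⊢
  intro δ hδ
  have hC0 : 0 ≤ C := (integral_nonneg fun ω => sq_nonneg _).trans (hC 0)
  refine (Metric.tendsto_atTop).2 fun γ hγ => ?_
  -- If the product reaches `δ`, then `|ε n| ≥ η` or `‖Y n‖ ≥ δ / η`. By Markov's inequality the
  -- second event has probability at most `C * (η / δ) ^ 2`, and `η` is chosen to make this small.
  obtain ⟨η, hη, hηγ⟩ : ∃ η : ℝ, 0 < η ∧ C * (η / δ) ^ 2 < γ / 2 := by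
    have : Tendsto (fun η : ℝ => C * (η / δ) ^ 2) (𝓝[>] 0) (𝓝 0) := by
      have : Continuous fun η : ℝ => C * (η / δ) ^ 2 := by fun_prop
      simpa using (this.tendsto 0).mono_left nhdsWithin_le_nhds
    obtain ⟨η, h1, h2⟩ := ((this.eventually (gt_mem_nhds (half_pos hγ))).and
      self_mem_nhdsWithin).exists
    exact ⟨η, h2, h1⟩
  obtain ⟨N, hN⟩ := (Metric.tendsto_atTop.1 (hε0 η hη)) (γ / 2) (half_pos hγ)
  refine ⟨N, fun n hn => ?_⟩
  have h1 := hN n hn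
  rw [Real.dist_eq, sub_zero, abs_of_nonneg measureReal_nonneg] at h1 ⊢
  have hmarkov : Pr.real {ω | (δ / η) ^ 2 ≤ ‖Y n ω‖ ^ 2} ≤ C * (η / δ) ^ 2 := by
    have := mul_meas_ge_le_integral_of_nonneg (Eventually.of_forall fun ω => sq_nonneg ‖Y n ω‖)
      (hY n) ((δ / η) ^ 2)
    have h3 : Pr.real {ω | (δ / η) ^ 2 ≤ ‖Y n ω‖ ^ 2} =
        (η / δ) ^ 2 * ((δ / η) ^ 2 * Pr.real {ω | (δ / η) ^ 2 ≤ ‖Y n ω‖ ^ 2}) := by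
      field_simp
    rw [h3, mul_comm C]
    exact mul_le_mul_of_nonneg_left (this.trans (hC n)) (sq_nonneg _)
  calc Pr.real {ω | δ ≤ ‖ε n ω * ‖Y n ω‖ - (0 : Ω → ℝ) ω‖}
      ≤ Pr.real ({ω | η ≤ ‖ε n ω - (0 : Ω → ℝ) ω‖} ∪ {ω | (δ / η) ^ 2 ≤ ‖Y n ω‖ ^ 2}) := by
        refine measureReal_mono fun ω hω => ?_
        by_contra hcon
        simp only [mem_union, mem_ofPred_eq, not_or, not_le, Pi.zero_apply, sub_zero, norm_mul,
          norm_norm] at hcon hω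
        have h4 : ‖Y n ω‖ < δ / η := lt_of_pow_lt_pow_left₀ 2 (by positivity) hcon.2
        have : ‖ε n ω‖ * ‖Y n ω‖ < η * (δ / η) :=
          mul_lt_mul'' hcon.1 h4 (norm_nonneg _) (norm_nonneg _)
        rw [mul_div_cancel₀ _ hη.ne'] at this
        linarith
    _ ≤ _ := measureReal_union_le _ _
    _ < γ := by linarith

/-- A sequence which is eventually dominated by a sequence converging to `0` in probability
converges to `0` in probability. -/
lemma tendstoInMeasure_of_eventually_norm_le {F : Type*} [NormedAddCommGroup F] {V : ℕ → Ω → F}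
    {W : ℕ → Ω → ℝ} (hV : ∀ n, AEStronglyMeasurable (V n) Pr) (hW : ∀ n, AEMeasurable (W n) Pr)
    (hlim : TendstoInMeasure Pr W atTop 0)
    (hle : ∀ᵐ ω ∂Pr, ∀ᶠ n in atTop, ‖V n ω‖ ≤ W n ω) : TendstoInMeasure Pr V atTop 0 := by
  -- The excess of `‖V n‖` over `W n` is almost surely zero from some random index on, hence it
  -- tends to `0` in probability as well.
  have he : TendstoInMeasure Pr (fun n ω => max (‖V n ω‖ - W n ω) 0) atTop 0 := by
    refine tendstoInMeasure_of_tendsto_ae (fun n => ?_) ?_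
    · exact (((hV n).norm.aemeasurable.sub (hW n)).max aemeasurable_const).aestronglyMeasurable
    · filter_upwards [hle] with ω hω
      refine tendsto_const_nhds.congr' ?_
      filter_upwards [hω] with n hn
      exact (max_eq_right (sub_nonpos.2 hn)).symm
  rw [tendstoInMeasure_iff_measureReal_norm] at he hlim ⊢
  intro δ hδ
  have := (he (δ / 2) (half_pos hδ)).add (hlim (δ / 2) (half_pos hδ))
  rw [add_zero] at this
  refine squeeze_zero (fun _ => measureReal_nonneg) (fun n => ?_) this
  refine (measureReal_mono fun ω hω => ?_).trans (measureReal_union_le _ _)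
  by_contra hcon
  simp only [mem_union, mem_ofPred_eq, not_or, not_le, Pi.zero_apply, sub_zero,
    Real.norm_eq_abs] at hcon hω
  have h1 := (le_max_left (‖V n ω‖ - W n ω) 0).trans (le_abs_self _)
  have h2 := le_abs_self (W n ω)
  linarith [hcon.1, hcon.2]

/-- The normalized sums of i.i.d. centered square integrable vectors are bounded in `L²`. -/
lemma integral_norm_sq_smul_sum_le {d : ℕ} {Y : ℕ → Ω → EuclideanSpace ℝ (Fin d)}
    (hindep : iIndepFun Y Pr) (hident : ∀ k, IdentDistrib (Y k) (Y 0) Pr Pr)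
    (hL2 : MemLp (Y 0) 2 Pr) (hmean : ∫ ω, Y 0 ω ∂Pr = 0) (n : ℕ) :
    Integrable (fun ω => ‖(√(n : ℝ))⁻¹ • ∑ k ∈ Finset.range n, Y k ω‖ ^ 2) Pr ∧
      ∫ ω, ‖(√(n : ℝ))⁻¹ • ∑ k ∈ Finset.range n, Y k ω‖ ^ 2 ∂Pr ≤
        ∑ i, Var[fun ω => Y 0 ω i; Pr] := by
  have hLk : ∀ k, MemLp (Y k) 2 Pr := fun k => (hident k).memLp_iff.2 hL2
  have hcoord : ∀ i : Fin d, Measurable fun y : EuclideanSpace ℝ (Fin d) => y i := fun i => by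
    fun_prop
  have hLi : ∀ k i, MemLp (fun ω => Y k ω i) 2 Pr := fun k i =>
    (EuclideanSpace.proj (𝕜 := ℝ) i).comp_memLp' (hLk k)
  have hident' : ∀ k i, IdentDistrib (fun ω => Y k ω i) (fun ω => Y 0 ω i) Pr Pr := fun k i =>
    (hident k).comp (hcoord i)
  have hm0 : ∀ i, ∫ ω, Y 0 ω i ∂Pr = 0 := fun i => by
    have := (EuclideanSpace.proj (𝕜 := ℝ) i).integral_comp_comm (hL2.integrable (by norm_num))
    rw [hmean] at this
    simpa using this
  have hsum2 : ∀ i, MemLp (fun ω => ∑ k ∈ Finset.range n, Y k ω i) 2 Pr := fun i =>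
    memLp_finsetSum _ fun k _ => hLi k i
  have hsq : (fun ω => ‖(√(n : ℝ))⁻¹ • ∑ k ∈ Finset.range n, Y k ω‖ ^ 2) =
      fun ω => ∑ i, (n : ℝ)⁻¹ * (∑ k ∈ Finset.range n, Y k ω i) ^ 2 := by
    ext ω
    rw [EuclideanSpace.norm_sq_eq]
    refine Finset.sum_congr rfl fun i _ => ?_
    simp [mul_pow]
  have hint : ∀ i, Integrable (fun ω => (n : ℝ)⁻¹ * (∑ k ∈ Finset.range n, Y k ω i) ^ 2) Pr :=
    fun i => (hsum2 i).integrable_sq.const_mul _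
  rw [hsq]
  refine ⟨integrable_finsetSum _ fun i _ => hint i, ?_⟩
  rw [integral_finsetSum _ fun i _ => hint i]
  refine Finset.sum_le_sum fun i _ => ?_
  rw [integral_const_mul]
  have h1 : ∫ ω, ∑ k ∈ Finset.range n, Y k ω i ∂Pr = 0 := by
    rw [integral_finsetSum _ fun k _ => (hLi k i).integrable (by norm_num)]
    exact Finset.sum_eq_zero fun k _ => (hident' k i).integral_eq.trans (hm0 i)
  have h2 : ∫ ω, (∑ k ∈ Finset.range n, Y k ω i) ^ 2 ∂Pr =
      Var[fun ω => ∑ k ∈ Finset.range n, Y k ω i; Pr] := by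
    rw [variance_eq_sub (hsum2 i), h1]; simp
  have h3 : (fun ω => ∑ k ∈ Finset.range n, Y k ω i) =
      ∑ k ∈ Finset.range n, fun ω => Y k ω i := by
    ext ω; simp
  rw [h2, h3, IndepFun.variance_sum (fun k _ => hLi k i)
    (fun k _ l _ hkl => (hindep.indepFun hkl).comp (hcoord i) (hcoord i)),
    Finset.sum_congr rfl fun k _ => (hident' k i).variance_eq, Finset.sum_const,
    Finset.card_range, nsmul_eq_mul, ← mul_assoc]
  -- The factor `n⁻¹ * n` is `1`, except for `n = 0` where it is `0`; an inequality covers both.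
  refine mul_le_of_le_one_left (variance_nonneg _ _) ?_
  rcases eq_or_ne (n : ℝ) 0 with hn | hn
  · simp [hn]
  · rw [inv_mul_cancel₀ hn]

/-- The multivariate **central limit theorem**. -/
lemma tendstoInDistribution_multivariateGaussian {d : ℕ}
    {Y : ℕ → Ω → EuclideanSpace ℝ (Fin d)} (hindep : iIndepFun Y Pr)
    (hident : ∀ k, IdentDistrib (Y k) (Y 0) Pr Pr) (hL2 : MemLp (Y 0) 2 Pr)
    (hmean : ∫ ω, Y 0 ω ∂Pr = 0) {S : Matrix (Fin d) (Fin d) ℝ} (hS : S.PosSemidef)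
    (hcov : ∀ t, ∫ ω, (inner ℝ t (Y 0 ω)) ^ 2 ∂Pr = t ⬝ᵥ S.mulVec t) :
    TendstoInDistribution (fun (n : ℕ) ω => (√(n : ℝ))⁻¹ • ∑ k ∈ Finset.range n, Y k ω) atTop id
      (fun _ => Pr) (multivariateGaussian 0 S) where
  forall_aemeasurable n := (measurable_const_smul _).comp_aemeasurable
    (Finset.aemeasurable_fun_sum _ fun k _ => (hident k).aemeasurable_fst)
  tendsto := by
    refine ProbabilityMeasure.tendsto_iff_tendsto_charFun.2 fun t => ?_
    -- Cramér–Wold device: the characteristic function of the vector sum at `t` is that of the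
    -- scalar sum of the `⟪t, Y k⟫` at `1`.
    set η : ℕ → Ω → ℝ := fun k ω => inner ℝ t (Y k ω) with hη
    have hmeas : Measurable fun y : EuclideanSpace ℝ (Fin d) => inner ℝ t y := by fun_prop
    have hη2 : MemLp (η 0) 2 Pr := hL2.const_inner t
    have hη_mean : ∫ ω, η 0 ω ∂Pr = 0 := by
      simp only [hη]
      rw [integral_inner (hL2.integrable (by norm_num)), hmean, inner_zero_right]
    have hη_var : Var[η 0; Pr] = t ⬝ᵥ S.mulVec t := by
      rw [variance_eq_sub hη2, hη_mean, ← hcov t]; simp [hη]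
    have hclt := tendstoInDistribution_inv_sqrt_mul_sum_sub (P := Pr) (X := η) (Y := id)
      (P' := gaussianReal 0 Var[η 0; Pr].toNNReal) ⟨by fun_prop, by simp⟩ hη2
      (hindep.comp (fun _ y => inner ℝ t y) fun _ => hmeas)
      (fun k => (hident k).comp hmeas)
    have h1 := ProbabilityMeasure.tendsto_iff_tendsto_charFun.1 hclt.tendsto 1
    have haem : ∀ n : ℕ, AEMeasurable (fun ω => (√(n : ℝ))⁻¹ • ∑ k ∈ Finset.range n, Y k ω) Pr :=
      fun n => (measurable_const_smul _).comp_aemeasurable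
        (Finset.aemeasurable_fun_sum _ fun k _ => (hident k).aemeasurable_fst)
    have hlim : charFun (multivariateGaussian 0 S) t =
        charFun (gaussianReal 0 Var[η 0; Pr].toNNReal) 1 := by
      rw [charFun_multivariateGaussian hS, charFun_gaussianReal, hη_var,
        Real.coe_toNNReal _ (by rw [← hη_var]; exact variance_nonneg _ _)]
      simp
    simp only [ProbabilityMeasure.coe_mk, Measure.map_id] at h1 ⊢
    rw [hlim]
    refine h1.congr fun n => ?_
    rw [charFun_apply, charFun_apply, integral_map (haem n) (by fun_prop),
      integral_map (hclt.forall_aemeasurable n) (by fun_prop)]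
    refine integral_congr_ae (Eventually.of_forall fun ω => ?_)
    have h0 : ∫ ω, η 0 ω ∂Pr = 0 := hη_mean
    simp only [h0, mul_zero, sub_zero]
    congr 2
    rw [inner_smul_left, sum_inner]
    simp [hη, real_inner_comm]

end PhiDivergence
end

noncomputable section

namespace PhiDivergence

/-! ### Min-max points of nearly quadratic functions -/

variable {E : Type*} [NormedAddCommGroup E] [InnerProductSpace ℝ E]

/-- On the closed ball of radius `r` around `(θ₀, θ₀)` the function `F` has gradient `G`, which is
`ε`-close to the affine map with linear part `(u, v) ↦ (A u, -A v)`; here `A` is coercive with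
constant `κ > ε` and has an inverse `B` of norm at most `b ≤ 1 / (2 * ε)`. At the centre the
gradient is small. -/
structure NearSaddle (F : E × E → ℝ) (G : E × E → E × E) (A B : E →L[ℝ] E) (θ₀ : E)
    (r κ b ε : ℝ) : Prop where
  r_pos : 0 < r
  hasFDerivAt : ∀ z ∈ Metric.closedBall (θ₀, θ₀) r,
    HasFDerivAt F ((innerSL ℝ (G z).1).coprod (innerSL ℝ (G z).2)) z
  approx : ∀ z ∈ Metric.closedBall (θ₀, θ₀) r, ∀ w ∈ Metric.closedBall (θ₀, θ₀) r,
    ‖G z - G w - (A (z - w).1, -A (z - w).2)‖ ≤ ε * ‖z - w‖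
  left_inv : ∀ u, B (A u) = u
  right_inv : ∀ u, A (B u) = u
  coercive : ∀ u, κ * ‖u‖ ^ 2 ≤ inner ℝ (A u) u
  bound : ∀ u, ‖B u‖ ≤ b * ‖u‖
  b_nonneg : 0 ≤ b
  eps_nonneg : 0 ≤ ε
  eps_mul_le : ε * b ≤ 1 / 2
  eps_lt : ε < κ
  small : b * ‖G (θ₀, θ₀)‖ ≤ r / 4

/-- One step of the simplified Newton method for the equation `G z = 0`. -/
def newtonStep (G : E × E → E × E) (B : E →L[ℝ] E) (z : E × E) : E × E :=
  z - (B (G z).1, -B (G z).2)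

namespace NearSaddle

variable {F : E × E → ℝ} {G : E × E → E × E} {A B : E →L[ℝ] E} {θ₀ : E} {r κ b ε : ℝ}

lemma norm_prod_neg_le (h : NearSaddle F G A B θ₀ r κ b ε) (v : E × E) :
    ‖((B v.1, -B v.2) : E × E)‖ ≤ b * ‖v‖ := by
  rw [Prod.norm_def, norm_neg]
  refine max_le ((h.bound _).trans ?_) ((h.bound _).trans ?_)
  · exact mul_le_mul_of_nonneg_left (norm_fst_le v) h.b_nonneg
  · exact mul_le_mul_of_nonneg_left (norm_snd_le v) h.b_nonneg

/-- Since `B` inverts `A`, the affine part of `G` cancels the identity in the Newton map. Only the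
deviation of `G` from affinity survives, multiplied by `B`. -/
lemma norm_newtonStep_sub_le (h : NearSaddle F G A B θ₀ r κ b ε) {z w : E × E}
    (hz : z ∈ Metric.closedBall (θ₀, θ₀) r) (hw : w ∈ Metric.closedBall (θ₀, θ₀) r) :
    ‖newtonStep G B z - newtonStep G B w‖ ≤ ε * b * ‖z - w‖ := by
  set e := G z - G w - (A (z - w).1, -A (z - w).2) with he
  have h1 : newtonStep G B z - newtonStep G B w = -(B e.1, -B e.2) := by
    simp only [newtonStep, he]
    ext <;> simp [h.left_inv] <;> abel
  rw [h1, norm_neg]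
  calc _ ≤ b * ‖e‖ := h.norm_prod_neg_le e
    _ ≤ b * (ε * ‖z - w‖) := mul_le_mul_of_nonneg_left (h.approx z hz w hw) h.b_nonneg
    _ = _ := by ring

/-- The contraction contributes at most `r / 2` and the first step from the centre at most `r / 4`.
The total is strictly below `r`, which puts the fixed point in the open ball. -/
lemma norm_newtonStep_sub_center_le (h : NearSaddle F G A B θ₀ r κ b ε) {z : E × E}
    (hz : z ∈ Metric.closedBall (θ₀, θ₀) r) :
    ‖newtonStep G B z - (θ₀, θ₀)‖ ≤ 3 / 4 * r := by
  have h0 : ((θ₀, θ₀) : E × E) ∈ Metric.closedBall (θ₀, θ₀) r :=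
    Metric.mem_closedBall_self h.r_pos.le
  have h1 := h.norm_newtonStep_sub_le hz h0
  have h2 : ‖newtonStep G B (θ₀, θ₀) - (θ₀, θ₀)‖ ≤ r / 4 := by
    have : newtonStep G B (θ₀, θ₀) - (θ₀, θ₀) = -(B (G (θ₀, θ₀)).1, -B (G (θ₀, θ₀)).2) := by
      simp [newtonStep]
    rw [this, norm_neg]
    exact (h.norm_prod_neg_le _).trans h.small
  have h3 : ‖z - (θ₀, θ₀)‖ ≤ r := by rwa [← dist_eq_norm]
  have h4 : ε * b * ‖z - (θ₀, θ₀)‖ ≤ 1 / 2 * r :=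
    mul_le_mul h.eps_mul_le h3 (norm_nonneg _) (by norm_num)
  calc _ ≤ ‖newtonStep G B z - newtonStep G B (θ₀, θ₀)‖ +
        ‖newtonStep G B (θ₀, θ₀) - (θ₀, θ₀)‖ := norm_sub_le_norm_sub_add_norm_sub _ _ _
    _ ≤ _ := by linarith

/-- The iterates of the simplified Newton method converge to a zero of the gradient. -/
lemma exists_tendsto_iterate [CompleteSpace E] (h : NearSaddle F G A B θ₀ r κ b ε) :
    ∃ z ∈ Metric.ball (θ₀, θ₀) r, G z = 0 ∧
      Tendsto (fun k => (newtonStep G B)^[k] (θ₀, θ₀)) atTop (𝓝 z) := by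
  have hmaps : MapsTo (newtonStep G B) (Metric.closedBall (θ₀, θ₀) r)
      (Metric.closedBall (θ₀, θ₀) r) := fun z hz => by
    rw [Metric.mem_closedBall, dist_eq_norm]
    linarith [h.norm_newtonStep_sub_center_le hz, h.r_pos]
  have hcontr : ContractingWith (1 / 2 : ℝ≥0)
      (hmaps.restrict (newtonStep G B) _ _) := by
    refine ⟨by rw [← NNReal.coe_lt_coe]; norm_num, LipschitzWith.of_dist_le_mul fun z w => ?_⟩
    rw [Subtype.dist_eq, Subtype.dist_eq, dist_eq_norm, dist_eq_norm]
    refine (h.norm_newtonStep_sub_le z.2 w.2).trans ?_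
    refine mul_le_mul_of_nonneg_right ?_ (norm_nonneg _)
    simpa using h.eps_mul_le
  obtain ⟨z, hz, hfix, hlim, -⟩ := hcontr.exists_fixedPoint' Metric.isClosed_closedBall.isComplete
    hmaps (Metric.mem_closedBall_self h.r_pos.le) (edist_ne_top _ _)
  refine ⟨z, ?_, ?_, hlim⟩
  · have := h.norm_newtonStep_sub_center_le hz
    rw [hfix.eq] at this
    rw [Metric.mem_ball, dist_eq_norm]
    linarith [h.r_pos]
  · have h1 : newtonStep G B z = z := hfix
    simp only [newtonStep, sub_eq_self, Prod.mk_eq_zero, neg_eq_zero] at h1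
    ext
    · rw [← h.right_inv (G z).1, h1.1, map_zero]; rfl
    · rw [← h.right_inv (G z).2, h1.2, map_zero]; rfl

/-- A zero of the gradient is given, up to a small error, by one step of the Newton method. -/
lemma norm_sub_add_le (h : NearSaddle F G A B θ₀ r κ b ε) {z : E × E}
    (hz : z ∈ Metric.closedBall (θ₀, θ₀) r) (hG : G z = 0) :
    ‖z - (θ₀, θ₀) + (B (G (θ₀, θ₀)).1, -B (G (θ₀, θ₀)).2)‖ ≤
      2 * b ^ 2 * ε * ‖G (θ₀, θ₀)‖ := by
  have h1 := h.norm_newtonStep_sub_le hz (Metric.mem_closedBall_self h.r_pos.le)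
  have h2 : newtonStep G B z = z := by simp [newtonStep, hG]
  have h3 : z - newtonStep G B (θ₀, θ₀) =
      z - (θ₀, θ₀) + (B (G (θ₀, θ₀)).1, -B (G (θ₀, θ₀)).2) := by
    rw [newtonStep]; abel
  rw [h2, h3] at h1
  have h4 := h.norm_prod_neg_le (G (θ₀, θ₀))
  -- By the contraction estimate the error is at most half of `‖z - (θ₀, θ₀)‖`, so it can be
  -- absorbed in the left-hand side.
  have h5 : ‖z - (θ₀, θ₀)‖ ≤ 2 * (b * ‖G (θ₀, θ₀)‖) := by
    have h6 : ‖z - (θ₀, θ₀)‖ ≤ ‖z - (θ₀, θ₀) + (B (G (θ₀, θ₀)).1, -B (G (θ₀, θ₀)).2)‖ +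
        ‖((B (G (θ₀, θ₀)).1, -B (G (θ₀, θ₀)).2) : E × E)‖ := by
      simpa using norm_sub_le (z - (θ₀, θ₀) + (B (G (θ₀, θ₀)).1, -B (G (θ₀, θ₀)).2))
        ((B (G (θ₀, θ₀)).1, -B (G (θ₀, θ₀)).2) : E × E)
    have h7 := mul_le_mul_of_nonneg_right h.eps_mul_le (norm_nonneg (z - (θ₀, θ₀)))
    linarith
  calc _ ≤ ε * b * ‖z - (θ₀, θ₀)‖ := h1
    _ ≤ ε * b * (2 * (b * ‖G (θ₀, θ₀)‖)) :=
        mul_le_mul_of_nonneg_left h5 (mul_nonneg h.eps_nonneg h.b_nonneg)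
    _ = _ := by ring

lemma hasDerivAt_comp_segment (h : NearSaddle F G A B θ₀ r κ b ε) {z v : E × E} {s : ℝ}
    (hz : z + s • v ∈ Metric.closedBall (θ₀, θ₀) r) :
    HasDerivAt (fun s : ℝ => F (z + s • v))
      (inner ℝ (G (z + s • v)).1 v.1 + inner ℝ (G (z + s • v)).2 v.2) s := by
  have h1 : HasDerivAt (fun s : ℝ => z + s • v) v s := by
    simpa using ((hasDerivAt_id s).smul_const v).const_add z
  exact ((h.hasFDerivAt _ hz).comp_hasDerivAt s h1).congr_deriv (by simp)

lemma lt_of_inner_pos (h : NearSaddle F G A B θ₀ r κ b ε) {z v : E × E}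
    (hz : z ∈ Metric.closedBall (θ₀, θ₀) r) (hzv : z + v ∈ Metric.closedBall (θ₀, θ₀) r)
    (hpos : ∀ s ∈ Ioo (0 : ℝ) 1, z + s • v ∈ Metric.closedBall (θ₀, θ₀) r →
      0 < inner ℝ (G (z + s • v)).1 v.1 + inner ℝ (G (z + s • v)).2 v.2) :
    F z < F (z + v) := by
  have hseg : ∀ s ∈ Icc (0 : ℝ) 1, z + s • v ∈ Metric.closedBall (θ₀, θ₀) r := fun s hs => by
    have := (convex_closedBall ((θ₀, θ₀) : E × E) r).add_smul_sub_mem hz hzv hs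
    simpa using this
  have hmono : StrictMonoOn (fun s : ℝ => F (z + s • v)) (Icc 0 1) := by
    refine strictMonoOn_of_deriv_pos (convex_Icc 0 1) ?_ ?_
    · exact fun s hs => (h.hasDerivAt_comp_segment (hseg s hs)).continuousAt.continuousWithinAt
    · intro s hs
      rw [interior_Icc] at hs
      have hs' := hseg s (Ioo_subset_Icc_self hs)
      rw [(h.hasDerivAt_comp_segment hs').deriv]
      exact hpos s hs hs'
  simpa using hmono (left_mem_Icc.2 zero_le_one) (right_mem_Icc.2 zero_le_one) zero_lt_one

/-- On the segment from the zero, the first gradient component at parameter `s` is `s • A u` up to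
`ε * s * ‖u‖`. Its product with `u` is therefore at least `(κ - ε) * s * ‖u‖ ^ 2 > 0`. -/
lemma lt_of_fst_ne (h : NearSaddle F G A B θ₀ r κ b ε) {ϑ θ a : E}
    (hz : (ϑ, a) ∈ Metric.closedBall (θ₀, θ₀) r) (hw : (θ, a) ∈ Metric.closedBall (θ₀, θ₀) r)
    (hG : G (ϑ, a) = 0) (hne : θ ≠ ϑ) : F (ϑ, a) < F (θ, a) := by
  set u := θ - ϑ with hu
  have hu0 : 0 < ‖u‖ := norm_pos_iff.2 (sub_ne_zero.2 hne)
  have hadd : ((ϑ, a) : E × E) + (u, 0) = (θ, a) := by simp [hu]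
  rw [← hadd] at hw ⊢
  refine h.lt_of_inner_pos hz hw fun s hs hs' => ?_
  have h1 := h.approx _ hs' _ hz
  rw [hG, add_sub_cancel_left] at h1
  simp only [Prod.smul_mk, smul_zero, map_smul, map_zero, neg_zero, sub_zero] at h1
  have h2 := (norm_fst_le _).trans h1
  have h3 : ‖((s • u, (0 : E)) : E × E)‖ = s * ‖u‖ := by
    simp [Prod.norm_def, norm_smul, abs_of_pos hs.1, mul_nonneg hs.1.le hu0.le]
  rw [h3] at h2
  simp only [Prod.fst_sub, Prod.smul_mk, smul_zero, inner_zero_right, add_zero] at h2 ⊢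
  have h4 := abs_real_inner_le_norm ((G ((ϑ, a) + (s • u, 0))).1 - s • A u) u
  rw [inner_sub_left, inner_smul_left] at h4
  have h5 := (abs_le.1 h4).1
  have h6 := mul_le_mul_of_nonneg_right h2 hu0.le
  have h7 := mul_le_mul_of_nonneg_left (h.coercive u) hs.1.le
  have h8 : 0 < (κ - ε) * (s * ‖u‖ ^ 2) :=
    mul_pos (sub_pos.2 h.eps_lt) (mul_pos hs.1 (by positivity))
  simp only [conj_trivial] at h5
  nlinarith

lemma lt_of_snd_ne (h : NearSaddle F G A B θ₀ r κ b ε) {ϑ α a : E}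
    (hz : (ϑ, a) ∈ Metric.closedBall (θ₀, θ₀) r) (hw : (ϑ, α) ∈ Metric.closedBall (θ₀, θ₀) r)
    (hG : G (ϑ, a) = 0) (hne : α ≠ a) : F (ϑ, α) < F (ϑ, a) := by
  -- Exchanging the two variables and changing the sign of `F` preserves the saddle structure, and
  -- turns maximality in the second variable into minimality in the first.
  have hs : NearSaddle (fun z => -F z.swap) (fun z => -(G z.swap).swap) A B θ₀ r κ b ε :=
    { h with
      hasFDerivAt := fun z hz => by
        have hz' : z.swap ∈ Metric.closedBall (θ₀, θ₀) r := by
          rw [← closedBall_prod_same] at hz ⊢; exact ⟨hz.2, hz.1⟩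
        have h1 : HasFDerivAt (Prod.swap : E × E → E × E)
            (ContinuousLinearEquiv.prodComm ℝ E E : E × E →L[ℝ] E × E) z :=
          (ContinuousLinearEquiv.prodComm ℝ E E).hasFDerivAt
        refine ((h.hasFDerivAt _ hz').comp z h1).neg.congr_fderiv ?_
        ext v <;> simp
      approx := fun z hz w hw => by
        have hz' : z.swap ∈ Metric.closedBall (θ₀, θ₀) r := by
          rw [← closedBall_prod_same] at hz ⊢; exact ⟨hz.2, hz.1⟩
        have hw' : w.swap ∈ Metric.closedBall (θ₀, θ₀) r := by
          rw [← closedBall_prod_same] at hw ⊢; exact ⟨hw.2, hw.1⟩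
        have h1 := h.approx _ hz' _ hw'
        have hsw : ∀ v : E × E, ‖v.swap‖ = ‖v‖ := fun v => by
          simp [Prod.norm_def, max_comm]
        rw [← hsw (z - w), ← hsw, ← norm_neg]
        refine (congrArg norm ?_).trans_le h1
        ext <;> simp <;> abel
      small := by
        have hsw : ∀ v : E × E, ‖v.swap‖ = ‖v‖ := fun v => by
          simp [Prod.norm_def, max_comm]
        simpa [hsw] using h.small }
  have hsw : ∀ {x y : E}, (x, y) ∈ Metric.closedBall (θ₀, θ₀) r →
      (y, x) ∈ Metric.closedBall (θ₀, θ₀) r := fun hx => by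
    rw [← closedBall_prod_same] at hx ⊢; exact ⟨hx.2, hx.1⟩
  have := hs.lt_of_fst_ne (hsw hz) (hsw hw) (by simp [hG]) hne
  simpa using this

/-- A zero of the gradient is a min-max point. -/
lemma isMinMaxOn [FiniteDimensional ℝ E] (h : NearSaddle F G A B θ₀ r κ b ε) {ϑ a : E}
    (hz : (ϑ, a) ∈ Metric.closedBall (θ₀, θ₀) r) (hG : G (ϑ, a) = 0) :
    IsMinMaxOn (fun θ α => F (θ, α)) (Metric.closedBall θ₀ r) ϑ a := by
  have hmem : ∀ {x y : E}, x ∈ Metric.closedBall θ₀ r → y ∈ Metric.closedBall θ₀ r →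
      (x, y) ∈ Metric.closedBall (θ₀, θ₀) r := fun hx hy => by
    rw [← closedBall_prod_same]; exact ⟨hx, hy⟩
  have hz' := hz
  rw [← closedBall_prod_same] at hz'
  have hex : ∀ θ ∈ Metric.closedBall θ₀ r, ∃ α ∈ Metric.closedBall θ₀ r,
      IsMaxOn (fun α => F (θ, α)) (Metric.closedBall θ₀ r) α := fun θ hθ =>
    (isCompact_closedBall θ₀ r).exists_isMaxOn ⟨θ₀, Metric.mem_closedBall_self h.r_pos.le⟩
      fun α hα => ((h.hasFDerivAt _ (hmem hθ hα)).continuousAt.comp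
        (f := fun α => ((θ, α) : E × E)) (by fun_prop)).continuousWithinAt
  choose! M hM hMmax using hex
  classical
  -- Compactness supplies some maximizer for every `θ`; at `ϑ` the selection is forced to take the
  -- value `a`.
  set M' : E → E := fun θ => if θ = ϑ then a else M θ with hM'
  have hmax : ∀ θ ∈ Metric.closedBall θ₀ r, M' θ ∈ Metric.closedBall θ₀ r ∧
      IsMaxOn (fun α => F (θ, α)) (Metric.closedBall θ₀ r) (M' θ) := by
    intro θ hθ
    by_cases hc : θ = ϑ
    · subst hc
      simp only [hM', if_true]
      refine ⟨hz'.2, fun α hα => ?_⟩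
      by_cases hα' : α = a
      · simp [hα']
      · exact (h.lt_of_snd_ne hz (hmem hz'.1 hα) hG hα').le
    · simp only [hM', if_neg hc]
      exact ⟨hM θ hθ, hMmax θ hθ⟩
  have hϑ : M' ϑ = a := by simp [hM']
  refine ⟨M', hmax, hz'.1, fun θ hθ => ?_, hϑ.symm⟩
  change F (ϑ, M' ϑ) ≤ F (θ, M' θ)
  rw [hϑ]
  -- The inserted middle term is `F (θ, a)`: the maximum over `α` dominates it, and it dominates `F
  -- (ϑ, a)`.
  refine le_trans ?_ ((hmax θ hθ).2 hz'.2)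
  by_cases hc : θ = ϑ
  · rw [hc]
  · exact (h.lt_of_fst_ne hz (hmem hθ hz'.2) hG hc).le

/-- A zero of the gradient is the only min-max point. -/
lemma eq_of_isMinMaxOn (h : NearSaddle F G A B θ₀ r κ b ε) {ϑ a ϑ' a' : E}
    (hz : (ϑ, a) ∈ Metric.closedBall (θ₀, θ₀) r) (hG : G (ϑ, a) = 0)
    (h' : IsMinMaxOn (fun θ α => F (θ, α)) (Metric.closedBall θ₀ r) ϑ' a') :
    ϑ' = ϑ ∧ a' = a := by
  have hmem : ∀ {x y : E}, x ∈ Metric.closedBall θ₀ r → y ∈ Metric.closedBall θ₀ r →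
      (x, y) ∈ Metric.closedBall (θ₀, θ₀) r := fun hx hy => by
    rw [← closedBall_prod_same]; exact ⟨hx, hy⟩
  have hz' := hz
  rw [← closedBall_prod_same] at hz'
  obtain ⟨M, hM, hϑ', hmin, rfl⟩ := h'
  -- The chain `F (ϑ', a) ≤ F (ϑ', M ϑ') ≤ F (ϑ, M ϑ) ≤ F (ϑ, a)` contradicts the strict inequality
  -- in the first variable unless `ϑ' = ϑ`. Strictness in the second variable then identifies the
  -- maximizer. Interiority of the competing point plays no role.
  have h1 : F (ϑ', M ϑ') ≤ F (ϑ, M ϑ) := hmin hz'.1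
  have h2 : F (ϑ, M ϑ) ≤ F (ϑ, a) := by
    by_cases hc : M ϑ = a
    · rw [hc]
    · exact (h.lt_of_snd_ne hz (hmem hz'.1 (hM ϑ hz'.1).1) hG hc).le
  have h3 : F (ϑ', a) ≤ F (ϑ', M ϑ') := (hM ϑ' hϑ').2 hz'.2
  have h4 : ϑ' = ϑ := by
    by_contra hc
    linarith [h.lt_of_fst_ne hz (hmem hϑ' hz'.2) hG hc]
  refine ⟨h4, ?_⟩
  subst h4
  by_contra hc
  linarith [h.lt_of_snd_ne hz (hmem hϑ' (hM _ hϑ').1) hG hc]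

end NearSaddle

end PhiDivergence
end

noncomputable section

namespace PhiDivergence

/-! ### Partial derivatives on `ℝᵈ × ℝᵈ` -/

variable {d : ℕ}

/-- The coordinates on `ℝᵈ × ℝᵈ`. -/
def coord : Fin d ⊕ Fin d → (EuclideanSpace ℝ (Fin d) × EuclideanSpace ℝ (Fin d) →L[ℝ] ℝ)
  | Sum.inl i => (EuclideanSpace.proj i).comp (ContinuousLinearMap.fst ℝ _ _)
  | Sum.inr i => (EuclideanSpace.proj i).comp (ContinuousLinearMap.snd ℝ _ _)

@[simp] lemma coord_inl (i : Fin d) (z : EuclideanSpace ℝ (Fin d) × EuclideanSpace ℝ (Fin d)) :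
    coord (Sum.inl i) z = z.1 i := rfl

@[simp] lemma coord_inr (i : Fin d) (z : EuclideanSpace ℝ (Fin d) × EuclideanSpace ℝ (Fin d)) :
    coord (Sum.inr i) z = z.2 i := rfl

lemma coord_dir (i j : Fin d ⊕ Fin d) : coord i (dir j) = if i = j then 1 else 0 := by
  rcases i with i | i <;> rcases j with j | j <;> simp [dir]

lemma ext_coord {z w : EuclideanSpace ℝ (Fin d) × EuclideanSpace ℝ (Fin d)}
    (h : ∀ i, coord i z = coord i w) : z = w := by
  ext i
  · exact h (Sum.inl i)
  · exact h (Sum.inr i)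

lemma coord_sum_smul_dir (a : Fin d ⊕ Fin d → ℝ) (i : Fin d ⊕ Fin d) :
    coord i (∑ j, a j • dir j) = a i := by
  simp only [map_sum, map_smul, coord_dir, smul_eq_mul, mul_ite, mul_one, mul_zero,
    Finset.sum_ite_eq, Finset.mem_univ, if_true]

lemma sum_smul_coord_dir (a : Fin d ⊕ Fin d → ℝ) (i : Fin d ⊕ Fin d) :
    (∑ j, a j • coord j) (dir i) = a i := by
  simp only [_root_.sum_apply, _root_.smul_apply, coord_dir, smul_eq_mul, mul_ite, mul_one,
    mul_zero, Finset.sum_ite_eq', Finset.mem_univ, if_true]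

lemma sum_coord_smul_dir (z : EuclideanSpace ℝ (Fin d) × EuclideanSpace ℝ (Fin d)) :
    ∑ i, coord i z • dir i = z :=
  ext_coord fun i => coord_sum_smul_dir _ i

/-- Guarantees that a path from the centre to `z` changing one coordinate at a time stays in every
ball around the centre that contains `z`. -/
lemma norm_le_norm_of_abs_coord_le {z w : EuclideanSpace ℝ (Fin d) × EuclideanSpace ℝ (Fin d)}
    (h : ∀ i, |coord i z| ≤ |coord i w|) : ‖z‖ ≤ ‖w‖ := by
  have key : ∀ u v : EuclideanSpace ℝ (Fin d), (∀ i, |u i| ≤ |v i|) → ‖u‖ ≤ ‖v‖ := by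
    intro u v huv
    rw [EuclideanSpace.norm_eq, EuclideanSpace.norm_eq]
    refine Real.sqrt_le_sqrt (Finset.sum_le_sum fun i _ => ?_)
    exact pow_le_pow_left₀ (norm_nonneg _) (huv i) 2
  rw [Prod.norm_def, Prod.norm_def]
  exact max_le_max (key _ _ fun i => h (Sum.inl i)) (key _ _ fun i => h (Sum.inr i))

lemma abs_coord_le (i : Fin d ⊕ Fin d)
    (z : EuclideanSpace ℝ (Fin d) × EuclideanSpace ℝ (Fin d)) : |coord i z| ≤ ‖z‖ := by
  rcases i with i | i
  · exact (PiLp.norm_apply_le z.1 i).trans (norm_fst_le z)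
  · exact (PiLp.norm_apply_le z.2 i).trans (norm_snd_le z)

lemma norm_coord_le (i : Fin d ⊕ Fin d) : ‖(coord i : _ →L[ℝ] ℝ)‖ ≤ 1 :=
  ContinuousLinearMap.opNorm_le_bound _ zero_le_one fun z => by
    rw [one_mul]; exact abs_coord_le i z

lemma norm_dir (i : Fin d ⊕ Fin d) : ‖dir i‖ = 1 := by
  rcases i with i | i <;> simp [dir, Prod.norm_def]

lemma norm_le_sum_abs_coord (z : EuclideanSpace ℝ (Fin d) × EuclideanSpace ℝ (Fin d)) :
    ‖z‖ ≤ ∑ i, |coord i z| := by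
  conv_lhs => rw [← sum_coord_smul_dir z]
  refine (norm_sum_le _ _).trans (Finset.sum_le_sum fun i _ => ?_)
  rw [norm_smul, norm_dir, mul_one, Real.norm_eq_abs]

section partialD

variable {F : EuclideanSpace ℝ (Fin d) × EuclideanSpace ℝ (Fin d) → ℝ}
  {z : EuclideanSpace ℝ (Fin d) × EuclideanSpace ℝ (Fin d)}

lemma partialD_eq {L : EuclideanSpace ℝ (Fin d) × EuclideanSpace ℝ (Fin d) →L[ℝ] ℝ}
    (h : HasFDerivAt F L z) (i : Fin d ⊕ Fin d) : partialD i F z = L (dir i) :=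
  (h.hasLineDerivAt _).lineDeriv

lemma hasFDerivAt_sum_partialD (h : DifferentiableAt ℝ F z) :
    HasFDerivAt F (∑ i, partialD i F z • coord i) z := by
  refine h.hasFDerivAt.congr_fderiv ?_
  refine ContinuousLinearMap.ext fun v => ?_
  conv_lhs => rw [← sum_coord_smul_dir v, map_sum]
  simp only [map_smul, _root_.sum_apply, _root_.smul_apply,
    ← partialD_eq h.hasFDerivAt, smul_eq_mul, mul_comm]

lemma partialD_congr {F' : EuclideanSpace ℝ (Fin d) × EuclideanSpace ℝ (Fin d) → ℝ}
    (h : F =ᶠ[𝓝 z] F') (i : Fin d ⊕ Fin d) : partialD i F z = partialD i F' z := by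
  rw [partialD, partialD, h.lineDeriv_eq]

lemma contDiffOn_partialD {U : Set (EuclideanSpace ℝ (Fin d) × EuclideanSpace ℝ (Fin d))}
    (hU : IsOpen U) {n : ℕ} (h : ContDiffOn ℝ (n + 1) F U) (i : Fin d ⊕ Fin d) :
    ContDiffOn ℝ n (partialD i F) U := by
  have h1 := ((contDiffOn_succ_iff_fderiv_of_isOpen hU).1 h).2.2
  refine (h1.clm_apply contDiffOn_const (g := fun _ => dir i)).congr fun z hz => ?_
  exact partialD_eq ((h.differentiableOn (by simp)).differentiableAt
    (hU.mem_nhds hz)).hasFDerivAt i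

/-- A function which is differentiable along the coordinate directions, with derivatives bounded
by `K`, is Lipschitz. -/
lemma abs_sub_le_of_partialD_le {z₀ : EuclideanSpace ℝ (Fin d) × EuclideanSpace ℝ (Fin d)}
    {ρ K : ℝ} (hK : 0 ≤ K)
    (hdiff : ∀ z ∈ Metric.ball z₀ ρ, ∀ k, LineDifferentiableAt ℝ F z (dir k))
    (hbound : ∀ z ∈ Metric.ball z₀ ρ, ∀ k, |partialD k F z| ≤ K) (hz : z ∈ Metric.ball z₀ ρ) :
    |F z - F z₀| ≤ Fintype.card (Fin d ⊕ Fin d) * K * ‖z - z₀‖ := by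
  set v := z - z₀ with hv
  have hvρ : ‖v‖ < ρ := by rwa [← dist_eq_norm]
  -- Only differentiability along the coordinate directions is available, so the coordinates are
  -- changed one after the other, each costing at most `K * ‖v‖` by the one-dimensional mean value
  -- inequality.
  have key : ∀ s : Finset (Fin d ⊕ Fin d),
      |F (z₀ + ∑ k ∈ s, coord k v • dir k) - F z₀| ≤ s.card * K * ‖v‖ := by
    intro s
    induction s using Finset.induction_on with
    | empty => simp
    | insert k s hk ih =>
      set y := z₀ + ∑ k ∈ s, coord k v • dir k with hy
      have hball : ∀ t ∈ uIcc 0 (coord k v), y + t • dir k ∈ Metric.ball z₀ ρ := by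
        intro t ht
        rw [Metric.mem_ball, dist_eq_norm, hy, add_assoc, add_sub_cancel_left]
        refine (norm_le_norm_of_abs_coord_le fun i => ?_).trans_lt hvρ
        have ht' : |t| ≤ |coord k v| := by
          have := abs_sub_left_of_mem_uIcc ht
          simpa using this
        rw [map_add, map_sum, map_smul]
        simp only [map_smul, coord_dir, smul_eq_mul, mul_ite, mul_one, mul_zero,
          Finset.sum_ite_eq]
        by_cases hi : i = k
        · subst hi
          simpa [hk] using ht'
        · by_cases his : i ∈ s <;> simp [hi, his]
      have hder : ∀ t ∈ uIcc 0 (coord k v), HasDerivWithinAt (fun t : ℝ => F (y + t • dir k))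
          (partialD k F (y + t • dir k)) (uIcc 0 (coord k v)) t := by
        intro t ht
        have h1 := (hdiff _ (hball t ht) k).hasLineDerivAt
        have h2 : HasDerivAt (fun s : ℝ => F (y + t • dir k + s • dir k))
            (partialD k F (y + t • dir k)) (t - t) := by rw [sub_self]; exact h1
        have h3 := h2.comp_sub_const t t
        refine HasDerivAt.hasDerivWithinAt (h3.congr_of_eventuallyEq
          (Eventually.of_forall fun s => ?_))
        change F _ = F _
        congr 1
        rw [add_assoc y, ← add_smul, add_sub_cancel]
      have hmv := (convex_uIcc 0 (coord k v)).norm_image_sub_le_of_norm_hasDerivWithin_le hder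
        (fun t ht => hbound _ (hball t ht) k) left_mem_uIcc right_mem_uIcc
      simp only [zero_smul, add_zero, sub_zero, Real.norm_eq_abs] at hmv
      have hins : z₀ + ∑ k ∈ insert k s, coord k v • dir k = y + coord k v • dir k := by
        rw [Finset.sum_insert hk, hy]; abel
      rw [hins, Finset.card_insert_of_notMem hk]
      have h4 : K * |coord k v| ≤ K * ‖v‖ := mul_le_mul_of_nonneg_left (abs_coord_le k v) hK
      calc |F (y + coord k v • dir k) - F z₀|
          ≤ |F (y + coord k v • dir k) - F y| + |F y - F z₀| := abs_sub_le _ _ _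
        _ ≤ K * ‖v‖ + s.card * K * ‖v‖ := add_le_add (hmv.trans h4) ih
        _ = _ := by push_cast; ring
  have := key Finset.univ
  rwa [sum_coord_smul_dir, hv, add_sub_cancel, Finset.card_univ] at this

/-- Mean value inequality for a function whose partial derivatives are almost constant. -/
lemma abs_sub_sub_le_of_partialD_sub_le
    {s : Set (EuclideanSpace ℝ (Fin d) × EuclideanSpace ℝ (Fin d))} (hs : Convex ℝ s)
    (hdiff : ∀ z ∈ s, DifferentiableAt ℝ F z) {a : Fin d ⊕ Fin d → ℝ} {κ : ℝ}
    (hbound : ∀ z ∈ s, ∀ j, |partialD j F z - a j| ≤ κ)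
    {w : EuclideanSpace ℝ (Fin d) × EuclideanSpace ℝ (Fin d)} (hz : z ∈ s) (hw : w ∈ s) :
    |F z - F w - ∑ j, a j * coord j (z - w)| ≤
      Fintype.card (Fin d ⊕ Fin d) * κ * ‖z - w‖ := by
  have h1 : ∀ y ∈ s, HasFDerivWithinAt F (∑ i, partialD i F y • coord i) s y := fun y hy =>
    (hasFDerivAt_sum_partialD (hdiff y hy)).hasFDerivWithinAt
  have h2 := hs.norm_image_sub_le_of_norm_hasFDerivWithin_le' (φ := ∑ j, a j • coord j)
    (C := Fintype.card (Fin d ⊕ Fin d) * κ) h1 (fun y hy => ?_) hw hz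
  · simpa using h2
  · rw [← Finset.sum_sub_distrib]
    refine (norm_sum_le _ _).trans ?_
    rw [← Finset.card_univ, ← nsmul_eq_mul]
    refine Finset.sum_le_card_nsmul _ _ _ fun j _ => ?_
    rw [← sub_smul, norm_smul]
    exact (mul_le_of_le_one_right (norm_nonneg _) (norm_coord_le j)).trans (hbound y hy j)

end partialD

/-! ### Differentiation under the integral sign -/

variable {𝒳 : Type*} [MeasurableSpace 𝒳] {lam : Measure 𝒳}

/-- For a smooth family of measurable functions the partial derivatives are measurable. -/
lemma aestronglyMeasurable_partialD
    {m : EuclideanSpace ℝ (Fin d) × EuclideanSpace ℝ (Fin d) → 𝒳 → ℝ}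
    {U : Set (EuclideanSpace ℝ (Fin d) × EuclideanSpace ℝ (Fin d))} (hU : IsOpen U)
    (hmeas : ∀ z ∈ U, AEStronglyMeasurable (m z) lam)
    {z : EuclideanSpace ℝ (Fin d) × EuclideanSpace ℝ (Fin d)} (hz : z ∈ U)
    (hdiff : ∀ᵐ x ∂lam, DifferentiableAt ℝ (fun z => m z x) z) (i : Fin d ⊕ Fin d) :
    AEStronglyMeasurable (fun x => partialD i (fun z => m z x) z) lam := by
  have hlim : Tendsto (fun n : ℕ => z + (1 / ((n : ℝ) + 1)) • dir i) atTop (𝓝 z) := by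
    simpa using
      ((tendsto_one_div_add_atTop_nhds_zero_nat (𝕜 := ℝ)).smul_const (dir i)).const_add z
  obtain ⟨N, hN⟩ := eventually_atTop.1 (hlim.eventually (hU.mem_nhds hz))
  -- The derivative is a limit of difference quotients along a sequence of steps; the shift by `N`
  -- keeps all evaluation points in `U`.
  refine aestronglyMeasurable_of_tendsto_ae atTop (f := fun (n : ℕ) x =>
    (1 / (((n + N : ℕ) : ℝ) + 1))⁻¹ * (m (z + (1 / (((n + N : ℕ) : ℝ) + 1)) • dir i) x - m z x))
    (fun n => ((hmeas _ (hN _ (Nat.le_add_left _ _))).sub (hmeas z hz)).const_mul _) ?_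
  filter_upwards [hdiff] with x hx
  have h1 := (hx.hasFDerivAt.hasLineDerivAt (dir i)).tendsto_slope_zero
  rw [partialD_eq hx.hasFDerivAt]
  have h2 : Tendsto (fun n : ℕ => 1 / (((n + N : ℕ) : ℝ) + 1)) atTop (𝓝[≠] 0) := by
    refine tendsto_nhdsWithin_iff.2 ⟨?_, Eventually.of_forall fun n => ?_⟩
    · exact (tendsto_add_atTop_iff_nat N).2 tendsto_one_div_add_atTop_nhds_zero_nat
    · simp only [mem_compl_iff, mem_singleton_iff]; positivity
  exact h1.comp h2

/-- The coordinate functionals have norm at most `1`, so the bound on each partial derivative bounds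
the Fréchet derivative by `L` times the number of coordinates, and dominated differentiation
applies. -/
lemma hasFDerivAt_integral_of_partialD_le
    {m : EuclideanSpace ℝ (Fin d) × EuclideanSpace ℝ (Fin d) → 𝒳 → ℝ}
    {U : Set (EuclideanSpace ℝ (Fin d) × EuclideanSpace ℝ (Fin d))} (hU : IsOpen U)
    (hmeas : ∀ z ∈ U, AEStronglyMeasurable (m z) lam) (hint : ∀ z ∈ U, Integrable (m z) lam)
    {L : 𝒳 → ℝ} (hL : Integrable L lam)
    (hdiff : ∀ᵐ x ∂lam, ∀ z ∈ U, DifferentiableAt ℝ (fun z => m z x) z)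
    (hbound : ∀ᵐ x ∂lam, ∀ z ∈ U, ∀ i, |partialD i (fun z => m z x) z| ≤ L x)
    {z : EuclideanSpace ℝ (Fin d) × EuclideanSpace ℝ (Fin d)} (hz : z ∈ U) :
    (∀ i, Integrable (fun x => partialD i (fun z => m z x) z) lam) ∧
      HasFDerivAt (fun z => ∫ x, m z x ∂lam)
        (∑ i, (∫ x, partialD i (fun z => m z x) z ∂lam) • coord i) z := by
  have hpm := fun i => aestronglyMeasurable_partialD hU hmeas hz (hdiff.mono fun x hx => hx z hz) i
  have hpi : ∀ i, Integrable (fun x => partialD i (fun z => m z x) z) lam := fun i =>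
    hL.mono' (hpm i) (hbound.mono fun x hx => hx z hz i)
  refine ⟨hpi, ?_⟩
  have hmain := hasFDerivAt_integral_of_dominated_of_fderiv_le (μ := lam) (F := m) (x₀ := z)
    (F' := fun z x => ∑ i, partialD i (fun z => m z x) z • coord i)
    (bound := fun x => Fintype.card (Fin d ⊕ Fin d) * L x) (hU.mem_nhds hz)
    (eventually_of_mem (hU.mem_nhds hz) hmeas) (hint z hz) ?_ ?_ (hL.const_mul _) ?_
  · refine hmain.congr_fderiv ?_
    rw [integral_finsetSum _ fun i _ => (hpi i).smul_const _]
    exact Finset.sum_congr rfl fun i _ => integral_smul_const _ _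
  · exact Finset.aestronglyMeasurable_fun_sum _ fun i _ => (hpm i).smul_const _
  · filter_upwards [hbound] with x hx y hy
    refine (norm_sum_le _ _).trans ?_
    rw [← Finset.card_univ, ← nsmul_eq_mul]
    refine Finset.sum_le_card_nsmul _ _ _ fun j _ => ?_
    rw [norm_smul]
    exact (mul_le_of_le_one_right (norm_nonneg _) (norm_coord_le j)).trans (hx y hy j)
  · filter_upwards [hdiff] with x hx y hy
    exact hasFDerivAt_sum_partialD (hx y hy)

end PhiDivergence
end

noncomputable section

namespace PhiDivergence

/-! ### Min-max points of empirical contrasts -/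

variable {d : ℕ} {𝒳 : Type*}

/-- The radial retraction onto the closed ball of radius `R` around `z₀`. -/
def radialRetract {V : Type*} [NormedAddCommGroup V] [NormedSpace ℝ V] (z₀ : V) (R : ℝ) (z : V) :
    V :=
  z₀ + (R / max R ‖z - z₀‖) • (z - z₀)

section radialRetract

variable {V : Type*} [NormedAddCommGroup V] [NormedSpace ℝ V] {z₀ : V} {R : ℝ}

lemma continuous_radialRetract (hR : 0 < R) : Continuous (radialRetract z₀ R) := by
  have : ∀ z : V, max R ‖z - z₀‖ ≠ 0 := fun z => (lt_max_of_lt_left hR).ne'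
  unfold radialRetract
  fun_prop (disch := exact this _)

lemma radialRetract_mem (hR : 0 < R) (z : V) : radialRetract z₀ R z ∈ Metric.closedBall z₀ R := by
  have h : 0 < max R ‖z - z₀‖ := lt_max_of_lt_left hR
  rw [Metric.mem_closedBall, dist_eq_norm, radialRetract, add_sub_cancel_left, norm_smul,
    Real.norm_of_nonneg (div_nonneg hR.le h.le), div_mul_eq_mul_div, div_le_iff₀ h]
  exact mul_le_mul_of_nonneg_left (le_max_right _ _) hR.le

lemma radialRetract_of_mem (hR : 0 < R) {z : V} (hz : z ∈ Metric.closedBall z₀ R) :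
    radialRetract z₀ R z = z := by
  rw [Metric.mem_closedBall, dist_eq_norm] at hz
  rw [radialRetract, max_eq_left hz, div_self hR.ne', one_smul, add_sub_cancel]

end radialRetract

/-- The constant is the minimum of the quadratic form on the unit sphere, positive by compactness;
homogeneity extends the bound to all vectors. -/
lemma exists_coercive_of_posDef {S : Matrix (Fin d) (Fin d) ℝ} (hS : S.PosDef) :
    ∃ κ > 0, ∀ u : EuclideanSpace ℝ (Fin d),
      κ * ‖u‖ ^ 2 ≤ inner ℝ (Matrix.toEuclideanCLM (𝕜 := ℝ) S u) u := by
  -- In dimension zero the unit sphere is empty and any constant works.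
  rcases subsingleton_or_nontrivial (EuclideanSpace ℝ (Fin d)) with hE | hE
  · exact ⟨1, one_pos, fun u => by rw [Subsingleton.elim u 0]; simp⟩
  obtain ⟨w, hw, hmin⟩ := (isCompact_sphere (0 : EuclideanSpace ℝ (Fin d)) 1).exists_isMinOn
    (NormedSpace.sphere_nonempty.2 zero_le_one)
    (f := fun u => inner ℝ (Matrix.toEuclideanCLM (𝕜 := ℝ) S u) u) (by fun_prop)
  have hpos : ∀ u : EuclideanSpace ℝ (Fin d), u ≠ 0 →
      0 < inner ℝ (Matrix.toEuclideanCLM (𝕜 := ℝ) S u) u := by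
    intro u hu
    rw [real_inner_comm, Matrix.inner_toEuclideanCLM]
    have hu' : u.ofLp ≠ 0 := fun h => hu (by ext i; exact congrFun h i)
    have := hS.dotProduct_mulVec_pos hu'
    simpa using this
  have hw0 : w ≠ 0 := by
    rintro rfl; simp at hw
  refine ⟨_, hpos w hw0, fun u => ?_⟩
  by_cases hu : u = 0
  · simp [hu]
  have hu0 : 0 < ‖u‖ := norm_pos_iff.2 hu
  have h1 : ‖u‖⁻¹ • u ∈ Metric.sphere (0 : EuclideanSpace ℝ (Fin d)) 1 := by
    simp [norm_smul, hu0.ne']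
  have h2 := hmin h1
  simp only [mem_ofPred_eq, map_smul, inner_smul_left, inner_smul_right, conj_trivial] at h2
  rw [← mul_assoc, ← mul_inv, ← sq, ← div_eq_inv_mul, le_div_iff₀ (by positivity)] at h2
  exact h2

/-- Smoothness of the contrast `H` at the observation `x`: on the ball of radius `ρ` around
`(θ₀, θ₀)`, its second order partial derivatives grow at most linearly with slope `K x`, and at the
centre its gradient is `(-c s, c s)`. -/
structure RegularPoint (H : EuclideanSpace ℝ (Fin d) × EuclideanSpace ℝ (Fin d) → 𝒳 → ℝ)
    (θ₀ : EuclideanSpace ℝ (Fin d)) (s : 𝒳 → EuclideanSpace ℝ (Fin d)) (K : 𝒳 → ℝ) (c ρ : ℝ)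
    (x : 𝒳) : Prop where
  diff : ∀ z ∈ Metric.ball (θ₀, θ₀) ρ, DifferentiableAt ℝ (fun z => H z x) z
  diff_partialD : ∀ i, ∀ z ∈ Metric.ball (θ₀, θ₀) ρ,
    DifferentiableAt ℝ (partialD i fun z => H z x) z
  lip : ∀ z ∈ Metric.ball (θ₀, θ₀) ρ, ∀ i j,
    |partialD j (partialD i fun z => H z x) z - partialD j (partialD i fun z => H z x) (θ₀, θ₀)| ≤
      K x * ‖z - (θ₀, θ₀)‖
  score_inl : ∀ i, partialD (Sum.inl i) (fun z => H z x) (θ₀, θ₀) = -(c * s x i)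
  score_inr : ∀ i, partialD (Sum.inr i) (fun z => H z x) (θ₀, θ₀) = c * s x i

/-- A contrast `H` which is smooth at almost every observation, whose gradient at `(θ₀, θ₀)` has
mean `0` and covariance given by `S`, and whose Hessian at `(θ₀, θ₀)` has mean
`diag (c S, -c S)`. -/
structure RegularContrast [MeasurableSpace 𝒳] (P : Measure 𝒳)
    (H : EuclideanSpace ℝ (Fin d) × EuclideanSpace ℝ (Fin d) → 𝒳 → ℝ)
    (θ₀ : EuclideanSpace ℝ (Fin d)) (s : 𝒳 → EuclideanSpace ℝ (Fin d)) (K : 𝒳 → ℝ)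
    (S : Matrix (Fin d) (Fin d) ℝ) (c ρ : ℝ) : Prop where
  c_pos : 0 < c
  ρ_pos : 0 < ρ
  measurable : ∀ z ∈ Metric.ball (θ₀, θ₀) ρ, Measurable (H z)
  integrable_bound : Integrable K P
  bound_nonneg : ∀ x, 0 ≤ K x
  measurable_score : Measurable s
  memLp_score : MemLp s 2 P
  integral_score : ∫ x, s x ∂P = 0
  posDef : S.PosDef
  integral_score_mul : ∀ i j, ∫ x, s x i * s x j ∂P = S i j
  regular : ∀ᵐ x ∂P, RegularPoint H θ₀ s K c ρ x
  integrable_hess : ∀ i j,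
    Integrable (fun x => partialD j (partialD i fun z => H z x) (θ₀, θ₀)) P
  integral_hess : ∀ i j, ∫ x, partialD j (partialD i fun z => H z x) (θ₀, θ₀) ∂P =
    c * Matrix.fromBlocks S 0 0 (-S) i j

section truncGrad

variable {H : EuclideanSpace ℝ (Fin d) × EuclideanSpace ℝ (Fin d) → 𝒳 → ℝ}
  {z₀ : EuclideanSpace ℝ (Fin d) × EuclideanSpace ℝ (Fin d)} {R ρ : ℝ} {T : Set 𝒳}

/-- The gradient of `H` at the projection of `z` onto a ball, set to zero for `x ∉ T`. -/
def truncGrad (H : EuclideanSpace ℝ (Fin d) × EuclideanSpace ℝ (Fin d) → 𝒳 → ℝ)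
    (z₀ : EuclideanSpace ℝ (Fin d) × EuclideanSpace ℝ (Fin d)) (R : ℝ) (T : Set 𝒳)
    (z : EuclideanSpace ℝ (Fin d) × EuclideanSpace ℝ (Fin d)) (x : 𝒳) :
    EuclideanSpace ℝ (Fin d) × EuclideanSpace ℝ (Fin d) :=
  ∑ i, T.indicator (fun x => partialD i (fun z => H z x) (radialRetract z₀ R z)) x • dir i

/-- The mean of the truncated gradient over the first `n` observations. -/
def meanGrad (H : EuclideanSpace ℝ (Fin d) × EuclideanSpace ℝ (Fin d) → 𝒳 → ℝ)
    (z₀ : EuclideanSpace ℝ (Fin d) × EuclideanSpace ℝ (Fin d)) (R : ℝ) (T : Set 𝒳) (X : ℕ → 𝒳)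
    (n : ℕ) (z : EuclideanSpace ℝ (Fin d) × EuclideanSpace ℝ (Fin d)) :
    EuclideanSpace ℝ (Fin d) × EuclideanSpace ℝ (Fin d) :=
  (n : ℝ)⁻¹ • ∑ k ∈ Finset.range n, truncGrad H z₀ R T z (X k)

lemma coord_meanGrad (hR : 0 < R) {X : ℕ → 𝒳} (hX : ∀ k, X k ∈ T) (n : ℕ)
    {z : EuclideanSpace ℝ (Fin d) × EuclideanSpace ℝ (Fin d)} (hz : z ∈ Metric.closedBall z₀ R)
    (i : Fin d ⊕ Fin d) :
    coord i (meanGrad H z₀ R T X n z) = empMean X n fun x => partialD i (fun z => H z x) z := by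
  rw [meanGrad, map_smul, map_sum, empMean, smul_eq_mul]
  congr 1
  refine Finset.sum_congr rfl fun k _ => ?_
  rw [truncGrad, coord_sum_smul_dir, indicator_of_mem (hX k), radialRetract_of_mem hR hz]

lemma measurable_truncGrad [MeasurableSpace 𝒳] (hR : 0 < R) (hRρ : R < ρ) (hT : MeasurableSet T)
    (hH : ∀ z ∈ Metric.ball z₀ ρ, Measurable (H z))
    (hdiff : ∀ x ∈ T, ∀ z ∈ Metric.ball z₀ ρ, DifferentiableAt ℝ (fun z => H z x) z)
    (z : EuclideanSpace ℝ (Fin d) × EuclideanSpace ℝ (Fin d)) :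
    Measurable (truncGrad H z₀ R T z) := by
  refine Finset.measurable_fun_sum _ fun i _ => Measurable.smul_const ?_ _
  set y := radialRetract z₀ R z with hy
  have hyρ : y ∈ Metric.ball z₀ ρ :=
    Metric.closedBall_subset_ball hRρ (radialRetract_mem hR z)
  have hlim : Tendsto (fun n : ℕ => y + (1 / ((n : ℝ) + 1)) • dir i) atTop (𝓝 y) := by
    simpa using
      ((tendsto_one_div_add_atTop_nhds_zero_nat (𝕜 := ℝ)).smul_const (dir i)).const_add y
  obtain ⟨N, hN⟩ := eventually_atTop.1 (hlim.eventually (Metric.isOpen_ball.mem_nhds hyρ))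
  refine measurable_of_tendsto_metrizable (f := fun (n : ℕ) => T.indicator fun x =>
    (1 / (((n + N : ℕ) : ℝ) + 1))⁻¹ * (H (y + (1 / (((n + N : ℕ) : ℝ) + 1)) • dir i) x - H y x))
    (fun n => (((hH _ (hN _ (Nat.le_add_left _ _))).sub (hH _ hyρ)).const_mul _).indicator hT)
    (tendsto_pi_nhds.2 fun x => ?_)
  by_cases hx : x ∈ T
  · simp only [indicator_of_mem hx]
    have hd := (hdiff x hx y hyρ).hasFDerivAt
    have h1 := (hd.hasLineDerivAt (dir i)).tendsto_slope_zero
    rw [partialD_eq hd]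
    have h2 : Tendsto (fun n : ℕ => 1 / (((n + N : ℕ) : ℝ) + 1)) atTop (𝓝[≠] 0) := by
      refine tendsto_nhdsWithin_iff.2 ⟨?_, Eventually.of_forall fun n => ?_⟩
      · exact (tendsto_add_atTop_iff_nat N).2 tendsto_one_div_add_atTop_nhds_zero_nat
      · simp only [mem_compl_iff, mem_singleton_iff]; positivity
    exact h1.comp h2
  · simp only [indicator_of_notMem hx]
    exact tendsto_const_nhds

/-- Retracting onto the ball makes continuity in `z` global. Together with measurability in `x` this
gives a Carathéodory function, hence joint measurability. -/
lemma continuous_truncGrad (hR : 0 < R) (hRρ : R < ρ)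
    (hdiff : ∀ x ∈ T, ∀ i, ∀ z ∈ Metric.ball z₀ ρ,
      DifferentiableAt ℝ (partialD i fun z => H z x) z) (x : 𝒳) :
    Continuous fun z => truncGrad H z₀ R T z x := by
  refine continuous_finsetSum _ fun i _ => ?_
  suffices hc : Continuous fun z =>
      T.indicator (fun x => partialD i (fun z => H z x) (radialRetract z₀ R z)) x from
    hc.smul continuous_const
  by_cases hx : x ∈ T
  · simp only [indicator_of_mem hx]
    refine continuous_iff_continuousAt.2 fun z => ContinuousAt.comp
      (g := partialD i fun z => H z x) ?_ (continuous_radialRetract hR).continuousAt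
    exact (hdiff x hx i _ (Metric.closedBall_subset_ball hRρ (radialRetract_mem hR z))).continuousAt
  · simp only [indicator_of_notMem hx]
    exact continuous_const

/-- The gradient is evaluated at the previous iterate, which is itself random, so separate
measurability in `x` would not be enough. -/
lemma measurable_iterate_newtonStep [MeasurableSpace 𝒳] {Ω : Type*} [MeasurableSpace Ω]
    (hR : 0 < R) (hRρ : R < ρ) (hT : MeasurableSet T) (hH : ∀ z ∈ Metric.ball z₀ ρ, Measurable (H z))
    (hdiff : ∀ x ∈ T, ∀ z ∈ Metric.ball z₀ ρ, DifferentiableAt ℝ (fun z => H z x) z)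
    (hdiff2 : ∀ x ∈ T, ∀ i, ∀ z ∈ Metric.ball z₀ ρ,
      DifferentiableAt ℝ (partialD i fun z => H z x) z)
    {X : ℕ → Ω → 𝒳} (hX : ∀ k, Measurable (X k)) (n : ℕ)
    (B : EuclideanSpace ℝ (Fin d) →L[ℝ] EuclideanSpace ℝ (Fin d)) (k : ℕ) :
    Measurable fun ω => (newtonStep (meanGrad H z₀ R T (fun i => X i ω) n) B)^[k] z₀ := by
  have hunc : Measurable (Function.uncurry (truncGrad H z₀ R T)) :=
    measurable_uncurry_of_continuous_of_measurable (continuous_truncGrad hR hRρ hdiff2)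
      (measurable_truncGrad hR hRρ hT hH hdiff)
  have hG : ∀ Z : Ω → EuclideanSpace ℝ (Fin d) × EuclideanSpace ℝ (Fin d), Measurable Z →
      Measurable fun ω => meanGrad H z₀ R T (fun i => X i ω) n (Z ω) := by
    intro Z hZ
    have h1 : ∀ j, Measurable fun ω => truncGrad H z₀ R T (Z ω) (X j ω) := fun j => by
      have hp : Measurable fun ω => (Z ω, X j ω) := hZ.prodMk (hX j)
      have := hunc.comp hp
      exact this
    have h2 : Measurable fun ω => ∑ j ∈ Finset.range n, truncGrad H z₀ R T (Z ω) (X j ω) :=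
      Finset.measurable_fun_sum _ fun j _ => h1 j
    exact (measurable_const_smul (n : ℝ)⁻¹).comp h2
  have hN : ∀ Z : Ω → EuclideanSpace ℝ (Fin d) × EuclideanSpace ℝ (Fin d), Measurable Z →
      Measurable fun ω => newtonStep (meanGrad H z₀ R T (fun i => X i ω) n) B (Z ω) := by
    intro Z hZ
    have h1 := hG Z hZ
    exact hZ.sub ((B.measurable.comp h1.fst).prodMk (B.measurable.comp h1.snd).neg)
  induction k with
  | zero => exact measurable_const
  | succ k ih =>
    simp only [Function.iterate_succ_apply']
    exact hN _ ih

end truncGrad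

end PhiDivergence
end

noncomputable section

namespace PhiDivergence

/-! ### Gradient and Hessian of the empirical contrast near the centre. -/

section Deterministic

variable {d : ℕ} {𝒳 : Type*}

/-- A bound for the distance between the Hessian of the empirical contrast near `(θ₀, θ₀)` and
`diag (c S, -c S)`. -/
def hessErr (H : EuclideanSpace ℝ (Fin d) × EuclideanSpace ℝ (Fin d) → 𝒳 → ℝ)
    (θ₀ : EuclideanSpace ℝ (Fin d)) (K : 𝒳 → ℝ) (S : Matrix (Fin d) (Fin d) ℝ) (c : ℝ)
    (X : ℕ → 𝒳) (n : ℕ) : ℝ :=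
  ∑ i, (Fintype.card (Fin d ⊕ Fin d) * ((n : ℝ) ^ (-(1 / 3) : ℝ) * empMean X n K) +
    ∑ j, |empMean X n (fun x => partialD j (partialD i fun z => H z x) (θ₀, θ₀)) -
      c * Matrix.fromBlocks S 0 0 (-S) i j|)

lemma innerSL_coprod_eq (g : EuclideanSpace ℝ (Fin d) × EuclideanSpace ℝ (Fin d)) :
    (innerSL ℝ g.1).coprod (innerSL ℝ g.2) = ∑ i, coord i g • coord i := by
  refine ContinuousLinearMap.ext fun v => ?_
  simp [Fintype.sum_sum_type, PiLp.inner_apply, mul_comm]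

lemma coord_prodMap_toEuclideanCLM (S : Matrix (Fin d) (Fin d) ℝ) (c : ℝ)
    (v : EuclideanSpace ℝ (Fin d) × EuclideanSpace ℝ (Fin d)) (i : Fin d ⊕ Fin d) :
    coord i ((c • Matrix.toEuclideanCLM (𝕜 := ℝ) S) v.1,
      -(c • Matrix.toEuclideanCLM (𝕜 := ℝ) S) v.2) =
      ∑ j, c * Matrix.fromBlocks S 0 0 (-S) i j * coord j v := by
  rcases i with i | i <;>
    simp [Fintype.sum_sum_type, Matrix.mulVec, dotProduct, Finset.mul_sum, mul_assoc]

variable {H : EuclideanSpace ℝ (Fin d) × EuclideanSpace ℝ (Fin d) → 𝒳 → ℝ}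
  {θ₀ : EuclideanSpace ℝ (Fin d)} {s : 𝒳 → EuclideanSpace ℝ (Fin d)} {K : 𝒳 → ℝ}
  {S : Matrix (Fin d) (Fin d) ℝ} {c ρ R : ℝ} {T : Set 𝒳} {X : ℕ → 𝒳} {n : ℕ}

lemma hasFDerivAt_empMean (hR : 0 < R) (hRρ : R < ρ)
    (hT : ∀ x ∈ T, RegularPoint H θ₀ s K c ρ x) (hX : ∀ k, X k ∈ T)
    {z : EuclideanSpace ℝ (Fin d) × EuclideanSpace ℝ (Fin d)}
    (hz : z ∈ Metric.closedBall (θ₀, θ₀) R) :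
    HasFDerivAt (fun z => empMean X n (H z))
      ((innerSL ℝ (meanGrad H (θ₀, θ₀) R T X n z).1).coprod
        (innerSL ℝ (meanGrad H (θ₀, θ₀) R T X n z).2)) z := by
  have h1 : ∀ k, HasFDerivAt (fun z => H z (X k))
      (∑ i, partialD i (fun z => H z (X k)) z • coord i) z := fun k =>
    hasFDerivAt_sum_partialD ((hT _ (hX k)).diff z (Metric.closedBall_subset_ball hRρ hz))
  have h2 := (HasFDerivAt.fun_sum fun k (_ : k ∈ Finset.range n) => h1 k).const_mul (n : ℝ)⁻¹
  refine h2.congr_fderiv ?_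
  rw [innerSL_coprod_eq, Finset.sum_comm, Finset.smul_sum]
  refine Finset.sum_congr rfl fun i _ => ?_
  rw [coord_meanGrad hR hX n hz, empMean, ← Finset.sum_smul, smul_smul]

lemma meanGrad_center (hR : 0 < R) (hT : ∀ x ∈ T, RegularPoint H θ₀ s K c ρ x)
    (hX : ∀ k, X k ∈ T) :
    meanGrad H (θ₀, θ₀) R T X n (θ₀, θ₀) =
      (-(c • (n : ℝ)⁻¹ • ∑ k ∈ Finset.range n, s (X k)),
        c • (n : ℝ)⁻¹ • ∑ k ∈ Finset.range n, s (X k)) := by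
  refine ext_coord fun i => ?_
  rw [coord_meanGrad hR hX n (Metric.mem_closedBall_self hR.le), empMean]
  rcases i with i | i
  · simp_rw [(hT _ (hX _)).score_inl i]
    simp [← Finset.mul_sum]; ring
  · simp_rw [(hT _ (hX _)).score_inr i]
    simp [← Finset.mul_sum]; ring

lemma norm_meanGrad_center (hR : 0 < R) (hc : 0 < c)
    (hT : ∀ x ∈ T, RegularPoint H θ₀ s K c ρ x) (hX : ∀ k, X k ∈ T) :
    ‖meanGrad H (θ₀, θ₀) R T X n (θ₀, θ₀)‖ =
      c * ‖(n : ℝ)⁻¹ • ∑ k ∈ Finset.range n, s (X k)‖ := by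
  rw [meanGrad_center hR hT hX, Prod.norm_def, norm_neg, max_self, norm_smul,
    Real.norm_of_nonneg hc.le]

/-- For each observation and each coordinate of the gradient, the mean value inequality replaces
increments by the Hessian at the centre, at a cost governed by `K x` times the radius. Averaging
these costs gives the first part of `hessErr`; replacing the averaged Hessian by its mean gives the
second. -/
lemma norm_meanGrad_sub_le (hR : 0 < R) (hRρ : R < ρ) (hK : ∀ x, 0 ≤ K x)
    (hT : ∀ x ∈ T, RegularPoint H θ₀ s K c ρ x) (hX : ∀ k, X k ∈ T)
    (hn : (n : ℝ) ^ (-(1 / 3) : ℝ) ≤ R)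
    {z w : EuclideanSpace ℝ (Fin d) × EuclideanSpace ℝ (Fin d)}
    (hz : z ∈ Metric.closedBall (θ₀, θ₀) ((n : ℝ) ^ (-(1 / 3) : ℝ)))
    (hw : w ∈ Metric.closedBall (θ₀, θ₀) ((n : ℝ) ^ (-(1 / 3) : ℝ))) :
    ‖meanGrad H (θ₀, θ₀) R T X n z - meanGrad H (θ₀, θ₀) R T X n w -
      ((c • Matrix.toEuclideanCLM (𝕜 := ℝ) S) (z - w).1,
        -(c • Matrix.toEuclideanCLM (𝕜 := ℝ) S) (z - w).2)‖ ≤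
      hessErr H θ₀ K S c X n * ‖z - w‖ := by
  set r := (n : ℝ) ^ (-(1 / 3) : ℝ) with hr
  have hsub := Metric.closedBall_subset_closedBall (x := ((θ₀, θ₀) : _ × _)) hn
  refine (norm_le_sum_abs_coord _).trans ?_
  rw [hessErr, Finset.sum_mul]
  refine Finset.sum_le_sum fun i _ => ?_
  rw [map_sub, map_sub, coord_meanGrad hR hX n (hsub hz), coord_meanGrad hR hX n (hsub hw),
    coord_prodMap_toEuclideanCLM, add_mul]
  set a : Fin d ⊕ Fin d → 𝒳 → ℝ := fun j x => partialD j (partialD i fun z => H z x) (θ₀, θ₀)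
    with ha
  have hx : ∀ x ∈ T, |partialD i (fun z => H z x) z - partialD i (fun z => H z x) w -
      ∑ j, a j x * coord j (z - w)| ≤
        Fintype.card (Fin d ⊕ Fin d) * (K x * r) * ‖z - w‖ := by
    intro x hxT
    refine abs_sub_sub_le_of_partialD_sub_le (convex_closedBall _ r) (fun y hy => ?_)
      (fun y hy j => ?_) hz hw
    · exact (hT x hxT).diff_partialD i y (Metric.closedBall_subset_ball hRρ (hsub hy))
    · refine ((hT x hxT).lip y (Metric.closedBall_subset_ball hRρ (hsub hy)) i j).trans ?_
      refine mul_le_mul_of_nonneg_left ?_ (hK x)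
      rwa [← dist_eq_norm]
  have hmean : |empMean X n (fun x => partialD i (fun z => H z x) z) -
      empMean X n (fun x => partialD i (fun z => H z x) w) -
      ∑ j, empMean X n (a j) * coord j (z - w)| ≤
        Fintype.card (Fin d ⊕ Fin d) * (r * empMean X n K) * ‖z - w‖ := by
    have e1 : empMean X n (fun x => partialD i (fun z => H z x) z) -
        empMean X n (fun x => partialD i (fun z => H z x) w) -
        ∑ j, empMean X n (a j) * coord j (z - w) = (n : ℝ)⁻¹ * ∑ k ∈ Finset.range n,
          (partialD i (fun z => H z (X k)) z - partialD i (fun z => H z (X k)) w -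
            ∑ j, a j (X k) * coord j (z - w)) := by
      simp only [empMean, Finset.sum_sub_distrib, mul_sub]
      congr 1
      rw [Finset.sum_comm, Finset.mul_sum]
      refine Finset.sum_congr rfl fun j _ => ?_
      rw [← Finset.sum_mul, mul_assoc]
    have e2 : Fintype.card (Fin d ⊕ Fin d) * (r * empMean X n K) * ‖z - w‖ =
        (n : ℝ)⁻¹ * ∑ k ∈ Finset.range n,
          Fintype.card (Fin d ⊕ Fin d) * (K (X k) * r) * ‖z - w‖ := by
      rw [← Finset.sum_mul, ← Finset.mul_sum, ← Finset.sum_mul, empMean]; ring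
    rw [e1, e2, abs_mul, abs_of_nonneg (by positivity : (0 : ℝ) ≤ (n : ℝ)⁻¹)]
    refine mul_le_mul_of_nonneg_left ?_ (by positivity)
    exact (Finset.abs_sum_le_sum_abs _ _).trans (Finset.sum_le_sum fun k _ => hx _ (hX k))
  have hlin : |∑ j, empMean X n (a j) * coord j (z - w) -
      ∑ j, c * Matrix.fromBlocks S 0 0 (-S) i j * coord j (z - w)| ≤
        (∑ j, |empMean X n (a j) - c * Matrix.fromBlocks S 0 0 (-S) i j|) * ‖z - w‖ := by
    rw [← Finset.sum_sub_distrib, Finset.sum_mul]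
    refine (Finset.abs_sum_le_sum_abs _ _).trans (Finset.sum_le_sum fun j _ => ?_)
    rw [← sub_mul, abs_mul]
    exact mul_le_mul_of_nonneg_left (abs_coord_le _ _) (abs_nonneg _)
  calc _ ≤ _ := abs_sub_le _ (∑ j, empMean X n (a j) * coord j (z - w)) _
    _ ≤ _ := add_le_add hmean hlin

lemma hessErr_nonneg (hK : ∀ x, 0 ≤ K x) : 0 ≤ hessErr H θ₀ K S c X n := by
  have h1 : 0 ≤ empMean X n K :=
    mul_nonneg (by positivity) (Finset.sum_nonneg fun k _ => hK _)
  exact Finset.sum_nonneg fun i _ => add_nonneg (by positivity)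
    (Finset.sum_nonneg fun j _ => abs_nonneg _)

end Deterministic

/-! ### Almost sure behaviour and limit law of the min-max points. -/

section Random

variable {d : ℕ} {𝒳 Ω : Type*} [MeasurableSpace 𝒳] [MeasurableSpace Ω] {Pr : Measure Ω}
  {P : Measure 𝒳} {X : ℕ → Ω → 𝒳}

lemma identDistrib_comp {β : Type*} [MeasurableSpace β] (hX : ∀ k, Measurable (X k))
    (hlaw : ∀ k, Pr.map (X k) = P) {f : 𝒳 → β} (hf : AEMeasurable f P) (k : ℕ) :
    IdentDistrib (fun ω => f (X k ω)) (fun ω => f (X 0 ω)) Pr Pr := by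
  have h : IdentDistrib (X k) (X 0) Pr Pr :=
    ⟨(hX k).aemeasurable, (hX 0).aemeasurable, by rw [hlaw, hlaw]⟩
  exact h.comp_of_aemeasurable (by rwa [hlaw])

lemma integral_comp_law {V : Type*} [NormedAddCommGroup V] [NormedSpace ℝ V]
    (hX : ∀ k, Measurable (X k)) (hlaw : ∀ k, Pr.map (X k) = P)
    {f : 𝒳 → V} (hf : AEStronglyMeasurable f P) (k : ℕ) :
    ∫ ω, f (X k ω) ∂Pr = ∫ x, f x ∂P := by
  rw [← hlaw k, integral_map (hX k).aemeasurable (by rwa [hlaw k])]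

/-- The strong law of large numbers for the empirical measure. -/
lemma ae_tendsto_empMean (hX : ∀ k, Measurable (X k)) (hindep : iIndepFun X Pr)
    (hlaw : ∀ k, Pr.map (X k) = P) {f : 𝒳 → ℝ} (hf : Integrable f P) :
    ∀ᵐ ω ∂Pr, Tendsto (fun n => empMean (fun i => X i ω) n f) atTop (𝓝 (∫ x, f x ∂P)) := by
  have hmap : ∀ k, AEMeasurable f (Pr.map (X k)) := fun k => by rw [hlaw]; exact hf.aemeasurable
  have hint : Integrable (fun ω => f (X 0 ω)) Pr :=
    (by rwa [hlaw] : Integrable f (Pr.map (X 0))).comp_measurable (hX 0)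
  have := strong_law_ae (fun k ω => f (X k ω)) hint
    (fun i j hij => (hindep.indepFun hij).comp₀ (hX i).aemeasurable (hX j).aemeasurable
      (hmap i) (hmap j))
    (identDistrib_comp hX hlaw hf.aemeasurable)
  rw [← integral_comp_law hX hlaw hf.aestronglyMeasurable 0]
  exact this

lemma tendsto_nat_rpow_neg : Tendsto (fun n : ℕ => (n : ℝ) ^ (-(1 / 3) : ℝ)) atTop (𝓝 0) :=
  (tendsto_rpow_neg_atTop (by norm_num : (0 : ℝ) < 1 / 3)).comp tendsto_natCast_atTop_atTop

variable {H : EuclideanSpace ℝ (Fin d) × EuclideanSpace ℝ (Fin d) → 𝒳 → ℝ}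
  {θ₀ : EuclideanSpace ℝ (Fin d)} {s : 𝒳 → EuclideanSpace ℝ (Fin d)} {K : 𝒳 → ℝ}
  {S : Matrix (Fin d) (Fin d) ℝ} {c ρ : ℝ}

namespace RegularContrast

lemma aemeasurable_hessErr (hc : RegularContrast P H θ₀ s K S c ρ) (hX : ∀ k, Measurable (X k))
    (hlaw : ∀ k, Pr.map (X k) = P) (n : ℕ) :
    AEMeasurable (fun ω => hessErr H θ₀ K S c (fun i => X i ω) n) Pr := by
  have h : ∀ f : 𝒳 → ℝ, Integrable f P →
      AEMeasurable (fun ω => empMean (fun i => X i ω) n f) Pr := fun f hf => by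
    refine AEMeasurable.const_mul (Finset.aemeasurable_fun_sum _ fun k _ => ?_) _
    exact AEMeasurable.comp_measurable (by rw [hlaw]; exact hf.aemeasurable) (hX k)
  refine Finset.aemeasurable_fun_sum _ fun i _ => AEMeasurable.add ?_ ?_
  · exact ((h K hc.integrable_bound).const_mul _).const_mul _
  · exact Finset.aemeasurable_fun_sum _ fun j _ =>
      continuous_abs.measurable.comp_aemeasurable ((h _ (hc.integrable_hess i j)).sub_const _)

/-- The strong law handles each of the finitely many Hessian entries at the centre. The averages of
`K` converge too, and they are multiplied by the shrinking radius. -/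
lemma ae_tendsto_hessErr (hc : RegularContrast P H θ₀ s K S c ρ) (hX : ∀ k, Measurable (X k))
    (hindep : iIndepFun X Pr) (hlaw : ∀ k, Pr.map (X k) = P) :
    ∀ᵐ ω ∂Pr, Tendsto (fun n => hessErr H θ₀ K S c (fun i => X i ω) n) atTop (𝓝 0) := by
  have h1 := ae_tendsto_empMean hX hindep hlaw hc.integrable_bound
  have h2 : ∀ᵐ ω ∂Pr, ∀ i j, Tendsto (fun n => empMean (fun i => X i ω) n
      fun x => partialD j (partialD i fun z => H z x) (θ₀, θ₀)) atTop
      (𝓝 (c * Matrix.fromBlocks S 0 0 (-S) i j)) := by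
    refine ae_all_iff.2 fun i => ae_all_iff.2 fun j => ?_
    rw [← hc.integral_hess i j]
    exact ae_tendsto_empMean hX hindep hlaw (hc.integrable_hess i j)
  filter_upwards [h1, h2] with ω h1 h2
  have h3 : ∀ i, Tendsto (fun n : ℕ => Fintype.card (Fin d ⊕ Fin d) *
      ((n : ℝ) ^ (-(1 / 3) : ℝ) * empMean (fun i => X i ω) n K) +
    ∑ j, |empMean (fun i => X i ω) n (fun x => partialD j (partialD i fun z => H z x) (θ₀, θ₀)) -
      c * Matrix.fromBlocks S 0 0 (-S) i j|) atTop (𝓝 (Fintype.card (Fin d ⊕ Fin d) *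
        (0 * ∫ x, K x ∂P) + ∑ j : Fin d ⊕ Fin d, |(0 : ℝ)|)) := by
    intro i
    refine ((tendsto_nat_rpow_neg.mul h1).const_mul _).add
      (tendsto_finsetSum _ fun j _ => ?_)
    have := (h2 i j).sub_const (c * Matrix.fromBlocks S 0 0 (-S) i j)
    rw [sub_self] at this
    exact this.abs
  have h4 := tendsto_finsetSum (Finset.univ : Finset (Fin d ⊕ Fin d)) fun i _ => h3 i
  simp only [zero_mul, abs_zero, Finset.sum_const_zero, mul_zero, add_zero] at h4
  exact h4

variable [IsProbabilityMeasure Pr]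

/-- This rate makes the first Newton step negligible against the radius `n^(-1/3)`, which is why the
min-max points fall in the interior; a mere law of large numbers would not suffice. -/
lemma ae_tendsto_score (hc : RegularContrast P H θ₀ s K S c ρ) (hX : ∀ k, Measurable (X k))
    (hindep : iIndepFun X Pr) (hlaw : ∀ k, Pr.map (X k) = P) :
    ∀ᵐ ω ∂Pr, Tendsto (fun n : ℕ => (n : ℝ) ^ (1 / 3 : ℝ) *
      ‖(n : ℝ)⁻¹ • ∑ k ∈ Finset.range n, s (X k ω)‖) atTop (𝓝 0) := by
  have hsi : ∀ i, Measurable fun x => s x i := fun i => by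
    have := hc.measurable_score; fun_prop
  have hL2 : ∀ i, MemLp (fun x => s x i) 2 P := fun i =>
    (EuclideanSpace.proj (𝕜 := ℝ) i).comp_memLp' hc.memLp_score
  have : IsProbabilityMeasure P := by
    rw [← hlaw 0]; exact Measure.isProbabilityMeasure_map (hX 0).aemeasurable
  have h0 : ∀ i, ∫ x, s x i ∂P = 0 := fun i => by
    have := (EuclideanSpace.proj (𝕜 := ℝ) i).integral_comp_comm
      (hc.memLp_score.integrable (by norm_num))
    rw [hc.integral_score] at this
    simpa using this
  have h1 : ∀ᵐ ω ∂Pr, ∀ i, Tendsto (fun n : ℕ => (n : ℝ) ^ (1 / 3 : ℝ) *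
      ((n : ℝ)⁻¹ * ∑ k ∈ Finset.range n, s (X k ω) i)) atTop (𝓝 0) := by
    refine ae_all_iff.2 fun i => ?_
    refine ae_tendsto_rpow_mul_mean (Y := fun k ω => s (X k ω) i) (fun k => (hsi i).comp (hX k))
      (hindep.comp (fun _ x => s x i) fun _ => hsi i)
      (identDistrib_comp hX hlaw (hsi i).aemeasurable) ?_ ?_
    · exact MemLp.comp_measurePreserving (hL2 i) ⟨hX 0, hlaw 0⟩
    · rw [integral_comp_law hX hlaw (f := fun x => s x i) (hsi i).aestronglyMeasurable, h0]
  filter_upwards [h1] with ω hω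
  have h2 := tendsto_finsetSum (Finset.univ : Finset (Fin d)) fun i _ => (hω i).abs
  simp only [abs_zero, Finset.sum_const_zero] at h2
  refine squeeze_zero (fun n => by positivity) (fun n => ?_) h2
  set v := (n : ℝ)⁻¹ • ∑ k ∈ Finset.range n, s (X k ω) with hv
  have h3 : ‖v‖ ≤ ∑ i, |v i| := by
    have := norm_le_sum_abs_coord (v, (0 : EuclideanSpace ℝ (Fin d)))
    simpa [Fintype.sum_sum_type, Prod.norm_def] using this
  have hpos : 0 ≤ (n : ℝ) ^ (1 / 3 : ℝ) := by positivity
  refine (mul_le_mul_of_nonneg_left h3 hpos).trans ?_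
  rw [Finset.mul_sum]
  refine Finset.sum_le_sum fun i _ => ?_
  rw [abs_mul, abs_of_nonneg hpos]
  simp [hv]

/-- Almost surely, for all large `n`, the empirical contrast is nearly quadratic on the ball of
radius `n ^ (-1/3)`. -/
lemma ae_eventually_nearSaddle (hc : RegularContrast P H θ₀ s K S c ρ)
    (hX : ∀ k, Measurable (X k)) (hindep : iIndepFun X Pr) (hlaw : ∀ k, Pr.map (X k) = P)
    {R : ℝ} (hR : 0 < R) (hRρ : R < ρ) {T : Set 𝒳} (hT : ∀ x ∈ T, RegularPoint H θ₀ s K c ρ x)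
    (hTae : ∀ᵐ x ∂P, x ∈ T) :
    ∃ κ b, ∀ᵐ ω ∂Pr, (∀ k, X k ω ∈ T) ∧ ∀ᶠ n : ℕ in atTop, (n : ℝ) ^ (-(1 / 3) : ℝ) ≤ R ∧
      NearSaddle (fun z => empMean (fun i => X i ω) n (H z))
        (meanGrad H (θ₀, θ₀) R T (fun i => X i ω) n) (c • Matrix.toEuclideanCLM (𝕜 := ℝ) S)
        (c⁻¹ • Matrix.toEuclideanCLM (𝕜 := ℝ) S⁻¹) θ₀ ((n : ℝ) ^ (-(1 / 3) : ℝ)) κ b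
        (hessErr H θ₀ K S c (fun i => X i ω) n) := by
  obtain ⟨κ, hκ, hcoer⟩ := exists_coercive_of_posDef hc.posDef
  set B := c⁻¹ • Matrix.toEuclideanCLM (𝕜 := ℝ) S⁻¹ with hB
  have hdet : IsUnit S.det := S.isUnit_iff_isUnit_det.1 hc.posDef.isUnit
  have hc0 : c ≠ 0 := hc.c_pos.ne'
  refine ⟨c * κ, ‖B‖, ?_⟩
  have hXT : ∀ᵐ ω ∂Pr, ∀ k, X k ω ∈ T := ae_all_iff.2 fun k =>
    ae_of_ae_map (hX k).aemeasurable (by rwa [hlaw])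
  filter_upwards [hXT, hc.ae_tendsto_hessErr hX hindep hlaw, hc.ae_tendsto_score hX hindep hlaw]
    with ω hω herr hscore
  refine ⟨hω, ?_⟩
  have e1 := herr.mul_const ‖B‖
  rw [zero_mul] at e1
  -- Once this quantity is at most `1`, it is the condition `small`, multiplied by `4 * n^(1/3)`.
  have e2 := hscore.const_mul (4 * (‖B‖ * c))
  rw [mul_zero] at e2
  filter_upwards [eventually_gt_atTop 0, tendsto_nat_rpow_neg.eventually (ge_mem_nhds hR),
    e1.eventually (ge_mem_nhds (by norm_num : (0 : ℝ) < 1 / 2)),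
    herr.eventually (gt_mem_nhds (mul_pos hc.c_pos hκ)),
    e2.eventually (ge_mem_nhds one_pos)] with n hn0 hnR hn1 hn2 hn3
  have hn0' : (0 : ℝ) < n := by exact_mod_cast hn0
  refine ⟨hnR, ?_⟩
  refine
    { r_pos := by positivity
      hasFDerivAt := fun z hz => hasFDerivAt_empMean hR hRρ hT hω
        (Metric.closedBall_subset_closedBall hnR hz)
      approx := fun z hz w hw =>
        norm_meanGrad_sub_le hR hRρ hc.bound_nonneg hT hω hnR hz hw
      left_inv := fun u => ?_
      right_inv := fun u => ?_
      coercive := fun u => ?_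
      bound := B.le_opNorm
      b_nonneg := norm_nonneg _
      eps_nonneg := hessErr_nonneg hc.bound_nonneg
      eps_mul_le := hn1
      eps_lt := hn2
      small := ?_ }
  · have : (Matrix.toEuclideanCLM (𝕜 := ℝ) S⁻¹ * Matrix.toEuclideanCLM (𝕜 := ℝ) S) u = u := by
      rw [← map_mul, Matrix.nonsing_inv_mul _ hdet, map_one]; rfl
    simp only [hB, _root_.smul_apply, map_smul, smul_smul]
    rw [mul_inv_cancel₀ hc0, one_smul]
    exact this
  · have : (Matrix.toEuclideanCLM (𝕜 := ℝ) S * Matrix.toEuclideanCLM (𝕜 := ℝ) S⁻¹) u = u := by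
      rw [← map_mul, Matrix.mul_nonsing_inv _ hdet, map_one]; rfl
    simp only [hB, _root_.smul_apply, map_smul, smul_smul]
    rw [inv_mul_cancel₀ hc0, one_smul]
    exact this
  · rw [_root_.smul_apply, inner_smul_left, mul_assoc]
    exact mul_le_mul_of_nonneg_left (hcoer u) hc.c_pos.le
  · rw [norm_meanGrad_center hR hc.c_pos hT hω, Real.rpow_neg hn0'.le]
    have hp : 0 < (n : ℝ) ^ (1 / 3 : ℝ) := by positivity
    rw [inv_eq_one_div ((n : ℝ) ^ (1 / 3 : ℝ)), div_div, le_div_iff₀ (by positivity)]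
    linarith

lemma exists_measurableSet (hc : RegularContrast P H θ₀ s K S c ρ) :
    ∃ T, MeasurableSet T ∧ (∀ x ∈ T, RegularPoint H θ₀ s K c ρ x) ∧ ∀ᵐ x ∂P, x ∈ T := by
  obtain ⟨T, h1, h2, h3⟩ := hc.regular.exists_measurable_mem
  exact ⟨T, h2, h3, h1⟩

/-- Almost surely, for all large `n`, there is exactly one min-max point; it lies in the open ball,
and both scores vanish there. -/
lemma ae_eventually_exists_unique (hc : RegularContrast P H θ₀ s K S c ρ)
    (hX : ∀ k, Measurable (X k)) (hindep : iIndepFun X Pr) (hlaw : ∀ k, Pr.map (X k) = P) :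
    ∀ᵐ ω ∂Pr, ∀ᶠ n : ℕ in atTop, ∃ ϑ a,
      (ϑ, a) ∈ Metric.ball (θ₀, θ₀) ((n : ℝ) ^ (-(1 / 3) : ℝ)) ∧
      IsMinMaxOn (fun θ α => empMean (fun i => X i ω) n (H (θ, α)))
        (Metric.closedBall θ₀ ((n : ℝ) ^ (-(1 / 3) : ℝ))) ϑ a ∧
      (∀ i, empMean (fun i => X i ω) n (fun x => partialD i (fun z => H z x) (ϑ, a)) = 0) ∧
      ∀ ϑ' a', IsMinMaxOn (fun θ α => empMean (fun i => X i ω) n (H (θ, α)))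
        (Metric.closedBall θ₀ ((n : ℝ) ^ (-(1 / 3) : ℝ))) ϑ' a' → ϑ' = ϑ ∧ a' = a := by
  obtain ⟨T, -, hT, hTae⟩ := hc.exists_measurableSet
  have hR := half_pos hc.ρ_pos
  obtain ⟨κ, b, h⟩ := hc.ae_eventually_nearSaddle hX hindep hlaw hR (half_lt_self hc.ρ_pos) hT hTae
  filter_upwards [h] with ω hω
  filter_upwards [hω.2] with n hn
  obtain ⟨z, hz, hG, -⟩ := hn.2.exists_tendsto_iterate
  have hz' := Metric.ball_subset_closedBall hz
  refine ⟨z.1, z.2, hz, hn.2.isMinMaxOn hz' hG, fun i => ?_, fun ϑ' a' h' =>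
    hn.2.eq_of_isMinMaxOn hz' hG h'⟩
  rw [← coord_meanGrad hR hω.1 n (Metric.closedBall_subset_closedBall hn.1 hz'), hG, map_zero]

/-- The min-max points can be chosen measurably. -/
lemma exists_measurable_isMinMaxOn (hc : RegularContrast P H θ₀ s K S c ρ)
    (hX : ∀ k, Measurable (X k)) (hindep : iIndepFun X Pr) (hlaw : ∀ k, Pr.map (X k) = P) :
    ∃ Z : ℕ → Ω → EuclideanSpace ℝ (Fin d) × EuclideanSpace ℝ (Fin d),
      (∀ n, Measurable (Z n)) ∧ ∀ᵐ ω ∂Pr, ∀ᶠ n : ℕ in atTop,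
        Z n ω ∈ Metric.ball (θ₀, θ₀) ((n : ℝ) ^ (-(1 / 3) : ℝ)) ∧
        IsMinMaxOn (fun θ α => empMean (fun i => X i ω) n (H (θ, α)))
          (Metric.closedBall θ₀ ((n : ℝ) ^ (-(1 / 3) : ℝ))) (Z n ω).1 (Z n ω).2 := by
  obtain ⟨T, hTm, hT, hTae⟩ := hc.exists_measurableSet
  have hR := half_pos hc.ρ_pos
  have hRρ := half_lt_self hc.ρ_pos
  obtain ⟨κ, b, h⟩ := hc.ae_eventually_nearSaddle hX hindep hlaw hR hRρ hT hTae
  -- The limit of the Newton iterates started at the centre: measurable because every iterate is,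
  -- and equal to the zero of the gradient on the good event. Elsewhere its value is irrelevant.
  refine ⟨fun n ω => limUnder atTop fun k =>
    (newtonStep (meanGrad H (θ₀, θ₀) (ρ / 2) T (fun i => X i ω) n)
      (c⁻¹ • Matrix.toEuclideanCLM (𝕜 := ℝ) S⁻¹))^[k] (θ₀, θ₀), fun n => ?_, ?_⟩
  · refine (StronglyMeasurable.limUnder fun k => ?_).measurable
    exact (measurable_iterate_newtonStep hR hRρ hTm hc.measurable (fun x hx => (hT x hx).diff)
      (fun x hx => (hT x hx).diff_partialD) hX n _ k).stronglyMeasurable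
  · filter_upwards [h] with ω hω
    filter_upwards [hω.2] with n hn
    obtain ⟨z, hz, hG, hlim⟩ := hn.2.exists_tendsto_iterate
    rw [hlim.limUnder_eq]
    exact ⟨hz, hn.2.isMinMaxOn (Metric.ball_subset_closedBall hz) hG⟩

lemma integral_inner_sq (hc : RegularContrast P H θ₀ s K S c ρ) (u : EuclideanSpace ℝ (Fin d)) :
    ∫ x, (inner ℝ u (s x)) ^ 2 ∂P = inner ℝ u (Matrix.toEuclideanCLM (𝕜 := ℝ) S u) := by
  have hL2 : ∀ i, MemLp (fun x => s x i) 2 P := fun i =>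
    (EuclideanSpace.proj (𝕜 := ℝ) i).comp_memLp' hc.memLp_score
  have hint : ∀ i j, Integrable (fun x => u i * u j * (s x i * s x j)) P := fun i j =>
    ((hL2 i).integrable_mul (hL2 j)).const_mul _
  have hsq : ∀ x, (inner ℝ u (s x)) ^ 2 = ∑ i, ∑ j, u i * u j * (s x i * s x j) := fun x => by
    rw [sq, PiLp.inner_apply, Finset.sum_mul_sum]
    refine Finset.sum_congr rfl fun i _ => Finset.sum_congr rfl fun j _ => ?_
    simp; ring
  simp_rw [hsq]
  rw [integral_finsetSum _ fun i _ => integrable_finsetSum _ fun j _ => hint i j,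
    Matrix.inner_toEuclideanCLM]
  simp only [dotProduct, Matrix.mulVec]
  refine Finset.sum_congr rfl fun i _ => ?_
  rw [integral_finsetSum _ fun j _ => hint i j, Finset.mul_sum]
  refine Finset.sum_congr rfl fun j _ => ?_
  rw [integral_const_mul, hc.integral_score_mul]
  simp; ring

lemma inner_inv_comm (hc : RegularContrast P H θ₀ s K S c ρ) (t u : EuclideanSpace ℝ (Fin d)) :
    inner ℝ t (Matrix.toEuclideanCLM (𝕜 := ℝ) S⁻¹ u) =
      inner ℝ (Matrix.toEuclideanCLM (𝕜 := ℝ) S⁻¹ t) u := by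
  have hsymm : (S⁻¹).transpose = S⁻¹ := by simpa using hc.posDef.inv.isHermitian.eq
  rw [real_inner_comm u, Matrix.inner_toEuclideanCLM, Matrix.inner_toEuclideanCLM,
    Matrix.dotProduct_mulVec, ← Matrix.mulVec_transpose, hsymm, dotProduct_comm]

lemma inv_apply_apply (hc : RegularContrast P H θ₀ s K S c ρ) (u : EuclideanSpace ℝ (Fin d)) :
    Matrix.toEuclideanCLM (𝕜 := ℝ) S (Matrix.toEuclideanCLM (𝕜 := ℝ) S⁻¹ u) = u := by
  have hdet : IsUnit S.det := S.isUnit_iff_isUnit_det.1 hc.posDef.isUnit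
  have : (Matrix.toEuclideanCLM (𝕜 := ℝ) S * Matrix.toEuclideanCLM (𝕜 := ℝ) S⁻¹) u = u := by
    rw [← map_mul, Matrix.mul_nonsing_inv _ hdet, map_one]; rfl
  exact this

/-- The min-max points are asymptotically normal. -/
lemma tendstoInDistribution_of_isMinMaxOn (hc : RegularContrast P H θ₀ s K S c ρ)
    (hX : ∀ k, Measurable (X k)) (hindep : iIndepFun X Pr) (hlaw : ∀ k, Pr.map (X k) = P)
    {ϑ a : ℕ → Ω → EuclideanSpace ℝ (Fin d)} (hϑ : ∀ n, AEMeasurable (ϑ n) Pr)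
    (ha : ∀ n, AEMeasurable (a n) Pr)
    (hmm : ∀ᵐ ω ∂Pr, ∀ᶠ n : ℕ in atTop,
      IsMinMaxOn (fun θ α => empMean (fun i => X i ω) n (H (θ, α)))
        (Metric.closedBall θ₀ ((n : ℝ) ^ (-(1 / 3) : ℝ))) (ϑ n ω) (a n ω)) :
    TendstoInDistribution (fun (n : ℕ) ω => √(n : ℝ) • (ϑ n ω - θ₀)) atTop id (fun _ => Pr)
        (multivariateGaussian 0 S⁻¹) ∧
      TendstoInDistribution (fun (n : ℕ) ω => √(n : ℝ) • (a n ω - θ₀)) atTop id (fun _ => Pr)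
        (multivariateGaussian 0 S⁻¹) := by
  have hPprob : IsProbabilityMeasure P := by
    rw [← hlaw 0]; exact Measure.isProbabilityMeasure_map (hX 0).aemeasurable
  set Q := Matrix.toEuclideanCLM (𝕜 := ℝ) S⁻¹ with hQ
  have hsm := hc.measurable_score
  have hmp : MeasurePreserving (X 0) Pr P := ⟨hX 0, hlaw 0⟩
  have hs2 : MemLp (fun ω => s (X 0 ω)) 2 Pr := hc.memLp_score.comp_measurePreserving hmp
  have hs_indep : iIndepFun (fun k ω => s (X k ω)) Pr := hindep.comp (fun _ => s) fun _ => hsm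
  have hs_ident := identDistrib_comp hX hlaw hsm.aemeasurable
  have hs_mean : ∫ ω, s (X 0 ω) ∂Pr = 0 := by
    rw [integral_comp_law hX hlaw hsm.aestronglyMeasurable, hc.integral_score]
  have hclt : TendstoInDistribution
      (fun (n : ℕ) ω => (√(n : ℝ))⁻¹ • ∑ k ∈ Finset.range n, Q (s (X k ω))) atTop id
      (fun _ => Pr) (multivariateGaussian 0 S⁻¹) := by
    refine tendstoInDistribution_multivariateGaussian (Y := fun k ω => Q (s (X k ω)))
      (hs_indep.comp (fun _ => Q) fun _ => Q.measurable)
      (fun k => (hs_ident k).comp Q.measurable) (Q.comp_memLp' hs2) ?_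
      hc.posDef.inv.posSemidef fun t => ?_
    · rw [Q.integral_comp_comm (hs2.integrable (by norm_num)), hs_mean, map_zero]
    -- The covariance of `S⁻¹ s` is `S⁻¹ S S⁻¹ = S⁻¹`, where symmetry moves one inverse onto `t`.
    · simp only [hQ, hc.inner_inv_comm]
      rw [integral_comp_law hX hlaw (f := fun x =>
          (inner ℝ (Matrix.toEuclideanCLM (𝕜 := ℝ) S⁻¹ t) (s x)) ^ 2) (by fun_prop),
        hc.integral_inner_sq, hc.inv_apply_apply, ← hc.inner_inv_comm,
        Matrix.inner_toEuclideanCLM]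
  obtain ⟨T, -, hT, hTae⟩ := hc.exists_measurableSet
  have hR := half_pos hc.ρ_pos
  obtain ⟨κ, b, hns⟩ :=
    hc.ae_eventually_nearSaddle hX hindep hlaw hR (half_lt_self hc.ρ_pos) hT hTae
  -- The error factor of `norm_sub_add_le`, with `c` coming from the norm of the gradient at the
  -- centre, which is `c` times the norm of the mean score.
  set ε : ℕ → Ω → ℝ := fun n ω => 2 * b ^ 2 * c * hessErr H θ₀ K S c (fun i => X i ω) n with hε
  have hεm : ∀ n, AEMeasurable (ε n) Pr := fun n => (hc.aemeasurable_hessErr hX hlaw n).const_mul _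
  have hW : TendstoInMeasure Pr (fun n ω =>
      ε n ω * ‖(√(n : ℝ))⁻¹ • ∑ k ∈ Finset.range n, s (X k ω)‖) atTop 0 := by
    refine tendstoInMeasure_mul_norm
      (fun n => (integral_norm_sq_smul_sum_le hs_indep hs_ident hs2 hs_mean n).1)
      (fun n => (integral_norm_sq_smul_sum_le hs_indep hs_ident hs2 hs_mean n).2) hεm ?_
    filter_upwards [hc.ae_tendsto_hessErr hX hindep hlaw] with ω hω
    simpa [hε] using hω.const_mul (2 * b ^ 2 * c)
  have hWm : ∀ n : ℕ, AEMeasurable (fun ω =>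
      ε n ω * ‖(√(n : ℝ))⁻¹ • ∑ k ∈ Finset.range n, s (X k ω)‖) Pr := fun n => by
    have : Measurable fun ω => ∑ k ∈ Finset.range n, s (X k ω) :=
      Finset.measurable_fun_sum _ fun k _ => hsm.comp (hX k)
    exact (hεm n).mul ((measurable_const_smul (√(n : ℝ))⁻¹).comp this).norm.aemeasurable
  have hle : ∀ᵐ ω ∂Pr, ∀ᶠ n : ℕ in atTop,
      ‖√(n : ℝ) • (ϑ n ω - θ₀) - (√(n : ℝ))⁻¹ • ∑ k ∈ Finset.range n, Q (s (X k ω))‖ ≤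
          ε n ω * ‖(√(n : ℝ))⁻¹ • ∑ k ∈ Finset.range n, s (X k ω)‖ ∧
      ‖√(n : ℝ) • (a n ω - θ₀) - (√(n : ℝ))⁻¹ • ∑ k ∈ Finset.range n, Q (s (X k ω))‖ ≤
          ε n ω * ‖(√(n : ℝ))⁻¹ • ∑ k ∈ Finset.range n, s (X k ω)‖ := by
    filter_upwards [hns, hmm] with ω hω hω'
    filter_upwards [hω.2, hω'] with n hn hn'
    obtain ⟨z, hz, hG, -⟩ := hn.2.exists_tendsto_iterate
    have hz' := Metric.ball_subset_closedBall hz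
    -- By uniqueness the given min-max point is the zero of the gradient, so the one-step expansion
    -- applies to it.
    obtain ⟨h1, h2⟩ := hn.2.eq_of_isMinMaxOn hz' hG hn'
    have h3 := hn.2.norm_sub_add_le hz' hG
    rw [norm_meanGrad_center hR hc.c_pos hT hω.1, meanGrad_center hR hT hω.1] at h3
    set m := (n : ℝ)⁻¹ • ∑ k ∈ Finset.range n, s (X k ω) with hm
    -- The factor `c` cancels, and so do the signs: the gradient `(-c m, c m)` and the linear part
    -- `(A, -A)` give the same leading term `Q m` in both components.
    have hcm : (c⁻¹ • Matrix.toEuclideanCLM (𝕜 := ℝ) S⁻¹) (c • m) = Q m := by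
      rw [_root_.smul_apply, map_smul, smul_smul, inv_mul_cancel₀ hc.c_pos.ne', one_smul]
    simp only [map_neg, hcm] at h3
    have hsqrt : √(n : ℝ) * (n : ℝ)⁻¹ = (√(n : ℝ))⁻¹ := by
      rw [← div_eq_mul_inv, Real.sqrt_div_self', one_div]
    have h4 : (√(n : ℝ))⁻¹ • ∑ k ∈ Finset.range n, Q (s (X k ω)) = √(n : ℝ) • Q m := by
      rw [hm, map_smul, map_sum, smul_smul, hsqrt]
    have h5 : (√(n : ℝ))⁻¹ • ∑ k ∈ Finset.range n, s (X k ω) = √(n : ℝ) • m := by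
      rw [hm, smul_smul, hsqrt]
    have key : ∀ y : EuclideanSpace ℝ (Fin d),
        ‖y - θ₀ - Q m‖ ≤ 2 * b ^ 2 * hessErr H θ₀ K S c (fun i => X i ω) n * (c * ‖m‖) →
        ‖√(n : ℝ) • (y - θ₀) - √(n : ℝ) • Q m‖ ≤ ε n ω * ‖√(n : ℝ) • m‖ := by
      intro y hy
      rw [← smul_sub, norm_smul, norm_smul, Real.norm_of_nonneg (Real.sqrt_nonneg _)]
      refine (mul_le_mul_of_nonneg_left hy (Real.sqrt_nonneg _)).trans_eq ?_
      simp only [hε]; ring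
    rw [h4, h5, h1, h2]
    refine ⟨key _ ((norm_fst_le _).trans h3 |> fun h => ?_),
      key _ ((norm_snd_le _).trans h3 |> fun h => ?_)⟩
    · simpa [sub_eq_add_neg] using h
    · simpa [sub_eq_add_neg] using h
  have main : ∀ y : ℕ → Ω → EuclideanSpace ℝ (Fin d), (∀ n, AEMeasurable (y n) Pr) →
      (∀ᵐ ω ∂Pr, ∀ᶠ n : ℕ in atTop,
        ‖√(n : ℝ) • (y n ω - θ₀) - (√(n : ℝ))⁻¹ • ∑ k ∈ Finset.range n, Q (s (X k ω))‖ ≤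
          ε n ω * ‖(√(n : ℝ))⁻¹ • ∑ k ∈ Finset.range n, s (X k ω)‖) →
      TendstoInDistribution (fun (n : ℕ) ω => √(n : ℝ) • (y n ω - θ₀)) atTop id (fun _ => Pr)
        (multivariateGaussian 0 S⁻¹) := by
    intro y hy hyle
    have hym : ∀ n : ℕ, AEMeasurable (fun ω => √(n : ℝ) • (y n ω - θ₀)) Pr := fun n =>
      (measurable_const_smul (√(n : ℝ))).comp_aemeasurable ((hy n).sub_const θ₀)
    refine tendstoInDistribution_of_tendstoInMeasure_sub _ _ hclt ?_ hym
    exact tendstoInMeasure_of_eventually_norm_le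
      (fun n => ((hym n).sub (hclt.forall_aemeasurable n)).aestronglyMeasurable) hWm hW hyle
  exact ⟨main ϑ hϑ (hle.mono fun ω h => h.mono fun n hn => hn.1),
    main a ha (hle.mono fun ω h => h.mono fun n hn => hn.2)⟩

end RegularContrast

end Random

end PhiDivergence
end

noncomputable section

namespace PhiDivergence

/-! ### The divergence function -/

section Phi

variable {φ : ℝ → ℝ≥0∞}

lemma isOpen_intDom (φ : ℝ → ℝ≥0∞) : IsOpen (intDom φ) := isOpen_interior

lemma contDiffOn_dPhi (hφs : ContDiffOn ℝ 4 (realPhi φ) (intDom φ)) :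
    ContDiffOn ℝ 3 (dPhi φ) (intDom φ) :=
  ((contDiffOn_succ_iff_deriv_of_isOpen (n := 3) (isOpen_intDom φ)).1
    (by norm_num; exact hφs)).2.2

lemma hasDerivAt_realPhi (hφ : IsDivergenceFunction φ) {t : ℝ} (ht : t ∈ intDom φ) :
    HasDerivAt (realPhi φ) (dPhi φ t) t :=
  ((hφ.differentiable t ht).differentiableAt ((isOpen_intDom φ).mem_nhds ht)).hasDerivAt

lemma hasDerivAt_dPhi (hφs : ContDiffOn ℝ 4 (realPhi φ) (intDom φ)) {t : ℝ}
    (ht : t ∈ intDom φ) : HasDerivAt (dPhi φ) (deriv (dPhi φ) t) t :=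
  (((contDiffOn_dPhi hφs).differentiableOn (by norm_num) t ht).differentiableAt
    ((isOpen_intDom φ).mem_nhds ht)).hasDerivAt

/-- `φ` is nonnegative and vanishes at `1`, so `1` is a global minimum. Replacing the value `∞` by
`0` does not spoil this. -/
lemma dPhi_one (hφ : IsDivergenceFunction φ) : dPhi φ 1 = 0 := by
  refine IsLocalMin.deriv_eq_zero (Eventually.of_forall fun t => ?_)
  simp only [realPhi, hφ.map_one, ENNReal.toReal_zero]
  exact ENNReal.toReal_nonneg

lemma measurable_realPhi (hφ : IsDivergenceFunction φ) : Measurable (realPhi φ) :=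
  hφ.closed.measurable.ennreal_toReal

lemma measurable_dPhi (φ : ℝ → ℝ≥0∞) : Measurable (dPhi φ) := measurable_deriv _

/-- A path along which `φ'` stays bounded does not leave the interior of the domain of `φ`. -/
lemma mem_intDom_of_bounded (hφ : IsDivergenceFunction φ) {t : ℝ → ℝ}
    (ht : ContinuousOn t (Icc 0 1)) (h0 : t 0 ∈ intDom φ) {C : ℝ}
    (hC : ∀ s ∈ Icc (0 : ℝ) 1, (∀ s' ∈ Icc 0 s, t s' ∈ intDom φ) → |dPhi φ (t s)| ≤ C) :
    ∀ s ∈ Icc (0 : ℝ) 1, t s ∈ intDom φ := by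
  by_contra! hcon
  -- `A` is the compact set of times outside the domain; its least element `σ` is the first exit
  -- time, before which the bound `C` is available.
  set A := Icc (0 : ℝ) 1 ∩ t ⁻¹' (intDom φ)ᶜ with hA
  have hAne : A.Nonempty := hcon
  have hAcl : IsClosed A :=
    ht.preimage_isClosed_of_isClosed isClosed_Icc (isOpen_intDom φ).isClosed_compl
  have hAc : IsCompact A := isCompact_Icc.of_isClosed_subset hAcl inter_subset_left
  obtain ⟨σ, ⟨hσ, hσ'⟩, hmin⟩ := hAc.exists_isLeast hAne
  have hbefore : ∀ s ∈ Ico (0 : ℝ) σ, t s ∈ intDom φ := by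
    intro s hs
    by_contra h
    exact absurd (hmin ⟨⟨hs.1, hs.2.le.trans hσ.2⟩, h⟩) (not_le.2 hs.2)
  have hσ0 : 0 < σ := by
    rcases hσ.1.eq_or_lt with h | h
    · exact absurd (h ▸ h0) hσ'
    · exact h
  have hlim : Tendsto t (𝓝[<] σ) (𝓝 (t σ)) := by
    refine (ht σ hσ).mono_left (nhdsWithin_le_of_mem ?_)
    filter_upwards [Ioo_mem_nhdsLT hσ0] with s hs using ⟨hs.1.le, hs.2.le.trans hσ.2⟩
  have hev : ∀ᶠ s in 𝓝[<] σ, t s ∈ intDom φ ∧ |dPhi φ (t s)| ≤ C := by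
    filter_upwards [Ioo_mem_nhdsLT hσ0] with s hs
    refine ⟨hbefore s ⟨hs.1.le, hs.2⟩, hC s ⟨hs.1.le, hs.2.le.trans hσ.2⟩ fun s' hs' => ?_⟩
    exact hbefore s' ⟨hs'.1, hs'.2.trans_lt hs.2⟩
  have hconn : OrdConnected (intDom φ) := hφ.strictConvex.1.ordConnected
  -- The exit point lies outside an interval, hence on one side of it. As a limit of points of the
  -- interval it is an endpoint, where steepness of `φ` contradicts the bound on `φ'`.
  have hside : (∀ u ∈ intDom φ, u < t σ) ∨ ∀ u ∈ intDom φ, t σ < u := by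
    by_contra! h
    obtain ⟨⟨u, hu, hu'⟩, v, hv, hv'⟩ := h
    exact hσ' (hconn.out hv hu ⟨hv', hu'⟩)
  rcases hside with h | h
  · have hlub : IsLUB (intDom φ) (t σ) :=
      ⟨fun u hu => (h u hu).le, fun b hb => le_of_tendsto hlim (hev.mono fun s hs => hb hs.1)⟩
    have h1 : Tendsto t (𝓝[<] σ) (𝓝[<] (t σ)) :=
      tendsto_nhdsWithin_iff.2 ⟨hlim, hev.mono fun s hs => h _ hs.1⟩
    obtain ⟨s, hs1, hs2⟩ := ((((hφ.steep_right _ hlub).comp h1).eventually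
      (eventually_gt_atTop C)).and hev).exists
    exact absurd ((le_abs_self _).trans hs2.2) (not_le.2 hs1)
  · have hglb : IsGLB (intDom φ) (t σ) :=
      ⟨fun u hu => (h u hu).le, fun b hb => ge_of_tendsto hlim (hev.mono fun s hs => hb hs.1)⟩
    have h1 : Tendsto t (𝓝[<] σ) (𝓝[>] (t σ)) :=
      tendsto_nhdsWithin_iff.2 ⟨hlim, hev.mono fun s hs => h _ hs.1⟩
    obtain ⟨s, hs1, hs2⟩ := ((((hφ.steep_left _ hglb).comp h1).eventually
      (eventually_lt_atBot (-C))).and hev).exists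
    have := (abs_le.1 hs2.2).1
    simp only [Function.comp_apply] at hs1
    linarith

end Phi

/-! ### Derivatives of the contrast at one observation -/

section Pointwise

variable {d : ℕ} {φ : ℝ → ℝ≥0∞}

/-- `(θ, α) ↦ φ'(q θ / q α) * q θ`. -/
def weightedDeriv (φ : ℝ → ℝ≥0∞) (q : EuclideanSpace ℝ (Fin d) → ℝ)
    (z : EuclideanSpace ℝ (Fin d) × EuclideanSpace ℝ (Fin d)) : ℝ :=
  dPhi φ (q z.1 / q z.2) * q z.1

/-- `(θ, α) ↦ t * φ' t - φ t` at `t = q θ / q α`. -/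
def conjugateTerm (φ : ℝ → ℝ≥0∞) (q : EuclideanSpace ℝ (Fin d) → ℝ)
    (z : EuclideanSpace ℝ (Fin d) × EuclideanSpace ℝ (Fin d)) : ℝ :=
  q z.1 / q z.2 * dPhi φ (q z.1 / q z.2) - realPhi φ (q z.1 / q z.2)

variable {q : EuclideanSpace ℝ (Fin d) → ℝ} {θ₀ : EuclideanSpace ℝ (Fin d)} {ρ : ℝ}

/-- The density `q`, as a function of the parameter, is smooth and positive on a ball. -/
structure SmoothPositive (q : EuclideanSpace ℝ (Fin d) → ℝ) (θ₀ : EuclideanSpace ℝ (Fin d))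
    (ρ : ℝ) : Prop where
  contDiffOn : ContDiffOn ℝ 3 q (Metric.ball θ₀ ρ)
  pos : ∀ θ ∈ Metric.ball θ₀ ρ, 0 < q θ

namespace SmoothPositive

lemma contDiffOn_fst (hq : SmoothPositive q θ₀ ρ) :
    ContDiffOn ℝ 3 (fun z : EuclideanSpace ℝ (Fin d) × EuclideanSpace ℝ (Fin d) => q z.1)
      (Metric.ball (θ₀, θ₀) ρ) :=
  hq.contDiffOn.comp contDiff_fst.contDiffOn fun z hz => by
    rw [← ball_prod_same] at hz; exact hz.1

lemma contDiffOn_snd (hq : SmoothPositive q θ₀ ρ) :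
    ContDiffOn ℝ 3 (fun z : EuclideanSpace ℝ (Fin d) × EuclideanSpace ℝ (Fin d) => q z.2)
      (Metric.ball (θ₀, θ₀) ρ) :=
  hq.contDiffOn.comp contDiff_snd.contDiffOn fun z hz => by
    rw [← ball_prod_same] at hz; exact hz.2

lemma pos_snd (hq : SmoothPositive q θ₀ ρ)
    {z : EuclideanSpace ℝ (Fin d) × EuclideanSpace ℝ (Fin d)}
    (hz : z ∈ Metric.ball (θ₀, θ₀) ρ) : 0 < q z.2 := by
  rw [← ball_prod_same] at hz; exact hq.pos _ hz.2

lemma contDiffOn_ratio (hq : SmoothPositive q θ₀ ρ) :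
    ContDiffOn ℝ 3 (fun z : EuclideanSpace ℝ (Fin d) × EuclideanSpace ℝ (Fin d) => q z.1 / q z.2)
      (Metric.ball (θ₀, θ₀) ρ) :=
  hq.contDiffOn_fst.div hq.contDiffOn_snd fun _ hz => (hq.pos_snd hz).ne'

variable {z : EuclideanSpace ℝ (Fin d) × EuclideanSpace ℝ (Fin d)}

lemma hasFDerivAt_fst (hq : SmoothPositive q θ₀ ρ) (hz : z ∈ Metric.ball (θ₀, θ₀) ρ) :
    HasFDerivAt (fun z : EuclideanSpace ℝ (Fin d) × EuclideanSpace ℝ (Fin d) => q z.1)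
      (∑ i, partialD i (fun z => q z.1) z • coord i) z :=
  hasFDerivAt_sum_partialD ((hq.contDiffOn_fst.differentiableOn (by norm_num)).differentiableAt
    (Metric.isOpen_ball.mem_nhds hz))

lemma hasFDerivAt_snd (hq : SmoothPositive q θ₀ ρ) (hz : z ∈ Metric.ball (θ₀, θ₀) ρ) :
    HasFDerivAt (fun z : EuclideanSpace ℝ (Fin d) × EuclideanSpace ℝ (Fin d) => q z.2)
      (∑ i, partialD i (fun z => q z.2) z • coord i) z :=
  hasFDerivAt_sum_partialD ((hq.contDiffOn_snd.differentiableOn (by norm_num)).differentiableAt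
    (Metric.isOpen_ball.mem_nhds hz))

lemma hasFDerivAt_ratio (hq : SmoothPositive q θ₀ ρ) (hz : z ∈ Metric.ball (θ₀, θ₀) ρ) :
    HasFDerivAt (fun z : EuclideanSpace ℝ (Fin d) × EuclideanSpace ℝ (Fin d) => q z.1 / q z.2)
      (∑ i, partialD i (fun z => q z.1 / q z.2) z • coord i) z :=
  hasFDerivAt_sum_partialD ((hq.contDiffOn_ratio.differentiableOn (by norm_num)).differentiableAt
    (Metric.isOpen_ball.mem_nhds hz))

lemma hasFDerivAt_weightedDeriv (hφs : ContDiffOn ℝ 4 (realPhi φ) (intDom φ))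
    (hq : SmoothPositive q θ₀ ρ) (hz : z ∈ Metric.ball (θ₀, θ₀) ρ)
    (hr : q z.1 / q z.2 ∈ intDom φ) :
    HasFDerivAt (weightedDeriv φ q)
      (dPhi φ (q z.1 / q z.2) • (∑ i, partialD i (fun z => q z.1) z • coord i) +
        q z.1 • deriv (dPhi φ) (q z.1 / q z.2) •
          ∑ i, partialD i (fun z => q z.1 / q z.2) z • coord i) z :=
  ((hasDerivAt_dPhi hφs hr).comp_hasFDerivAt z (hq.hasFDerivAt_ratio hz)).mul
    (hq.hasFDerivAt_fst hz)

lemma hasFDerivAt_conjugateTerm (hφ : IsDivergenceFunction φ)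
    (hφs : ContDiffOn ℝ 4 (realPhi φ) (intDom φ)) (hq : SmoothPositive q θ₀ ρ)
    (hz : z ∈ Metric.ball (θ₀, θ₀) ρ) (hr : q z.1 / q z.2 ∈ intDom φ) :
    HasFDerivAt (conjugateTerm φ q)
      ((q z.1 / q z.2 * deriv (dPhi φ) (q z.1 / q z.2)) •
          ∑ i, partialD i (fun z => q z.1 / q z.2) z • coord i) z := by
  have h1 : HasDerivAt (fun t => t * dPhi φ t - realPhi φ t)
      (q z.1 / q z.2 * deriv (dPhi φ) (q z.1 / q z.2)) (q z.1 / q z.2) := by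
    refine (((hasDerivAt_id _).mul (hasDerivAt_dPhi hφs hr)).sub
      (hasDerivAt_realPhi hφ hr)).congr_deriv ?_
    simp
  exact h1.comp_hasFDerivAt z (hq.hasFDerivAt_ratio hz)

lemma partialD_conjugateTerm (hφ : IsDivergenceFunction φ)
    (hφs : ContDiffOn ℝ 4 (realPhi φ) (intDom φ)) (hq : SmoothPositive q θ₀ ρ)
    (hz : z ∈ Metric.ball (θ₀, θ₀) ρ) (hr : q z.1 / q z.2 ∈ intDom φ) (i : Fin d ⊕ Fin d) :
    partialD i (conjugateTerm φ q) z = q z.1 / q z.2 * deriv (dPhi φ) (q z.1 / q z.2) *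
      partialD i (fun z => q z.1 / q z.2) z := by
  rw [partialD_eq (hq.hasFDerivAt_conjugateTerm hφ hφs hz hr), _root_.smul_apply,
    ← partialD_eq (hq.hasFDerivAt_ratio hz), smul_eq_mul]

/-- Both terms of the contrast carry the factor `φ''` times the derivative of the ratio, with
weights `q θ` and `q θ / q α`; this relates their derivatives without any integration. -/
lemma partialD_weightedDeriv (hφ : IsDivergenceFunction φ)
    (hφs : ContDiffOn ℝ 4 (realPhi φ) (intDom φ)) (hq : SmoothPositive q θ₀ ρ)
    (hz : z ∈ Metric.ball (θ₀, θ₀) ρ) (hr : q z.1 / q z.2 ∈ intDom φ) (i : Fin d ⊕ Fin d) :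
    partialD i (weightedDeriv φ q) z = q z.2 * partialD i (conjugateTerm φ q) z +
      dPhi φ (q z.1 / q z.2) * partialD i (fun z => q z.1) z := by
  rw [partialD_conjugateTerm hφ hφs hq hz hr,
    partialD_eq (hq.hasFDerivAt_weightedDeriv hφs hz hr), _root_.add_apply,
    _root_.smul_apply, _root_.smul_apply, _root_.smul_apply,
    ← partialD_eq (hq.hasFDerivAt_ratio hz), ← partialD_eq (hq.hasFDerivAt_fst hz)]
  have := (hq.pos_snd hz).ne'
  simp only [smul_eq_mul]
  field_simp
  ring

lemma partialD_ratio_diag (hq : SmoothPositive q θ₀ ρ) {θ : EuclideanSpace ℝ (Fin d)}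
    (hθ : θ ∈ Metric.ball θ₀ ρ) (i : Fin d ⊕ Fin d) :
    partialD i (fun z => q z.1 / q z.2) (θ, θ) =
      (partialD i (fun z => q z.1) (θ, θ) - partialD i (fun z => q z.2) (θ, θ)) / q θ := by
  have hz : (θ, θ) ∈ Metric.ball (θ₀, θ₀) ρ := by rw [← ball_prod_same]; exact ⟨hθ, hθ⟩
  have hq0 : q θ ≠ 0 := (hq.pos θ hθ).ne'
  have h1 := (hq.hasFDerivAt_fst hz).hasLineDerivAt (dir i)
  have h2 := (hq.hasFDerivAt_snd hz).hasLineDerivAt (dir i)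
  rw [← partialD_eq (hq.hasFDerivAt_fst hz)] at h1
  rw [← partialD_eq (hq.hasFDerivAt_snd hz)] at h2
  have h3 := (HasDerivAt.fun_div h1 h2 (by simpa using hq0)).deriv
  rw [partialD, lineDeriv, h3]
  simp only [zero_smul, add_zero]
  field_simp

lemma ratio_diag (hq : SmoothPositive q θ₀ ρ) {θ : EuclideanSpace ℝ (Fin d)}
    (hθ : θ ∈ Metric.ball θ₀ ρ) : q θ / q θ = 1 := div_self (hq.pos θ hθ).ne'

lemma partialD_conjugateTerm_diag (hφ : IsDivergenceFunction φ)
    (hφs : ContDiffOn ℝ 4 (realPhi φ) (intDom φ)) (hq : SmoothPositive q θ₀ ρ)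
    {θ : EuclideanSpace ℝ (Fin d)} (hθ : θ ∈ Metric.ball θ₀ ρ) (i : Fin d ⊕ Fin d) :
    partialD i (conjugateTerm φ q) (θ, θ) = deriv (dPhi φ) 1 *
      ((partialD i (fun z => q z.1) (θ, θ) - partialD i (fun z => q z.2) (θ, θ)) / q θ) := by
  have hz : (θ, θ) ∈ Metric.ball (θ₀, θ₀) ρ := by rw [← ball_prod_same]; exact ⟨hθ, hθ⟩
  rw [partialD_conjugateTerm hφ hφs hq hz (by simpa [hq.ratio_diag hθ] using hφ.one_mem),
    hq.partialD_ratio_diag hθ, hq.ratio_diag hθ, one_mul]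

lemma partialD_weightedDeriv_diag (hφ : IsDivergenceFunction φ)
    (hφs : ContDiffOn ℝ 4 (realPhi φ) (intDom φ)) (hq : SmoothPositive q θ₀ ρ)
    {θ : EuclideanSpace ℝ (Fin d)} (hθ : θ ∈ Metric.ball θ₀ ρ) (i : Fin d ⊕ Fin d) :
    partialD i (weightedDeriv φ q) (θ, θ) = deriv (dPhi φ) 1 *
      (partialD i (fun z => q z.1) (θ, θ) - partialD i (fun z => q z.2) (θ, θ)) := by
  have hz : (θ, θ) ∈ Metric.ball (θ₀, θ₀) ρ := by rw [← ball_prod_same]; exact ⟨hθ, hθ⟩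
  rw [partialD_weightedDeriv hφ hφs hq hz (by simpa [hq.ratio_diag hθ] using hφ.one_mem),
    hq.partialD_conjugateTerm_diag hφ hφs hθ, hq.ratio_diag hθ, dPhi_one hφ]
  have := (hq.pos θ hθ).ne'
  field_simp
  ring

lemma contDiffOn_weightedDeriv (hφs : ContDiffOn ℝ 4 (realPhi φ) (intDom φ))
    (hq : SmoothPositive q θ₀ ρ)
    (hr : ∀ z ∈ Metric.ball (θ₀, θ₀) ρ, q z.1 / q z.2 ∈ intDom φ) :
    ContDiffOn ℝ 3 (weightedDeriv φ q) (Metric.ball (θ₀, θ₀) ρ) :=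
  ((contDiffOn_dPhi hφs).comp hq.contDiffOn_ratio hr).mul hq.contDiffOn_fst

lemma contDiffOn_conjugateTerm (hφs : ContDiffOn ℝ 4 (realPhi φ) (intDom φ))
    (hq : SmoothPositive q θ₀ ρ)
    (hr : ∀ z ∈ Metric.ball (θ₀, θ₀) ρ, q z.1 / q z.2 ∈ intDom φ) :
    ContDiffOn ℝ 3 (conjugateTerm φ q) (Metric.ball (θ₀, θ₀) ρ) :=
  (hq.contDiffOn_ratio.mul ((contDiffOn_dPhi hφs).comp hq.contDiffOn_ratio hr)).sub
    ((hφs.of_le (by norm_num)).comp hq.contDiffOn_ratio hr)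

/-- The second order partial derivatives of the two terms of the contrast at `(θ₀, θ₀)`. -/
lemma partialD_partialD_sub (hφ : IsDivergenceFunction φ)
    (hφs : ContDiffOn ℝ 4 (realPhi φ) (intDom φ)) (hq : SmoothPositive q θ₀ ρ) (hρ : 0 < ρ)
    (hr : ∀ z ∈ Metric.ball (θ₀, θ₀) ρ, q z.1 / q z.2 ∈ intDom φ) (i j : Fin d ⊕ Fin d) :
    partialD j (partialD i (weightedDeriv φ q)) (θ₀, θ₀) -
      q θ₀ * partialD j (partialD i (conjugateTerm φ q)) (θ₀, θ₀) = deriv (dPhi φ) 1 *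
        ((partialD i (fun z => q z.1) (θ₀, θ₀) * partialD j (fun z => q z.1) (θ₀, θ₀) -
          partialD i (fun z => q z.2) (θ₀, θ₀) * partialD j (fun z => q z.2) (θ₀, θ₀)) / q θ₀) := by
  have hθ : θ₀ ∈ Metric.ball θ₀ ρ := Metric.mem_ball_self hρ
  have hz : (θ₀, θ₀) ∈ Metric.ball (θ₀, θ₀) ρ := Metric.mem_ball_self hρ
  have hnhds := Metric.isOpen_ball.mem_nhds hz
  -- Differentiating this identity once more leaves only products of first derivatives: the second
  -- derivative of the conjugate term is subtracted off, and that of `q` is multiplied by `φ'(1) =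
  -- 0`.
  have hev : partialD i (weightedDeriv φ q) =ᶠ[𝓝 (θ₀, θ₀)] fun z =>
      q z.2 * partialD i (conjugateTerm φ q) z +
        dPhi φ (q z.1 / q z.2) * partialD i (fun z => q z.1) z := by
    filter_upwards [hnhds] with z hz
    exact partialD_weightedDeriv hφ hφs hq hz (hr z hz) i
  have hdiff : ∀ {F : EuclideanSpace ℝ (Fin d) × EuclideanSpace ℝ (Fin d) → ℝ},
      ContDiffOn ℝ 3 F (Metric.ball (θ₀, θ₀) ρ) → ∀ i,
      DifferentiableAt ℝ (partialD i F) (θ₀, θ₀) := fun hF i =>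
    ((contDiffOn_partialD Metric.isOpen_ball (n := 2) (by exact_mod_cast hF) i).differentiableOn
      (by norm_num)).differentiableAt hnhds
  have h1 := (hasFDerivAt_sum_partialD (hdiff (hq.contDiffOn_conjugateTerm hφs hr) i))
  have h2 := (hasFDerivAt_sum_partialD (hdiff hq.contDiffOn_fst i))
  have h3 : HasFDerivAt (fun z : EuclideanSpace ℝ (Fin d) × EuclideanSpace ℝ (Fin d) =>
      dPhi φ (q z.1 / q z.2)) _ (θ₀, θ₀) :=
    (hasDerivAt_dPhi hφs (hr _ hz)).comp_hasFDerivAt (θ₀, θ₀) (hq.hasFDerivAt_ratio hz)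
  have h4 := ((hq.hasFDerivAt_snd hz).mul h1).add (h3.mul h2)
  have hone : q θ₀ / q θ₀ = 1 := hq.ratio_diag hθ
  rw [(partialD_congr hev j).trans (partialD_eq h4 j)]
  simp only [_root_.add_apply, _root_.smul_apply, smul_eq_mul]
  rw [← partialD_eq h1, ← partialD_eq h2, ← partialD_eq (hq.hasFDerivAt_ratio hz),
    ← partialD_eq (hq.hasFDerivAt_snd hz), hone, dPhi_one hφ,
    hq.partialD_conjugateTerm_diag hφ hφs hθ, hq.partialD_ratio_diag hθ]
  have := (hq.pos θ₀ hθ).ne'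
  field_simp
  ring

/-- If the partial derivatives of `φ'(q θ / q α) * q θ` are bounded, then the ratios `q θ / q α`
stay in the interior of the domain of `φ`. -/
lemma ratio_mem_intDom (hφ : IsDivergenceFunction φ)
    (hφs : ContDiffOn ℝ 4 (realPhi φ) (intDom φ)) (hq : SmoothPositive q θ₀ ρ) {L : ℝ}
    (hL : ∀ z ∈ Metric.ball (θ₀, θ₀) ρ, ∀ i, |partialD i (weightedDeriv φ q) z| ≤ L)
    (hz : z ∈ Metric.ball (θ₀, θ₀) ρ) : q z.1 / q z.2 ∈ intDom φ := by
  obtain ⟨θ, α⟩ := z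
  have hz' := hz
  rw [← ball_prod_same] at hz'
  obtain ⟨hθ, hα⟩ := hz'
  -- The path starts on the diagonal and moves only `α`, so the factor `q θ` stays constant and a
  -- bound on the product is a bound on `φ'`.
  set v : EuclideanSpace ℝ (Fin d) × EuclideanSpace ℝ (Fin d) := (0, α - θ) with hv
  set y : ℝ → EuclideanSpace ℝ (Fin d) × EuclideanSpace ℝ (Fin d) := fun s => (θ, θ) + s • v
    with hy
  have hy1 : ∀ s, (y s).1 = θ := fun s => by simp [hy, hv]
  have hyball : ∀ s ∈ Icc (0 : ℝ) 1, y s ∈ Metric.ball (θ₀, θ₀) ρ := by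
    intro s hs
    rw [← ball_prod_same]
    have h2 := (convex_ball θ₀ ρ).add_smul_sub_mem hθ hα hs
    refine ⟨?_, ?_⟩
    · rw [hy1]; exact hθ
    · simpa [hy, hv] using h2
  have hycont : Continuous y := by simp only [hy]; fun_prop
  have hL0 : 0 ≤ ∑ i, |coord i v| * L :=
    Finset.sum_nonneg fun i _ => mul_nonneg (abs_nonneg _)
      ((abs_nonneg _).trans (hL (θ, α) hz i))
  have hratio0 : q (y 0).1 / q (y 0).2 = 1 := by
    simp only [hy, zero_smul, add_zero]; exact hq.ratio_diag hθ
  have key := mem_intDom_of_bounded hφ (t := fun s => q (y s).1 / q (y s).2)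
    (C := (∑ i, |coord i v| * L) / q θ)
    (hq.contDiffOn_ratio.continuousOn.comp hycont.continuousOn hyball)
    (by rw [hratio0]; exact hφ.one_mem) ?_ 1 (right_mem_Icc.2 zero_le_one)
  · simpa [hy, hv] using key
  · intro s hs hmem
    have hder : ∀ t ∈ Icc (0 : ℝ) s, HasDerivWithinAt (fun t => weightedDeriv φ q (y t))
        (∑ i, partialD i (weightedDeriv φ q) (y t) * coord i v) (Icc 0 s) t := by
      intro t ht
      have ht' : t ∈ Icc (0 : ℝ) 1 := ⟨ht.1, ht.2.trans hs.2⟩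
      have h1 : HasDerivAt y v t := by
        simpa [hy] using ((hasDerivAt_id t).smul_const v).const_add (θ, θ)
      have h2 := hasFDerivAt_sum_partialD
        (hq.hasFDerivAt_weightedDeriv hφs (hyball t ht') (hmem t ht)).differentiableAt
      refine ((h2.comp_hasDerivAt t h1).congr_deriv ?_).hasDerivWithinAt
      simp
    have hbd : ∀ t ∈ Icc (0 : ℝ) s,
        ‖∑ i, partialD i (weightedDeriv φ q) (y t) * coord i v‖ ≤ ∑ i, |coord i v| * L := by
      intro t ht
      refine (norm_sum_le _ _).trans (Finset.sum_le_sum fun i _ => ?_)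
      rw [norm_mul, mul_comm]
      exact mul_le_mul_of_nonneg_left (hL _ (hyball t ⟨ht.1, ht.2.trans hs.2⟩) i) (abs_nonneg _)
    have hmv := (convex_Icc 0 s).norm_image_sub_le_of_norm_hasDerivWithin_le hder hbd
      (left_mem_Icc.2 hs.1) (right_mem_Icc.2 hs.1)
    -- On the diagonal the ratio is `1` and `φ'(1) = 0`, so the mean value inequality bounds the
    -- function itself and not just its increment.
    have h0 : weightedDeriv φ q (y 0) = 0 := by
      rw [weightedDeriv, hratio0, dPhi_one hφ, zero_mul]
    rw [h0, sub_zero, sub_zero, weightedDeriv, hy1, norm_mul, Real.norm_of_nonneg hs.1,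
      Real.norm_of_nonneg (hq.pos θ hθ).le, Real.norm_eq_abs] at hmv
    rw [le_div_iff₀ (hq.pos θ hθ)]
    simp only [hy1]
    exact hmv.trans (mul_le_of_le_one_right hL0 hs.2)

end SmoothPositive

end Pointwise

end PhiDivergence
end

noncomputable section

namespace PhiDivergence

/-! ### The contrast of a parametric model -/

variable {d : ℕ}

section Coordinates

variable {q : EuclideanSpace ℝ (Fin d) → ℝ}

lemma partialD_inl_fst (i : Fin d) (θ α : EuclideanSpace ℝ (Fin d)) :
    partialD (Sum.inl i) (fun z => q z.1) (θ, α) =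
      lineDeriv ℝ q θ (EuclideanSpace.single i 1) := rfl

lemma partialD_inr_snd (i : Fin d) (θ α : EuclideanSpace ℝ (Fin d)) :
    partialD (Sum.inr i) (fun z => q z.2) (θ, α) =
      lineDeriv ℝ q α (EuclideanSpace.single i 1) := rfl

lemma partialD_inr_fst (i : Fin d) (θ α : EuclideanSpace ℝ (Fin d)) :
    partialD (Sum.inr i) (fun z => q z.1) (θ, α) = 0 := by
  simp [partialD, lineDeriv, dir]

lemma partialD_inl_snd (i : Fin d) (θ α : EuclideanSpace ℝ (Fin d)) :
    partialD (Sum.inl i) (fun z => q z.2) (θ, α) = 0 := by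
  simp [partialD, lineDeriv, dir]

variable {F F' : EuclideanSpace ℝ (Fin d) × EuclideanSpace ℝ (Fin d) → ℝ}
  {U : Set (EuclideanSpace ℝ (Fin d) × EuclideanSpace ℝ (Fin d))}

lemma eqOn_partialD (hU : IsOpen U) (h : EqOn F F' U) (i : Fin d ⊕ Fin d) :
    EqOn (partialD i F) (partialD i F') U := fun _ hz =>
  partialD_congr (h.eventuallyEq_of_mem (hU.mem_nhds hz)) i

lemma partialD_zero (i : Fin d ⊕ Fin d) :
    partialD i (0 : EuclideanSpace ℝ (Fin d) × EuclideanSpace ℝ (Fin d) → ℝ) = 0 := by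
  ext z; simp [partialD, lineDeriv]

lemma eqOn_partialD_zero (hU : IsOpen U) (h : EqOn F 0 U) (i : Fin d ⊕ Fin d) :
    EqOn (partialD i F) 0 U := by
  simpa [partialD_zero] using eqOn_partialD hU h i

lemma partialD_sub {z : EuclideanSpace ℝ (Fin d) × EuclideanSpace ℝ (Fin d)}
    (h : DifferentiableAt ℝ F z) (h' : DifferentiableAt ℝ F' z) (i : Fin d ⊕ Fin d) :
    partialD i (fun z => F z - F' z) z = partialD i F z - partialD i F' z := by
  rw [partialD_eq (h.hasFDerivAt.fun_sub h'.hasFDerivAt), partialD_eq h.hasFDerivAt,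
    partialD_eq h'.hasFDerivAt, _root_.sub_apply]

end Coordinates

variable {𝒳 : Type*} [MeasurableSpace 𝒳]

/-- The contrast `(θ, α) ↦ h(θ, α, ·)`. -/
def contrast (lam : Measure 𝒳) (φ : ℝ → ℝ≥0∞) (p : EuclideanSpace ℝ (Fin d) → 𝒳 → ℝ)
    (z : EuclideanSpace ℝ (Fin d) × EuclideanSpace ℝ (Fin d)) (x : 𝒳) : ℝ :=
  hFun lam φ p z.1 z.2 x

/-- The score function of the model at `θ`. -/
def scoreFun (p : EuclideanSpace ℝ (Fin d) → 𝒳 → ℝ) (θ : EuclideanSpace ℝ (Fin d)) (x : 𝒳) :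
    EuclideanSpace ℝ (Fin d) :=
  WithLp.toLp 2 fun i => lineDeriv ℝ (fun ϑ => p ϑ x) θ (EuclideanSpace.single i 1) / p θ x

/-- The behaviour of a model near `θ₀`: almost every observation has smooth positive densities with
ratios in the interior of the domain of `φ`, or else vanishing densities. -/
structure LocalModel (lam : Measure 𝒳) (φ : ℝ → ℝ≥0∞) (p : EuclideanSpace ℝ (Fin d) → 𝒳 → ℝ)
    (θ₀ : EuclideanSpace ℝ (Fin d)) (ρ : ℝ) (L : 𝒳 → ℝ) : Prop where
  divergence : IsDivergenceFunction φ
  smooth : ContDiffOn ℝ 4 (realPhi φ) (intDom φ)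
  pos_two : 0 < deriv (dPhi φ) 1
  ρ_pos : 0 < ρ
  measurable : ∀ θ ∈ Metric.ball θ₀ ρ, Measurable (p θ)
  nonneg : ∀ θ ∈ Metric.ball θ₀ ρ, ∀ x, 0 ≤ p θ x
  isProbabilityMeasure : ∀ θ ∈ Metric.ball θ₀ ρ, IsProbabilityMeasure (modelMeasure lam p θ)
  regular : ∀ᵐ x ∂lam, (SmoothPositive (fun θ => p θ x) θ₀ ρ ∧
    ∀ z ∈ Metric.ball (θ₀, θ₀) ρ, p z.1 x / p z.2 x ∈ intDom φ) ∨
      ∀ θ ∈ Metric.ball θ₀ ρ, p θ x = 0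
  integrable_bound : Integrable L lam
  bound : ∀ᵐ x ∂lam, ∀ z ∈ Metric.ball (θ₀, θ₀) ρ, ∀ i, |partialD i (fpAt φ p x) z| ≤ L x
  bound_two : ∀ᵐ x ∂lam, ∀ z ∈ Metric.ball (θ₀, θ₀) ρ, ∀ i j,
    |partialD j (partialD i (fpAt φ p x)) z| ≤ L x
  integrable : ∀ z ∈ Metric.ball (θ₀, θ₀) ρ,
    Integrable (fFun φ p z.1 z.2) (modelMeasure lam p z.1)

section modelMeasure

variable {lam : Measure 𝒳} {p : EuclideanSpace ℝ (Fin d) → 𝒳 → ℝ} {θ : EuclideanSpace ℝ (Fin d)}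

lemma integral_modelMeasure (hm : Measurable (p θ)) (h0 : ∀ x, 0 ≤ p θ x) (u : 𝒳 → ℝ) :
    ∫ x, u x ∂(modelMeasure lam p θ) = ∫ x, u x * p θ x ∂lam := by
  rw [modelMeasure, integral_withDensity_eq_integral_toReal_smul hm.ennreal_ofReal (by simp)]
  simp [ENNReal.toReal_ofReal (h0 _), mul_comm]

lemma integrable_modelMeasure_iff (hm : Measurable (p θ)) (h0 : ∀ x, 0 ≤ p θ x) {u : 𝒳 → ℝ} :
    Integrable u (modelMeasure lam p θ) ↔ Integrable (fun x => u x * p θ x) lam := by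
  rw [modelMeasure, integrable_withDensity_iff hm.ennreal_ofReal (by simp)]
  simp [ENNReal.toReal_ofReal (h0 _)]

lemma ae_modelMeasure_iff (hm : Measurable (p θ)) {u : 𝒳 → Prop} :
    (∀ᵐ x ∂(modelMeasure lam p θ), u x) ↔ ∀ᵐ x ∂lam, 0 < p θ x → u x := by
  rw [modelMeasure, ae_withDensity_iff hm.ennreal_ofReal]
  simp

end modelMeasure

namespace LocalModel

variable {lam : Measure 𝒳} {φ : ℝ → ℝ≥0∞} {p : EuclideanSpace ℝ (Fin d) → 𝒳 → ℝ}
  {θ₀ : EuclideanSpace ℝ (Fin d)} {ρ : ℝ} {L : 𝒳 → ℝ}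

lemma mem_fst {z : EuclideanSpace ℝ (Fin d) × EuclideanSpace ℝ (Fin d)}
    (hz : z ∈ Metric.ball (θ₀, θ₀) ρ) : z.1 ∈ Metric.ball θ₀ ρ := by
  rw [← ball_prod_same] at hz; exact hz.1

lemma mem_snd {z : EuclideanSpace ℝ (Fin d) × EuclideanSpace ℝ (Fin d)}
    (hz : z ∈ Metric.ball (θ₀, θ₀) ρ) : z.2 ∈ Metric.ball θ₀ ρ := by
  rw [← ball_prod_same] at hz; exact hz.2

omit [MeasurableSpace 𝒳] in
lemma fpAt_eqOn_zero {x : 𝒳} (hx : ∀ θ ∈ Metric.ball θ₀ ρ, p θ x = 0) :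
    EqOn (fpAt φ p x) 0 (Metric.ball (θ₀, θ₀) ρ) := fun z hz => by
  simp [fpAt, hx z.1 (mem_fst hz)]

lemma differentiableAt_of_contDiffOn
    {F : EuclideanSpace ℝ (Fin d) × EuclideanSpace ℝ (Fin d) → ℝ}
    (hF : ContDiffOn ℝ 3 F (Metric.ball (θ₀, θ₀) ρ))
    {z : EuclideanSpace ℝ (Fin d) × EuclideanSpace ℝ (Fin d)}
    (hz : z ∈ Metric.ball (θ₀, θ₀) ρ) :
    DifferentiableAt ℝ F z ∧ (∀ i, DifferentiableAt ℝ (partialD i F) z) ∧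
      ∀ i j, DifferentiableAt ℝ (partialD j (partialD i F)) z := by
  have hnhds := Metric.isOpen_ball.mem_nhds hz
  have h2 := fun i => contDiffOn_partialD Metric.isOpen_ball (n := 2) (by exact_mod_cast hF) i
  have h1 := fun i j =>
    contDiffOn_partialD Metric.isOpen_ball (n := 1) (by exact_mod_cast h2 i) j
  exact ⟨(hF.differentiableOn (by norm_num)).differentiableAt hnhds,
    fun i => ((h2 i).differentiableOn (by norm_num)).differentiableAt hnhds,
    fun i j => ((h1 i j).differentiableOn (by norm_num)).differentiableAt hnhds⟩

variable (hm : LocalModel lam φ p θ₀ ρ L)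
include hm

lemma ae_differentiableAt : ∀ᵐ x ∂lam, ∀ z ∈ Metric.ball (θ₀, θ₀) ρ,
    DifferentiableAt ℝ (fpAt φ p x) z ∧ ∀ i, DifferentiableAt ℝ (partialD i (fpAt φ p x)) z := by
  filter_upwards [hm.regular] with x hx z hz
  rcases hx with ⟨hx, hr⟩ | hx
  · have := differentiableAt_of_contDiffOn (hx.contDiffOn_weightedDeriv hm.smooth hr) hz
    exact ⟨this.1, this.2.1⟩
  · have hnhds := Metric.isOpen_ball.mem_nhds hz
    have h0 := fpAt_eqOn_zero (φ := φ) hx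
    exact ⟨(differentiableAt_const 0).congr_of_eventuallyEq (h0.eventuallyEq_of_mem hnhds),
      fun i => (differentiableAt_const 0).congr_of_eventuallyEq
        ((eqOn_partialD_zero Metric.isOpen_ball h0 i).eventuallyEq_of_mem hnhds)⟩

lemma measurable_ratio {z : EuclideanSpace ℝ (Fin d) × EuclideanSpace ℝ (Fin d)}
    (hz : z ∈ Metric.ball (θ₀, θ₀) ρ) : Measurable fun x => p z.1 x / p z.2 x :=
  (hm.measurable _ (mem_fst hz)).div (hm.measurable _ (mem_snd hz))

lemma measurable_fpAt {z : EuclideanSpace ℝ (Fin d) × EuclideanSpace ℝ (Fin d)}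
    (hz : z ∈ Metric.ball (θ₀, θ₀) ρ) : Measurable fun x => fpAt φ p x z :=
  ((measurable_dPhi φ).comp (hm.measurable_ratio hz)).mul (hm.measurable _ (mem_fst hz))

lemma integrable_fpAt {z : EuclideanSpace ℝ (Fin d) × EuclideanSpace ℝ (Fin d)}
    (hz : z ∈ Metric.ball (θ₀, θ₀) ρ) : Integrable (fun x => fpAt φ p x z) lam :=
  (integrable_modelMeasure_iff (hm.measurable _ (mem_fst hz)) (hm.nonneg _ (mem_fst hz))).1
    (hm.integrable z hz)

lemma measurable_contrast {z : EuclideanSpace ℝ (Fin d) × EuclideanSpace ℝ (Fin d)}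
    (hz : z ∈ Metric.ball (θ₀, θ₀) ρ) : Measurable (contrast lam φ p z) := by
  have h1 := hm.measurable_ratio hz
  exact measurable_const.sub ((h1.mul ((measurable_dPhi φ).comp h1)).sub
    ((measurable_realPhi hm.divergence).comp h1))

lemma contrast_eq {z : EuclideanSpace ℝ (Fin d) × EuclideanSpace ℝ (Fin d)}
    (hz : z ∈ Metric.ball (θ₀, θ₀) ρ) (x : 𝒳) :
    hAt lam φ p x z = (∫ y, fpAt φ p y z ∂lam) - conjugateTerm φ (fun θ => p θ x) z := by
  rw [hAt, hFun, integral_modelMeasure (hm.measurable _ (mem_fst hz)) (hm.nonneg _ (mem_fst hz))]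
  rfl

lemma hasFDerivAt_integral {z : EuclideanSpace ℝ (Fin d) × EuclideanSpace ℝ (Fin d)}
    (hz : z ∈ Metric.ball (θ₀, θ₀) ρ) :
    (∀ i, Integrable (fun x => partialD i (fpAt φ p x) z) lam) ∧
      HasFDerivAt (fun z => ∫ x, fpAt φ p x z ∂lam)
        (∑ i, (∫ x, partialD i (fpAt φ p x) z ∂lam) • coord i) z :=
  hasFDerivAt_integral_of_partialD_le Metric.isOpen_ball
    (fun _ hz => (hm.measurable_fpAt hz).aestronglyMeasurable) (fun _ hz => hm.integrable_fpAt hz)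
    hm.integrable_bound (hm.ae_differentiableAt.mono fun _ hx z hz => (hx z hz).1) hm.bound hz

lemma partialD_integral {z : EuclideanSpace ℝ (Fin d) × EuclideanSpace ℝ (Fin d)}
    (hz : z ∈ Metric.ball (θ₀, θ₀) ρ) (i : Fin d ⊕ Fin d) :
    partialD i (fun z => ∫ x, fpAt φ p x z ∂lam) z = ∫ x, partialD i (fpAt φ p x) z ∂lam := by
  rw [partialD_eq (hm.hasFDerivAt_integral hz).2, sum_smul_coord_dir]

lemma hasFDerivAt_integral_partialD {z : EuclideanSpace ℝ (Fin d) × EuclideanSpace ℝ (Fin d)}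
    (hz : z ∈ Metric.ball (θ₀, θ₀) ρ) (i : Fin d ⊕ Fin d) :
    (∀ j, Integrable (fun x => partialD j (partialD i (fpAt φ p x)) z) lam) ∧
      HasFDerivAt (partialD i fun z => ∫ x, fpAt φ p x z ∂lam)
        (∑ j, (∫ x, partialD j (partialD i (fpAt φ p x)) z ∂lam) • coord j) z := by
  have h := hasFDerivAt_integral_of_partialD_le (lam := lam) Metric.isOpen_ball
    (m := fun z x => partialD i (fpAt φ p x) z)
    (fun z hz => ((hm.hasFDerivAt_integral hz).1 i).aestronglyMeasurable)
    (fun z hz => (hm.hasFDerivAt_integral hz).1 i) hm.integrable_bound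
    (hm.ae_differentiableAt.mono fun _ hx z hz => (hx z hz).2 i)
    (hm.bound_two.mono fun _ hx z hz => hx z hz i) hz
  refine ⟨h.1, h.2.congr_of_eventuallyEq ?_⟩
  filter_upwards [Metric.isOpen_ball.mem_nhds hz] with w hw using hm.partialD_integral hw i

lemma partialD_partialD_integral {z : EuclideanSpace ℝ (Fin d) × EuclideanSpace ℝ (Fin d)}
    (hz : z ∈ Metric.ball (θ₀, θ₀) ρ) (i j : Fin d ⊕ Fin d) :
    partialD j (partialD i fun z => ∫ x, fpAt φ p x z ∂lam) z =
      ∫ x, partialD j (partialD i (fpAt φ p x)) z ∂lam := by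
  rw [partialD_eq (hm.hasFDerivAt_integral_partialD hz i).2, sum_smul_coord_dir]

lemma integral_density {θ : EuclideanSpace ℝ (Fin d)} (hθ : θ ∈ Metric.ball θ₀ ρ) :
    Integrable (p θ) lam ∧ ∫ x, p θ x ∂lam = 1 := by
  have := hm.isProbabilityMeasure θ hθ
  have h1 := (integrable_modelMeasure_iff (lam := lam) (hm.measurable θ hθ) (hm.nonneg θ hθ)
    (u := fun _ => 1)).1 (integrable_const 1)
  have h2 := integral_modelMeasure (lam := lam) (hm.measurable θ hθ) (hm.nonneg θ hθ) fun _ => 1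
  simp only [one_mul] at h1 h2
  exact ⟨h1, by rw [← h2]; simp⟩

/-- The derivatives of the densities integrate to `0`. -/
lemma integral_lineDeriv (i : Fin d) :
    ∫ x, lineDeriv ℝ (fun ϑ => p ϑ x) θ₀ (EuclideanSpace.single i 1) ∂lam = 0 := by
  have hz : (θ₀, θ₀) ∈ Metric.ball (θ₀, θ₀) ρ := Metric.mem_ball_self hm.ρ_pos
  have hzero : ∀ {x : 𝒳}, (∀ θ ∈ Metric.ball θ₀ ρ, p θ x = 0) →
      EqOn (fun z : EuclideanSpace ℝ (Fin d) × EuclideanSpace ℝ (Fin d) => p z.1 x) 0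
        (Metric.ball (θ₀, θ₀) ρ) := fun hx z hz => hx z.1 (mem_fst hz)
  -- Domination of the density derivatives is not assumed, but follows: on the diagonal the
  -- `θ`-derivative of `f p_θ` is `φ''(1)` times that of `p_θ`, whence the bound `|L| / φ''(1)`.
  have h := hasFDerivAt_integral_of_partialD_le (lam := lam) Metric.isOpen_ball
    (m := fun z x => p z.1 x) (L := fun x => |L x| / deriv (dPhi φ) 1)
    (fun z hz => (hm.measurable _ (mem_fst hz)).aestronglyMeasurable)
    (fun z hz => (hm.integral_density (mem_fst hz)).1) (hm.integrable_bound.abs.div_const _)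
    ?_ ?_ hz
  · have h1 := partialD_eq h.2 (Sum.inl i)
    have h2 : (fun z : EuclideanSpace ℝ (Fin d) × EuclideanSpace ℝ (Fin d) =>
        ∫ x, p z.1 x ∂lam) =ᶠ[𝓝 (θ₀, θ₀)] fun _ => 1 := by
      filter_upwards [Metric.isOpen_ball.mem_nhds hz] with z hz
      exact (hm.integral_density (mem_fst hz)).2
    rw [partialD_congr h2, partialD_eq (hasFDerivAt_const (1 : ℝ) (θ₀, θ₀))] at h1
    rw [sum_smul_coord_dir] at h1
    exact h1.symm
  · filter_upwards [hm.regular] with x hx z hz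
    rcases hx with ⟨hx, -⟩ | hx
    · exact (hx.hasFDerivAt_fst hz).differentiableAt
    · exact (differentiableAt_const 0).congr_of_eventuallyEq
        ((hzero hx).eventuallyEq_of_mem (Metric.isOpen_ball.mem_nhds hz))
  · filter_upwards [hm.regular, hm.bound] with x hx hb z hz j
    have hc := hm.pos_two
    rcases hx with ⟨hx, -⟩ | hx
    · obtain ⟨θ, α⟩ := z
      have hθ : θ ∈ Metric.ball θ₀ ρ := mem_fst (z := (θ, α)) hz
      rw [le_div_iff₀ hc]
      rcases j with j | j
      · have hdiag : (θ, θ) ∈ Metric.ball (θ₀, θ₀) ρ := by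
          rw [← ball_prod_same]; exact ⟨hθ, hθ⟩
        have h1 := hb (θ, θ) hdiag (Sum.inl j)
        have h2 := hx.partialD_weightedDeriv_diag hm.divergence hm.smooth hθ (Sum.inl j)
        have h3 : partialD (Sum.inl j) (fun z => p z.2 x) (θ, θ) = 0 :=
          partialD_inl_snd (q := fun θ => p θ x) j θ θ
        rw [h3, sub_zero] at h2
        change |partialD (Sum.inl j) (weightedDeriv φ fun θ => p θ x) (θ, θ)| ≤ L x at h1
        rw [h2, abs_mul, abs_of_pos hc, mul_comm] at h1
        exact h1.trans (le_abs_self _)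
      · have h1 : partialD (Sum.inr j) (fun z => p z.1 x) (θ, α) = 0 :=
          partialD_inr_fst (q := fun θ => p θ x) j θ α
        rw [h1]; simp
    · rw [eqOn_partialD_zero Metric.isOpen_ball (hzero hx) j hz]
      simp only [Pi.zero_apply, abs_zero]
      positivity

end LocalModel

end PhiDivergence
end

noncomputable section

namespace PhiDivergence

variable {d : ℕ} {𝒳 : Type*} [MeasurableSpace 𝒳]

/-! ### Gradient, Hessian and moments of the contrast at the true parameter. -/

namespace LocalModel

variable {lam : Measure 𝒳} {φ : ℝ → ℝ≥0∞} {p : EuclideanSpace ℝ (Fin d) → 𝒳 → ℝ}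
  {θ₀ : EuclideanSpace ℝ (Fin d)} {ρ : ℝ} {L K : 𝒳 → ℝ}

omit [MeasurableSpace 𝒳] in
lemma lineDeriv_eq_zero {x : 𝒳} (hρ : 0 < ρ) (hx : ∀ θ ∈ Metric.ball θ₀ ρ, p θ x = 0)
    (v : EuclideanSpace ℝ (Fin d)) : lineDeriv ℝ (fun ϑ => p ϑ x) θ₀ v = 0 := by
  have : (fun ϑ => p ϑ x) =ᶠ[𝓝 θ₀] fun _ => 0 :=
    eventually_of_mem (Metric.ball_mem_nhds θ₀ hρ) hx
  rw [this.lineDeriv_eq]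
  simp [lineDeriv]

variable (hm : LocalModel lam φ p θ₀ ρ L)
include hm

lemma center_mem : (θ₀, θ₀) ∈ Metric.ball (θ₀, θ₀) ρ := Metric.mem_ball_self hm.ρ_pos

lemma ae_pos_imp : ∀ᵐ x ∂(modelMeasure lam p θ₀), SmoothPositive (fun θ => p θ x) θ₀ ρ ∧
    ∀ z ∈ Metric.ball (θ₀, θ₀) ρ, p z.1 x / p z.2 x ∈ intDom φ := by
  have hθ : θ₀ ∈ Metric.ball θ₀ ρ := Metric.mem_ball_self hm.ρ_pos
  rw [ae_modelMeasure_iff (hm.measurable θ₀ hθ)]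
  filter_upwards [hm.regular] with x hx hpos
  rcases hx with hx | hx
  · exact hx
  · exact absurd (hx θ₀ hθ) hpos.ne'

lemma ae_partialD_fpAt_diag : ∀ᵐ x ∂lam, ∀ i : Fin d,
    partialD (Sum.inl i) (fpAt φ p x) (θ₀, θ₀) = deriv (dPhi φ) 1 *
        lineDeriv ℝ (fun ϑ => p ϑ x) θ₀ (EuclideanSpace.single i 1) ∧
      partialD (Sum.inr i) (fpAt φ p x) (θ₀, θ₀) = -(deriv (dPhi φ) 1 *
        lineDeriv ℝ (fun ϑ => p ϑ x) θ₀ (EuclideanSpace.single i 1)) := by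
  have hθ : θ₀ ∈ Metric.ball θ₀ ρ := Metric.mem_ball_self hm.ρ_pos
  filter_upwards [hm.regular] with x hx i
  rcases hx with ⟨hx, -⟩ | hx
  · have h1 := hx.partialD_weightedDeriv_diag hm.divergence hm.smooth hθ (Sum.inl i)
    have h2 := hx.partialD_weightedDeriv_diag hm.divergence hm.smooth hθ (Sum.inr i)
    rw [partialD_inl_fst (q := fun θ => p θ x), partialD_inl_snd (q := fun θ => p θ x),
      sub_zero] at h1
    rw [partialD_inr_fst (q := fun θ => p θ x), partialD_inr_snd (q := fun θ => p θ x),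
      zero_sub, mul_neg] at h2
    exact ⟨h1, h2⟩
  · have h0 := fun i => eqOn_partialD_zero Metric.isOpen_ball (fpAt_eqOn_zero (φ := φ) hx) i
      hm.center_mem
    simp [h0, lineDeriv_eq_zero hm.ρ_pos hx]

/-- On the diagonal the integrand is `± φ''(1)` times a derivative of the density, or zero off the
support. Hence the integral term of `h` does not contribute to its gradient at the centre. -/
lemma integral_partialD_fpAt_diag (i : Fin d ⊕ Fin d) :
    ∫ x, partialD i (fpAt φ p x) (θ₀, θ₀) ∂lam = 0 := by
  rcases i with i | i
  · rw [integral_congr_ae (hm.ae_partialD_fpAt_diag.mono fun x hx => (hx i).1),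
      integral_const_mul, hm.integral_lineDeriv, mul_zero]
  · rw [integral_congr_ae (hm.ae_partialD_fpAt_diag.mono fun x hx => (hx i).2), integral_neg,
      integral_const_mul, hm.integral_lineDeriv, mul_zero, neg_zero]

lemma differentiableAt_integral {z : EuclideanSpace ℝ (Fin d) × EuclideanSpace ℝ (Fin d)}
    (hz : z ∈ Metric.ball (θ₀, θ₀) ρ) :
    DifferentiableAt ℝ (fun z => ∫ x, fpAt φ p x z ∂lam) z ∧
      ∀ i, DifferentiableAt ℝ (partialD i fun z => ∫ x, fpAt φ p x z ∂lam) z :=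
  ⟨(hm.hasFDerivAt_integral hz).2.differentiableAt,
    fun i => (hm.hasFDerivAt_integral_partialD hz i).2.differentiableAt⟩

section Pointwise

variable {x : 𝒳} (hx : SmoothPositive (fun θ => p θ x) θ₀ ρ)
  (hr : ∀ z ∈ Metric.ball (θ₀, θ₀) ρ, p z.1 x / p z.2 x ∈ intDom φ)
  {z : EuclideanSpace ℝ (Fin d) × EuclideanSpace ℝ (Fin d)} (hz : z ∈ Metric.ball (θ₀, θ₀) ρ)
include hx hr hz

lemma partialD_hAt (i : Fin d ⊕ Fin d) :
    partialD i (hAt lam φ p x) z = partialD i (fun z => ∫ y, fpAt φ p y z ∂lam) z -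
      partialD i (conjugateTerm φ fun θ => p θ x) z := by
  rw [eqOn_partialD Metric.isOpen_ball (fun z hz => hm.contrast_eq hz x) i hz,
    partialD_sub (hm.differentiableAt_integral hz).1
      (differentiableAt_of_contDiffOn (hx.contDiffOn_conjugateTerm hm.smooth hr) hz).1]

lemma differentiableAt_hAt : DifferentiableAt ℝ (hAt lam φ p x) z ∧
    ∀ i, DifferentiableAt ℝ (partialD i (hAt lam φ p x)) z := by
  have hc := differentiableAt_of_contDiffOn (hx.contDiffOn_conjugateTerm hm.smooth hr) hz
  have hM := hm.differentiableAt_integral hz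
  have hnhds := Metric.isOpen_ball.mem_nhds hz
  exact ⟨(hM.1.fun_sub hc.1).congr_of_eventuallyEq
      (eventually_of_mem hnhds fun w hw => hm.contrast_eq hw x),
    fun i => ((hM.2 i).fun_sub (hc.2.1 i)).congr_of_eventuallyEq
      (eventually_of_mem hnhds fun w hw => hm.partialD_hAt hx hr hw i)⟩

lemma partialD_partialD_hAt (i j : Fin d ⊕ Fin d) :
    partialD j (partialD i (hAt lam φ p x)) z =
      (∫ y, partialD j (partialD i (fpAt φ p y)) z ∂lam) -
        partialD j (partialD i (conjugateTerm φ fun θ => p θ x)) z := by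
  rw [eqOn_partialD Metric.isOpen_ball (fun z hz => hm.partialD_hAt hx hr hz i) j hz,
    partialD_sub ((hm.differentiableAt_integral hz).2 i)
      ((differentiableAt_of_contDiffOn (hx.contDiffOn_conjugateTerm hm.smooth hr) hz).2.1 i),
    hm.partialD_partialD_integral hz]

omit hz

lemma partialD_hAt_diag (i : Fin d) :
    partialD (Sum.inl i) (hAt lam φ p x) (θ₀, θ₀) =
        -(deriv (dPhi φ) 1 * scoreFun p θ₀ x i) ∧
      partialD (Sum.inr i) (hAt lam φ p x) (θ₀, θ₀) =
        deriv (dPhi φ) 1 * scoreFun p θ₀ x i := by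
  have hθ : θ₀ ∈ Metric.ball θ₀ ρ := Metric.mem_ball_self hm.ρ_pos
  have hM : ∀ i, partialD i (hAt lam φ p x) (θ₀, θ₀) =
      -partialD i (conjugateTerm φ fun θ => p θ x) (θ₀, θ₀) := fun i => by
    rw [hm.partialD_hAt hx hr hm.center_mem, hm.partialD_integral hm.center_mem,
      hm.integral_partialD_fpAt_diag, zero_sub]
  rw [hM, hM, hx.partialD_conjugateTerm_diag hm.divergence hm.smooth hθ,
    hx.partialD_conjugateTerm_diag hm.divergence hm.smooth hθ,
    partialD_inl_fst (q := fun θ => p θ x), partialD_inl_snd (q := fun θ => p θ x),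
    partialD_inr_fst (q := fun θ => p θ x), partialD_inr_snd (q := fun θ => p θ x)]
  constructor
  · simp [scoreFun]
  · simp [scoreFun, neg_div]

/-- The bound on third order partial derivatives is a Lipschitz bound for the second order ones, the
number of coordinates entering because they are changed one at a time. -/
lemma regularPoint (hK : ∀ z ∈ Metric.ball (θ₀, θ₀) ρ, ∀ i j k,
      LineDifferentiableAt ℝ (partialD j (partialD i (hAt lam φ p x))) z (dir k) ∧
        |partialD k (partialD j (partialD i (hAt lam φ p x))) z| ≤ K x)
    {s : 𝒳 → EuclideanSpace ℝ (Fin d)} (hs : s x = scoreFun p θ₀ x) :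
    RegularPoint (contrast lam φ p) θ₀ s (fun x => Fintype.card (Fin d ⊕ Fin d) * |K x|)
      (deriv (dPhi φ) 1) ρ x where
  diff z hz := (hm.differentiableAt_hAt hx hr hz).1
  diff_partialD i z hz := (hm.differentiableAt_hAt hx hr hz).2 i
  lip z hz i j := abs_sub_le_of_partialD_le (abs_nonneg (K x)) (fun z hz k => (hK z hz i j k).1)
    (fun z hz k => (hK z hz i j k).2.trans (le_abs_self _)) hz
  score_inl i := by rw [hs]; exact (hm.partialD_hAt_diag hx hr i).1
  score_inr i := by rw [hs]; exact (hm.partialD_hAt_diag hx hr i).2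

end Pointwise

section Moments

lemma integral_model (u : 𝒳 → ℝ) :
    ∫ x, u x ∂(modelMeasure lam p θ₀) = ∫ x, u x * p θ₀ x ∂lam :=
  integral_modelMeasure (hm.measurable _ (Metric.mem_ball_self hm.ρ_pos))
    (hm.nonneg _ (Metric.mem_ball_self hm.ρ_pos)) u

lemma integral_scoreFun (i : Fin d) : ∫ x, scoreFun p θ₀ x i ∂(modelMeasure lam p θ₀) = 0 := by
  have hθ : θ₀ ∈ Metric.ball θ₀ ρ := Metric.mem_ball_self hm.ρ_pos
  rw [hm.integral_model, ← hm.integral_lineDeriv i]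
  refine integral_congr_ae ?_
  filter_upwards [hm.regular] with x hx
  rcases hx with ⟨hx, -⟩ | hx
  · have := (hx.pos θ₀ hθ).ne'
    simp [scoreFun, this]
  · simp [hx θ₀ hθ, lineDeriv_eq_zero hm.ρ_pos hx]

lemma integral_scoreFun_mul (i j : Fin d) :
    ∫ x, scoreFun p θ₀ x i * scoreFun p θ₀ x j ∂(modelMeasure lam p θ₀) =
      fisherInfo lam p θ₀ i j := by
  rw [hm.integral_model]
  refine integral_congr_ae (ae_of_all _ fun x => ?_)
  -- Where the density vanishes, the left side has weight zero and the right side is a division by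
  -- zero, so both are `0`.
  by_cases h : p θ₀ x = 0
  · simp [h]
  · simp only [scoreFun]
    field_simp

/-- Up to the factor `φ''(1)` the score is the `α`-gradient of `h` at the centre, whose square
integrability is part of the moment condition. -/
lemma memLp_scoreFun (hmom : MomentCondition lam φ p θ₀) :
    MemLp (scoreFun p θ₀) 2 (modelMeasure lam p θ₀) := by
  refine MemLp.of_eval_piLp fun i => ?_
  refine ((hmom.1 (Sum.inr i)).const_mul (deriv (dPhi φ) 1)⁻¹).ae_eq ?_
  filter_upwards [hm.ae_pos_imp] with x hx
  rw [(hm.partialD_hAt_diag hx.1 hx.2 i).2, inv_mul_cancel_left₀ hm.pos_two.ne']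

/-- The Hessian of the integral term is constant in `x`, and `P_θ₀` has mass one, so the mean
Hessian is the `lam`-integral of the combination in `partialD_partialD_sub`. That combination is a
difference of products of first derivatives of the density, which gives the block-diagonal form. -/
lemma integral_partialD_partialD_hAt (hmom : MomentCondition lam φ p θ₀) (i j : Fin d ⊕ Fin d) :
    ∫ x, partialD j (partialD i (hAt lam φ p x)) (θ₀, θ₀) ∂(modelMeasure lam p θ₀) =
      deriv (dPhi φ) 1 *
        Matrix.fromBlocks (fisherInfo lam p θ₀) 0 0 (-fisherInfo lam p θ₀) i j := by
  have hθ : θ₀ ∈ Metric.ball θ₀ ρ := Metric.mem_ball_self hm.ρ_pos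
  have hz := hm.center_mem
  set Q₁ : Fin d ⊕ Fin d → 𝒳 → ℝ := fun i x => partialD i (fun z => p z.1 x) (θ₀, θ₀) with hQ₁
  set Q₂ : Fin d ⊕ Fin d → 𝒳 → ℝ := fun i x => partialD i (fun z => p z.2 x) (θ₀, θ₀) with hQ₂
  set I := ∫ x, partialD j (partialD i (fpAt φ p x)) (θ₀, θ₀) ∂lam with hI
  -- When integrated, the term `- I * p θ₀ x` cancels the integral of the last term, leaving the
  -- mean Hessian.
  have hae : (fun x => deriv (dPhi φ) 1 * ((Q₁ i x * Q₁ j x - Q₂ i x * Q₂ j x) / p θ₀ x)) =ᵐ[lam]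
      fun x => partialD j (partialD i (hAt lam φ p x)) (θ₀, θ₀) * p θ₀ x - I * p θ₀ x +
        partialD j (partialD i (fpAt φ p x)) (θ₀, θ₀) := by
    filter_upwards [hm.regular] with x hx
    rcases hx with ⟨hx, hr⟩ | hx
    · rw [← hx.partialD_partialD_sub hm.divergence hm.smooth hm.ρ_pos hr,
        hm.partialD_partialD_hAt hx hr hz]
      change partialD j (partialD i (fpAt φ p x)) (θ₀, θ₀) - _ = _
      ring
    · have h0 := eqOn_partialD_zero Metric.isOpen_ball
        (eqOn_partialD_zero Metric.isOpen_ball (fpAt_eqOn_zero (φ := φ) hx) i) j hz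
      simp [hx θ₀ hθ, h0]
  have hint1 := (integrable_modelMeasure_iff (hm.measurable _ hθ) (hm.nonneg _ hθ)).1 (hmom.2.1 i j)
  have hint2 := (hm.integral_density hθ).1.const_mul I
  have hint12 : Integrable (fun x =>
      partialD j (partialD i (hAt lam φ p x)) (θ₀, θ₀) * p θ₀ x - I * p θ₀ x) lam :=
    hint1.sub hint2
  have hint3 := (hm.hasFDerivAt_integral_partialD hz i).1 j
  have key : ∫ x, partialD j (partialD i (hAt lam φ p x)) (θ₀, θ₀) ∂(modelMeasure lam p θ₀) =
      deriv (dPhi φ) 1 * ∫ x, (Q₁ i x * Q₁ j x - Q₂ i x * Q₂ j x) / p θ₀ x ∂lam := by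
    rw [← integral_const_mul, integral_congr_ae hae, integral_add hint12 hint3,
      integral_sub hint1 hint2, integral_const_mul, (hm.integral_density hθ).2, ← hI,
      hm.integral_model]
    ring
  rw [key]
  congr 1
  have e1 : ∀ (k : Fin d) x, Q₁ (Sum.inl k) x =
    lineDeriv ℝ (fun ϑ => p ϑ x) θ₀ (EuclideanSpace.single k 1) := fun k x => rfl
  have e2 : ∀ (k : Fin d) x, Q₁ (Sum.inr k) x = 0 := fun k x =>
    partialD_inr_fst (q := fun θ => p θ x) k θ₀ θ₀
  have e3 : ∀ (k : Fin d) x, Q₂ (Sum.inl k) x = 0 := fun k x =>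
    partialD_inl_snd (q := fun θ => p θ x) k θ₀ θ₀
  have e4 : ∀ (k : Fin d) x, Q₂ (Sum.inr k) x =
    lineDeriv ℝ (fun ϑ => p ϑ x) θ₀ (EuclideanSpace.single k 1) := fun k x => rfl
  rcases i with i | i <;> rcases j with j | j
  · simp [e1, e3, fisherInfo]
  · simp [e2, e3]
  · simp [e2, e3]
  · simp [e2, e4, fisherInfo, neg_div, integral_neg]

/-- As the matrix of second moments of the score it is positive semidefinite; nonsingularity
upgrades this to definiteness. -/
lemma posDef_fisherInfo (hmom : MomentCondition lam φ p θ₀) : (fisherInfo lam p θ₀).PosDef := by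
  have hL2 : ∀ i, MemLp (fun x => scoreFun p θ₀ x i) 2 (modelMeasure lam p θ₀) := fun i =>
    (EuclideanSpace.proj (𝕜 := ℝ) i).comp_memLp' (hm.memLp_scoreFun hmom)
  have hint : ∀ (u : Fin d → ℝ) i j,
      Integrable (fun x => u i * scoreFun p θ₀ x i * (u j * scoreFun p θ₀ x j))
        (modelMeasure lam p θ₀) := fun u i j =>
    ((hL2 i).const_mul (u i)).integrable_mul ((hL2 j).const_mul (u j))
  have hpsd : (fisherInfo lam p θ₀).PosSemidef := by
    refine Matrix.PosSemidef.of_dotProduct_mulVec_nonneg ?_ fun u => ?_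
    · ext i j
      simp [fisherInfo, mul_comm]
    · have : star u ⬝ᵥ (fisherInfo lam p θ₀).mulVec u =
          ∫ x, (∑ i, u i * scoreFun p θ₀ x i) ^ 2 ∂(modelMeasure lam p θ₀) := by
        simp_rw [sq, Finset.sum_mul_sum]
        rw [integral_finsetSum _ fun i _ => integrable_finsetSum _ fun j _ => hint u i j]
        simp only [dotProduct, Matrix.mulVec]
        refine Finset.sum_congr rfl fun i _ => ?_
        rw [integral_finsetSum _ fun j _ => hint u i j, Finset.mul_sum]
        refine Finset.sum_congr rfl fun j _ => ?_
        rw [← hm.integral_scoreFun_mul, ← integral_mul_const, ← integral_const_mul]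
        refine integral_congr_ae (ae_of_all _ fun x => ?_)
        simp
        ring
      rw [this]
      exact integral_nonneg fun x => sq_nonneg _
  exact hpsd.posDef_iff_isUnit.2 ((Matrix.isUnit_iff_isUnit_det _).2 hmom.2.2)

lemma exists_regularContrast (hmom : MomentCondition lam φ p θ₀)
    (hK : Integrable K (modelMeasure lam p θ₀))
    (hbound : ∀ᵐ x ∂(modelMeasure lam p θ₀), ∀ z ∈ Metric.ball (θ₀, θ₀) ρ, ∀ i j k,
      LineDifferentiableAt ℝ (partialD j (partialD i (hAt lam φ p x))) z (dir k) ∧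
        |partialD k (partialD j (partialD i (hAt lam φ p x))) z| ≤ K x) :
    ∃ s, RegularContrast (modelMeasure lam p θ₀) (contrast lam φ p) θ₀ s
      (fun x => Fintype.card (Fin d ⊕ Fin d) * |K x|) (fisherInfo lam p θ₀)
      (deriv (dPhi φ) 1) ρ := by
  have hP := hm.isProbabilityMeasure θ₀ (Metric.mem_ball_self hm.ρ_pos)
  have hs := hm.memLp_scoreFun hmom
  have hmk := hs.1.ae_eq_mk
  -- The score is only known to be almost everywhere measurable; a measurable version is used so
  -- that its values along the sample are independent random vectors.
  exact ⟨hs.1.mk _,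
    { c_pos := hm.pos_two
      ρ_pos := hm.ρ_pos
      measurable := fun z hz => hm.measurable_contrast hz
      integrable_bound := hK.abs.const_mul _
      bound_nonneg := fun x => by positivity
      measurable_score := hs.1.stronglyMeasurable_mk.measurable
      memLp_score := hs.ae_eq hmk
      integral_score := by
        rw [← integral_congr_ae hmk]
        ext i
        have := (EuclideanSpace.proj (𝕜 := ℝ) i).integral_comp_comm (hs.integrable (by norm_num))
        exact this.symm.trans (hm.integral_scoreFun i)
      posDef := hm.posDef_fisherInfo hmom
      integral_score_mul := fun i j => by
        rw [← hm.integral_scoreFun_mul]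
        exact integral_congr_ae (hmk.mono fun x hx => by simp only [hx])
      regular := by
        filter_upwards [hm.ae_pos_imp, hbound, hmk] with x hx hb hx'
        exact hm.regularPoint hx.1 hx.2 hb hx'.symm
      integrable_hess := hmom.2.1
      integral_hess := hm.integral_partialD_partialD_hAt hmom }⟩

end Moments

end LocalModel

end PhiDivergence
end

noncomputable section

namespace PhiDivergence

/-! ### From the model assumptions to a regular contrast, and conclusion. -/

variable {d : ℕ} {𝒳 : Type*} [MeasurableSpace 𝒳] {lam : Measure 𝒳} {φ : ℝ → ℝ≥0∞}
  {Θ : Set (EuclideanSpace ℝ (Fin d))} {p : EuclideanSpace ℝ (Fin d) → 𝒳 → ℝ}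
  {θT : EuclideanSpace ℝ (Fin d)}

lemma exists_regularContrast_of_isParametricModel (hφ : IsDivergenceFunction φ)
    (hφs : ContDiffOn ℝ 4 (realPhi φ) (intDom φ)) (hφ_two : 0 < deriv (dPhi φ) 1)
    (hp : IsParametricModel lam Θ p)
    (hp_smooth : ∀ᵐ x ∂lam, ContDiffOn ℝ 3 (fun θ => p θ x) (interior Θ))
    (hint : IntegrabilityCondition lam φ Θ p) (hdom : DominationCondition lam φ Θ p θT)
    (hmom : MomentCondition lam φ p θT) :
    ∃ s K ρ, Metric.ball θT ρ ⊆ Θ ∧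
      RegularContrast (modelMeasure lam p θT) (contrast lam φ p) θT s K
        (fisherInfo lam p θT) (deriv (dPhi φ) 1) ρ := by
  obtain ⟨N, hN, hθN, hNΘ, ⟨L, hL, hLb⟩, K, hK, hKb⟩ := hdom
  obtain ⟨ρ, hρ, hball⟩ := Metric.isOpen_iff.1 hN θT hθN
  have hΘ : Metric.ball θT ρ ⊆ Θ := hball.trans hNΘ
  have hΘi : Metric.ball θT ρ ⊆ interior Θ := interior_maximal hΘ Metric.isOpen_ball
  have hprod : ∀ z ∈ Metric.ball (θT, θT) ρ, z ∈ N ×ˢ N := fun z hz =>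
    ⟨hball (LocalModel.mem_fst hz), hball (LocalModel.mem_snd hz)⟩
  have hm : LocalModel lam φ p θT ρ L :=
    { divergence := hφ
      smooth := hφs
      pos_two := hφ_two
      ρ_pos := hρ
      measurable := fun θ hθ => hp.measurable θ (hΘ hθ)
      nonneg := fun θ hθ => hp.nonneg θ (hΘ hθ)
      isProbabilityMeasure := fun θ hθ => hp.isProbabilityMeasure θ (hΘ hθ)
      -- The integrability condition puts the ratios in the domain only for each fixed pair, with a
      -- null set depending on it. The derivative bound gives all pairs at once, and off the common
      -- support every density vanishes.
      regular := by
        obtain ⟨S, hS⟩ := hp.support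
        filter_upwards [hS, hp_smooth, hLb] with x hx hsm hb
        by_cases hxS : x ∈ S
        · have hq : SmoothPositive (fun θ => p θ x) θT ρ :=
            ⟨hsm.mono hΘi, fun θ hθ => (hx θ (hΘ hθ)).2 hxS⟩
          exact Or.inl ⟨hq, fun z hz =>
            hq.ratio_mem_intDom hφ hφs (L := L x) (fun z hz i => (hb z (hprod z hz)).1 i) hz⟩
        · exact Or.inr fun θ hθ => le_antisymm
            (not_lt.1 fun h => hxS ((hx θ (hΘ hθ)).1 h)) (hp.nonneg θ (hΘ hθ) x)
      integrable_bound := hL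
      bound := hLb.mono fun x hx z hz => (hx z (hprod z hz)).1
      bound_two := hLb.mono fun x hx z hz => (hx z (hprod z hz)).2
      integrable := fun z hz =>
        (hint z.1 (hNΘ (hprod z hz).1) z.2 (hNΘ (hprod z hz).2)).2 }
  obtain ⟨s, hs⟩ := hm.exists_regularContrast hmom hK
    (hKb.mono fun x hx z hz => hx z (hprod z hz))
  exact ⟨s, _, ρ, hΘ, hs⟩

lemma ballB_eq_closedBall {ρ : ℝ} (hΘ : Metric.ball θT ρ ⊆ Θ) {n : ℕ}
    (hn : (n : ℝ) ^ (-(1 / 3) : ℝ) < ρ) :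
    ballB Θ θT n = Metric.closedBall θT ((n : ℝ) ^ (-(1 / 3) : ℝ)) := by
  ext θ
  rw [ballB, mem_ofPred_eq, ← dist_eq_norm, Metric.mem_closedBall]
  exact ⟨fun h => h.2, fun h => ⟨hΘ (lt_of_le_of_lt h hn), h⟩⟩

/-- For large `n` the constraint `θ ∈ Θ` in `ballB` is void, so the interior of the product is the
open ball for the sup norm. -/
lemma isLocalMinMax_iff {ρ : ℝ} (hΘ : Metric.ball θT ρ ⊆ Θ) {n : ℕ} (hn0 : n ≠ 0)
    (hn : (n : ℝ) ^ (-(1 / 3) : ℝ) < ρ) {X : ℕ → 𝒳} {ϑ a : EuclideanSpace ℝ (Fin d)} :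
    IsLocalMinMax lam φ Θ p θT X n ϑ a ↔
      (ϑ, a) ∈ Metric.ball (θT, θT) ((n : ℝ) ^ (-(1 / 3) : ℝ)) ∧
      IsMinMaxOn (fun θ α => empMean X n (contrast lam φ p (θ, α)))
        (Metric.closedBall θT ((n : ℝ) ^ (-(1 / 3) : ℝ))) ϑ a := by
  -- Here `n ≠ 0` matters: for `n = 0` the real power is `0` and the ball degenerates to a point.
  have hr : (n : ℝ) ^ (-(1 / 3) : ℝ) ≠ 0 := by positivity
  rw [IsLocalMinMax, ballB_eq_closedBall hΘ hn, interior_prod_eq, interior_closedBall _ hr,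
    ball_prod_same]
  rfl

end PhiDivergence
end

theorem mainTheorem6 {d : ℕ} {𝒳 Ω : Type*} [MeasurableSpace 𝒳] [MeasurableSpace Ω]
    (Pr : Measure Ω) [IsProbabilityMeasure Pr]
    (φ : ℝ → ℝ≥0∞) (hφ : PhiDivergence.IsDivergenceFunction φ)
    (hφ_smooth : ContDiffOn ℝ 4 (PhiDivergence.realPhi φ) (PhiDivergence.intDom φ))
    (hφ_two : 0 < deriv (PhiDivergence.dPhi φ) 1)
    (lam : Measure 𝒳) [SigmaFinite lam]
    (Θ : Set (EuclideanSpace ℝ (Fin d))) (p : EuclideanSpace ℝ (Fin d) → 𝒳 → ℝ)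
    (hp : PhiDivergence.IsParametricModel lam Θ p)
    (hp_smooth : ∀ᵐ x ∂lam, ContDiffOn ℝ 3 (fun θ => p θ x) (interior Θ))
    (hint : PhiDivergence.IntegrabilityCondition lam φ Θ p)
    (θT : EuclideanSpace ℝ (Fin d)) (hθT : θT ∈ interior Θ)
    (hdom : PhiDivergence.DominationCondition lam φ Θ p θT)
    (hmom : PhiDivergence.MomentCondition lam φ p θT)
    (X : ℕ → Ω → 𝒳) (hX_meas : ∀ i, Measurable (X i)) (hX_indep : iIndepFun X Pr)
    (hX_law : ∀ i, Pr.map (X i) = PhiDivergence.modelMeasure lam p θT) :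
    -- almost surely, for all large `n`, interior min-max points exist, and they solve the scores
    (∀ᵐ ω ∂Pr, ∀ᶠ n : ℕ in atTop,
      (∃ ϑ a, PhiDivergence.IsLocalMinMax lam φ Θ p θT (fun i => X i ω) n ϑ a) ∧
      (∀ ϑ a, PhiDivergence.IsLocalMinMax lam φ Θ p θT (fun i => X i ω) n ϑ a →
        PhiDivergence.SolvesScores lam φ p (fun i => X i ω) n ϑ a)) ∧
    -- these points can be chosen measurably in the sample
    (∃ ϑ a : ℕ → Ω → EuclideanSpace ℝ (Fin d),
      (∀ n, AEMeasurable (ϑ n) Pr) ∧ (∀ n, AEMeasurable (a n) Pr) ∧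
      ∀ᵐ ω ∂Pr, ∀ᶠ n : ℕ in atTop,
        PhiDivergence.IsLocalMinMax lam φ Θ p θT (fun i => X i ω) n (ϑ n ω) (a n ω)) ∧
    -- any such choice is asymptotically normal
    (∀ ϑ a : ℕ → Ω → EuclideanSpace ℝ (Fin d),
      (∀ n, AEMeasurable (ϑ n) Pr) → (∀ n, AEMeasurable (a n) Pr) →
      (∀ᵐ ω ∂Pr, ∀ᶠ n : ℕ in atTop,
        PhiDivergence.IsLocalMinMax lam φ Θ p θT (fun i => X i ω) n (ϑ n ω) (a n ω)) →
      TendstoInDistribution (fun (n : ℕ) ω => √(n : ℝ) • (ϑ n ω - θT)) atTop id (fun _ => Pr)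
          (multivariateGaussian 0 (PhiDivergence.fisherInfo lam p θT)⁻¹) ∧
      TendstoInDistribution (fun (n : ℕ) ω => √(n : ℝ) • (a n ω - θT)) atTop id (fun _ => Pr)
          (multivariateGaussian 0 (PhiDivergence.fisherInfo lam p θT)⁻¹)) := by
  obtain ⟨s, K, ρ, hΘ, hc⟩ := PhiDivergence.exists_regularContrast_of_isParametricModel hφ
    hφ_smooth hφ_two hp hp_smooth hint hdom hmom
  have hlarge : ∀ᶠ n : ℕ in atTop, n ≠ 0 ∧ (n : ℝ) ^ (-(1 / 3) : ℝ) < ρ :=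
    (eventually_ne_atTop 0).and
      (PhiDivergence.tendsto_nat_rpow_neg.eventually_lt_const hc.ρ_pos)
  refine ⟨?_, ?_, fun ϑ a hϑ ha h => ?_⟩
  · filter_upwards [hc.ae_eventually_exists_unique hX_meas hX_indep hX_law] with ω hω
    filter_upwards [hω, hlarge] with n ⟨ϑ, a, hball, hmm, hscore, huniq⟩ ⟨hn0, hn⟩
    refine ⟨⟨ϑ, a, (PhiDivergence.isLocalMinMax_iff hΘ hn0 hn).2 ⟨hball, hmm⟩⟩, fun ϑ' a' h' => ?_⟩
    -- The score equations come from uniqueness: every min-max point is the zero of the gradient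
    -- already found. No derivative of the selection of maximizers is involved.
    obtain ⟨rfl, rfl⟩ := huniq ϑ' a' ((PhiDivergence.isLocalMinMax_iff hΘ hn0 hn).1 h').2
    exact ⟨fun i => hscore (Sum.inl i), fun i => hscore (Sum.inr i)⟩
  · obtain ⟨Z, hZ, hZmm⟩ := hc.exists_measurable_isMinMaxOn hX_meas hX_indep hX_law
    refine ⟨fun n ω => (Z n ω).1, fun n ω => (Z n ω).2, fun n => (hZ n).fst.aemeasurable,
      fun n => (hZ n).snd.aemeasurable, ?_⟩
    filter_upwards [hZmm] with ω hω
    filter_upwards [hω, hlarge] with n hn ⟨hn0, hn'⟩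
    exact (PhiDivergence.isLocalMinMax_iff hΘ hn0 hn').2 hn
  · refine hc.tendstoInDistribution_of_isMinMaxOn hX_meas hX_indep hX_law hϑ ha ?_
    filter_upwards [h] with ω hω
    filter_upwards [hω, hlarge] with n hn ⟨hn0, hn'⟩
    exact ((PhiDivergence.isLocalMinMax_iff hΘ hn0 hn').1 hn).2
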